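/- Let $0<T<\infty$ and let $u$ be a Leray–Hopf weak solution on $[0,T]$, with initial datum $u_0\in L^2(\mathbb R^3;\mathbb R^3)$, $\operatorname{div}u_0=0$, of the Navier–Stokes equations $$\partial_t u-\Delta u+u\cdot\nabla u+\nabla\Pi=0,\qquad \operatorname{div}u=0,\qquad u|_{t=0}=u_0\qquad\text{in }\mathbb R^3 .$$ That is: $u\in L^\infty(0,T;L^2(\mathbb R^3))$ with $\nabla u\in L^2(0,T;L^2(\mathbb R^3))$; $u$ is weakly continuous from $[0,T]$ to $L^2(\mathbb R^3)$ and $u(0)=u_0$; $u$ is divergence-free and solves the momentum equation in the sense of distributions, i.e. $\int_0^T\!\int_{\mathbb R^3}\big(u\cdot\partial_t\varphi-\nabla u:\nabla\varphi+u\otimes u:\nabla\varphi\big)\,dx\,dt=-\int_{\mathbb R^3}u_0\cdot\varphi(0)\,dx$ for all divergence-free $\varphi\in C_c^\infty([0,T)\times\mathbb R^3;\mathbb R^3)$; and $\tfrac12\|u(t)\|_{L^2}^2+\int_0^t\|\nabla u\|_{L^2}^2\,ds\le\tfrac12\|u_0\|_{L^2}^2$ for all $t\in[0,T]$. Write $u=(u_1,u_2,u_3)$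 and $u_h=(u_1,u_2)$. Suppose that one of the following three conditions holds (exponents lie in $[1,\infty]$ with $1/\infty=0$, and $\frac{2p}{p-2}=2$ for $p=\infty$): 1. $u_h\in L^p(0,T;L^q(\mathbb R^3))$ and $u_3\in L^{\frac{2p}{p-2}}(0,T;L^{\frac{2q}{q-2}}(\mathbb R^3))$ for some $p,q$ with $\frac2p+\frac2q=1$ and $4\le q<\infty$; 2. $u_h\in L^p(0,T;L^q(\mathbb R^3))$ and $u_3\in L^{\frac{2p}{p-2}}(0,T;L^{\frac{2q}{q-2}}(\mathbb R^3))$ for some $p,q$ with $\frac1p+\frac3q=1$ and $q\le4$; 3. each of the three components of $u$ belongs, with exponents of its own, to the Shinbrot class or to the Beirão da Veiga–Yang class: there is a set $S\subseteq\{1,2,3\}$ such that for every $i\in S$ one has $u_i\in L^{p_i}(0,T;L^{q_i}(\mathbb R^3))$ for some $p_i,q_i$ with $\frac2{p_i}+\frac2{q_i}=1$, $q_i\ge4$, and for every $j\in\{1,2,3\}\setminus S$ one has $u_j\in L^{p_j}(0,T;L^{q_j}(\mathbb R^3))$ for some $p_j,q_j$ with $\frac1{p_j}+\frac3{q_j}=1$,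 $q_j\le4$. Then for every $t\in[0,T]$ the energy equality holds: $$\tfrac12\|u(t)\|_{L^2(\mathbb R^3)}^2+\int_0^t\|\nabla u(s)\|_{L^2(\mathbb R^3)}^2\,ds=\tfrac12\|u_0\|_{L^2(\mathbb R^3)}^2 .$$ -/

import Mathlib

open MeasureTheory Set
open scoped ENNReal ContDiff

namespace NavierStokes

/-- Three-dimensional Euclidean space. -/
abbrev E3 : Type := EuclideanSpace ℝ (Fin 3)

/-- The classical partial derivative `∂ᵢ f (x)` of a scalar function. -/
noncomputable def pderiv (i : Fin 3) (f : E3 → ℝ) (x : E3) : ℝ :=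
  fderiv ℝ f x (EuclideanSpace.single i 1)

/-- Lebesgue measure on the space-time slab `(0,T) × ℝ³`. -/
noncomputable def slab (T : ℝ) : Measure (ℝ × E3) :=
  ((volume : Measure ℝ).restrict (Ioo 0 T)).prod (volume : Measure E3)

/-- Scalar test functions `C_c^∞(ℝ³)`. -/
def IsTest (ψ : E3 → ℝ) : Prop :=
  ContDiff ℝ ∞ ψ ∧ HasCompactSupport ψ

/-- Divergence-free vector test fields in `C_c^∞([0,T) × ℝ³; ℝ³)`, written as restrictions of
smooth compactly supported fields on `ℝ × ℝ³` that vanish near all times `t ≥ T`. -/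
structure IsSolenoidalTest (T : ℝ) (φ : ℝ → E3 → E3) : Prop where
  smooth : ContDiff ℝ ∞ (fun z : ℝ × E3 => φ z.1 z.2)
  compact_support : HasCompactSupport (fun z : ℝ × E3 => φ z.1 z.2)
  support_lt : tsupport (fun z : ℝ × E3 => φ z.1 z.2) ⊆ Iio T ×ˢ univ
  div_free : ∀ t x, ∑ i, pderiv i (fun y => φ t y i) x = 0

/-- `div v = 0` in the sense of distributions on `ℝ³`. -/
def WeakDivFree (v : E3 → E3) : Prop :=
  ∀ ψ : E3 → ℝ, IsTest ψ → ∫ x, ∑ i, v x i * pderiv i ψ x = 0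

/-- `g i j` is the distributional derivative `∂ᵢ vⱼ` on `ℝ³`. -/
def IsWeakGradient (v : E3 → E3) (g : E3 → Fin 3 → Fin 3 → ℝ) : Prop :=
  ∀ ψ : E3 → ℝ, IsTest ψ → ∀ i j, ∫ x, v x j * pderiv i ψ x = -∫ x, g x i j * ψ x

/-- The mixed norm `‖f‖_{L^p(0,T; L^q(ℝ³))}`. -/
noncomputable def mixedNorm {F : Type*} [NormedAddCommGroup F]
    (T : ℝ) (p q : ℝ≥0∞) (f : ℝ → E3 → F) : ℝ≥0∞ :=
  eLpNorm (fun t => eLpNorm (f t) q (volume : Measure E3)) p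
    ((volume : Measure ℝ).restrict (Ioo 0 T))

/-- `f ∈ L^p(0,T; L^q(ℝ³))`. -/
def MemLpLq {F : Type*} [NormedAddCommGroup F]
    (T : ℝ) (p q : ℝ≥0∞) (f : ℝ → E3 → F) : Prop :=
  AEStronglyMeasurable (fun z : ℝ × E3 => f z.1 z.2) (slab T) ∧ mixedNorm T p q f < ⊤

/-- Kinetic energy `½ ‖v‖²_{L²}`. -/
noncomputable def energy (v : E3 → E3) : ℝ :=
  (1 / 2) * ∫ x, ‖v x‖ ^ 2

/-- Dissipation `∫₀ᵗ ‖∇u(s)‖²_{L²} ds`, where `G` is the gradient of `u`. -/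
noncomputable def dissipation (G : ℝ → E3 → Fin 3 → Fin 3 → ℝ) (t : ℝ) : ℝ :=
  ∫ s in Ioo 0 t, ∫ x, ∑ i, ∑ j, (G s x i j) ^ 2

/-- `u` is a Leray–Hopf weak solution on `[0,T]`, with initial datum `u₀`, of
`∂ₜu - Δu + (u·∇)u + ∇Π = 0`, `div u = 0` in `ℝ³`; `G t x i j` is the weak derivative `∂ᵢ uⱼ`.
As usual `u` is the representative that is weakly continuous in `L²`, and the
pressure is eliminated by testing with divergence-free fields. -/
structure IsLerayHopf (T : ℝ) (u₀ : E3 → E3) (u : ℝ → E3 → E3)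
    (G : ℝ → E3 → Fin 3 → Fin 3 → ℝ) : Prop where
  initial_memLp : MemLp u₀ 2 (volume : Measure E3)
  initial_div_free : WeakDivFree u₀
  /-- `u ∈ L^∞(0,T; L²)`. -/
  bounded : MemLpLq T ⊤ 2 u
  /-- `u(t) ∈ L²` for every `t ∈ [0,T]`. -/
  memLp : ∀ t ∈ Icc 0 T, MemLp (u t) 2 (volume : Measure E3)
  /-- `∇u ∈ L²(0,T; L²)`. -/
  grad_memLp : ∀ i j, MemLp (fun z : ℝ × E3 => G z.1 z.2 i j) 2 (slab T)
  grad : ∀ᵐ t ∂((volume : Measure ℝ).restrict (Ioo 0 T)), IsWeakGradient (u t) (G t)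
  div_free : ∀ t ∈ Icc 0 T, WeakDivFree (u t)
  /-- `u ∈ C_w([0,T]; L²)`. -/
  weak_continuous : ∀ ψ : E3 → E3, MemLp ψ 2 (volume : Measure E3) →
    ContinuousOn (fun t => ∫ x, inner ℝ (u t x) (ψ x)) (Icc 0 T)
  initial : u 0 =ᵐ[volume] u₀
  /-- The momentum equation in the sense of distributions. -/
  momentum : ∀ φ : ℝ → E3 → E3, IsSolenoidalTest T φ →
    ∫ t in Ioo 0 T, ∫ x,
        (inner ℝ (u t x) (deriv (fun s => φ s x) t)
          - ∑ i, ∑ j, G t x i j * pderiv i (fun y => φ t y j) x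
          + ∑ i, ∑ j, u t x i * u t x j * pderiv i (fun y => φ t y j) x)
      = -∫ x, inner ℝ (u₀ x) (φ 0 x)
  energy_inequality : ∀ t ∈ Icc 0 T, energy (u t) + dissipation G t ≤ energy u₀

/-- The exponent `2p/(p-2)`, with its limiting value `2` at `p = ∞`; used for `2 < p ≤ ∞`. -/
noncomputable def dualExponent (p : ℝ≥0∞) : ℝ≥0∞ :=
  if p = ⊤ then 2 else 2 * p / (p - 2)

/-- The exponents of Shinbrot's class: `2/p + 2/q = 1`, `q ≥ 4`. -/
def ShinbrotExponents (p q : ℝ≥0∞) : Prop :=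
  2 / p + 2 / q = 1 ∧ 4 ≤ q

/-- The exponents of the Beirão da Veiga–Yang class: `1/p + 3/q = 1`, `q ≤ 4`
(so `3 ≤ q`, with `p = ∞` when `q = 3`). -/
def BeiraoDaVeigaYangExponents (p q : ℝ≥0∞) : Prop :=
  1 / p + 3 / q = 1 ∧ q ≤ 4

end NavierStokes

/-! Mollify in space only. Write `f_ε = ρ_ε * f` with an even kernel. Testing the momentum equation
with `ρ_ε * φ` shows that, against solenoidal fields, `∂ₜu_ε = Δu_ε - div (u ⊗ u)_ε`. All
derivatives on the right can be put on the kernel, so for fixed `ε` the right-hand side is bounded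
in `L²` uniformly in time by the energy alone, and `t ↦ u_ε(t)` is Lipschitz in `L²`. Solenoidal
test fields are dense among divergence-free `L²` fields (`mem_closure_solenoidal`), so `u_ε` itself
is an admissible test vector. With `energy_identity_of_weak` this gives
`IsLerayHopf.mollified_energy`: the energy of `u_ε` changes at the rate `-‖∇u_ε‖² + N_ε`, where `N_ε
= ∑ ∫ (uᵢuⱼ)_ε ∂ᵢ(uⱼ)_ε`.

It remains to show that the time integral of `N_ε` tends to zero. At a fixed time compare `N_ε` with
`∑ ∫ (uᵢ)_ε (uⱼ)_ε ∂ᵢ(uⱼ)_ε`, which vanishes because `u_ε` is divergence-free. If `(i,j) ≠ (3,3)`,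
Hölder gives `uᵢuⱼ ∈ L²`: use `u_h ∈ L⁴` for two horizontal components, and `u_h ∈ L^q`, `u₃ ∈ L^r`
with `1/q + 1/r = 1/2` for a mixed product. Both regularizations of the product then converge to it
in `L²`, while `∂ᵢ(uⱼ)_ε` converges in `L²`.

The product `u₃²` need not be in `L²`. There `∂₃u₃ = -∂₁u₁ - ∂₂u₂` and an integration by parts turn
the term into `2 ∑ ∫ (u₃ ∂ᵢu₃)_ε (uᵢ)_ε` over horizontal `i`. Now `u₃ ∂ᵢu₃ ∈ L^s` with `1/s = 1/r +
1/2`, which is dual to `uᵢ ∈ L^q`. Hence `N_ε → 0` at almost every time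
(`IsRegularSlice.tendsto_convective`). The same Hölder bounds give a majorant independent of `ε`
(`IsRegularSlice.enorm_convective_le`), built from `‖u_h‖₄⁴`, `(‖u_h‖_q ‖u₃‖_r)²` and `‖∇u‖₂²`;
dominated convergence yields `IsLerayHopf.energy_equality`.

Integrability of the majorant in time comes from interpolation. A component in Shinbrot's class is
in `L⁴L⁴` by interpolation with `L^∞L²`, one in the Beirão da Veiga–Yang class by interpolation with
`L²L⁶`, which is available through Sobolev. The dual exponents make `‖u_h‖_q ‖u₃‖_r` square
integrable in time. In the third case all components are in `L⁴L⁴` and `q = r = 4` works. -/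

namespace NavierStokes

open Filter Topology
open scoped NNReal Convolution

/-! ### Convolution on `ℝ³` and Young's inequality -/

/-- The convolution of a kernel `k` with `f`. -/
noncomputable def conv (k f : E3 → ℝ) (x : E3) : ℝ := ∫ y, f y * k (x - y)

lemma conv_eq_convolution (k f : E3 → ℝ) :
    conv k f = f ⋆[ContinuousLinearMap.mul ℝ ℝ, volume] k := rfl

lemma conv_swap (k f : E3 → ℝ) : conv k f = conv f k := by
  funext x
  have h := integral_sub_left_eq_self (fun y => f y * k (x - y)) (volume : Measure E3) x
  simp only [sub_sub_cancel] at h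
  simp only [conv]
  rw [← h]
  simp_rw [mul_comm]

lemma aestronglyMeasurable_sub_left {k : E3 → ℝ} (hk : AEStronglyMeasurable k volume) (x : E3) :
    AEStronglyMeasurable (fun y => k (x - y)) volume :=
  hk.comp_quasiMeasurePreserving (quasiMeasurePreserving_sub_left volume x)

lemma aestronglyMeasurable_conv_integrand {k f : E3 → ℝ} (hk : AEStronglyMeasurable k volume)
    (hf : AEStronglyMeasurable f volume) :
    AEStronglyMeasurable (fun z : E3 × E3 => f z.2 * k (z.1 - z.2))
      ((volume : Measure E3).prod volume) :=
  hf.convolution_integrand (ContinuousLinearMap.mul ℝ ℝ) hk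

lemma aestronglyMeasurable_conv {k f : E3 → ℝ} (hk : AEStronglyMeasurable k volume)
    (hf : AEStronglyMeasurable f volume) : AEStronglyMeasurable (conv k f) volume :=
  (aestronglyMeasurable_conv_integrand hk hf).integral_prod_right'

/-- Jensen's inequality for the weight `a`, without normalizing its mass: Hölder is applied to the
factorization `a b = a^(1-1/r) (a b^r)^(1/r)`. -/
lemma lintegral_mul_rpow_le {α : Type*} [MeasurableSpace α] {μ : Measure α} {a b : α → ℝ≥0∞}
    (ha : AEMeasurable a μ) (hb : AEMeasurable b μ) {r : ℝ} (hr : 1 ≤ r) :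
    (∫⁻ y, a y * b y ∂μ) ^ r ≤ (∫⁻ y, a y ∂μ) ^ (r - 1) * ∫⁻ y, a y * b y ^ r ∂μ := by
  have hr0 : 0 < r := by linarith
  have hinv : r⁻¹ ≤ 1 := inv_le_one_of_one_le₀ hr
  have hinv0 : 0 ≤ r⁻¹ := by positivity
  have h := ENNReal.lintegral_mul_norm_pow_le (f := a) (g := fun y => a y * b y ^ r) (μ := μ) ha
    (ha.mul (hb.pow_const r)) (p := 1 - r⁻¹) (q := r⁻¹) (by linarith) hinv0 (by ring)
  have h' : ∀ y, a y ^ (1 - r⁻¹) * (a y * b y ^ r) ^ r⁻¹ = a y * b y := by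
    intro y
    rw [ENNReal.mul_rpow_of_nonneg _ _ hinv0, ← ENNReal.rpow_mul, mul_inv_cancel₀ hr0.ne',
      ENNReal.rpow_one, ← mul_assoc, ← ENNReal.rpow_add_of_nonneg _ _ (by linarith) hinv0]
    simp
  simp_rw [h'] at h
  calc (∫⁻ y, a y * b y ∂μ) ^ r
      ≤ ((∫⁻ y, a y ∂μ) ^ (1 - r⁻¹) * (∫⁻ y, a y * b y ^ r ∂μ) ^ r⁻¹) ^ r := by gcongr
    _ = _ := by
      rw [ENNReal.mul_rpow_of_nonneg _ _ hr0.le, ← ENNReal.rpow_mul, ← ENNReal.rpow_mul,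
        inv_mul_cancel₀ hr0.ne', ENNReal.rpow_one]
      congr 2
      field_simp

/-- Young's convolution inequality `L¹ * Lᵖ ⊆ Lᵖ`. -/
lemma eLpNorm_conv_le {k f : E3 → ℝ} (hk : AEStronglyMeasurable k volume)
    (hf : AEStronglyMeasurable f volume) {p : ℝ≥0∞} (hp : 1 ≤ p) (hp' : p ≠ ⊤) :
    eLpNorm (conv k f) p volume ≤ eLpNorm k 1 volume * eLpNorm f p volume := by
  have hp0 : p ≠ 0 := (zero_lt_one.trans_le hp).ne'
  have hr : 1 ≤ p.toReal := by
    simpa using (ENNReal.toReal_le_toReal ENNReal.one_ne_top hp').2 hp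
  set r := p.toReal
  have hr0 : 0 < r := by linarith
  set A := eLpNorm k 1 volume with hA
  have hA' : A = ∫⁻ x, ‖k x‖ₑ := eLpNorm_one_eq_lintegral_enorm
  have hAx : ∀ x, ∫⁻ y, ‖k (x - y)‖ₑ = A := fun x => by
    rw [hA', lintegral_sub_left_eq_self (fun y => ‖k y‖ₑ) x]
  have hAy : ∀ y, ∫⁻ x, ‖k (x - y)‖ₑ = A := fun y => by
    rw [hA', lintegral_sub_right_eq_self (fun y => ‖k y‖ₑ) y]
  have hmeas : AEMeasurable (fun z : E3 × E3 => ‖k (z.1 - z.2)‖ₑ * ‖f z.2‖ₑ ^ r)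
      ((volume : Measure E3).prod volume) := by
    have h1 : AEStronglyMeasurable (fun z : E3 × E3 => k (z.1 - z.2))
        ((volume : Measure E3).prod volume) :=
      hk.comp_quasiMeasurePreserving (quasiMeasurePreserving_sub_of_right_invariant volume volume)
    have h2 : AEStronglyMeasurable (fun z : E3 × E3 => f z.2)
        ((volume : Measure E3).prod volume) := hf.comp_snd
    exact h1.enorm.mul (h2.enorm.pow_const r)
  -- Jensen for the weight `|k(x - ·)|` of mass `A` costs `A ^ (r - 1)`; Tonelli then contributes
  -- one more factor `A`.
  have key : ∫⁻ x, ‖conv k f x‖ₑ ^ r ≤ A ^ r * ∫⁻ y, ‖f y‖ₑ ^ r := by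
    calc ∫⁻ x, ‖conv k f x‖ₑ ^ r
        ≤ ∫⁻ x, A ^ (r - 1) * ∫⁻ y, ‖k (x - y)‖ₑ * ‖f y‖ₑ ^ r := by
          refine lintegral_mono fun x => ?_
          have h1 : ‖conv k f x‖ₑ ≤ ∫⁻ y, ‖k (x - y)‖ₑ * ‖f y‖ₑ := by
            refine (enorm_integral_le_lintegral_enorm _).trans_eq ?_
            simp_rw [enorm_mul, mul_comm]
          have h2 := lintegral_mul_rpow_le (aestronglyMeasurable_sub_left hk x).enorm hf.enorm hr
          rw [hAx x] at h2
          exact (ENNReal.rpow_le_rpow h1 hr0.le).trans h2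
      _ = A ^ (r - 1) * ∫⁻ x, ∫⁻ y, ‖k (x - y)‖ₑ * ‖f y‖ₑ ^ r :=
          lintegral_const_mul'' _ hmeas.lintegral_prod_right'
      _ = A ^ (r - 1) * ∫⁻ y, ∫⁻ x, ‖k (x - y)‖ₑ * ‖f y‖ₑ ^ r := by
          rw [lintegral_lintegral_swap hmeas]
      _ = A ^ (r - 1) * ∫⁻ y, A * ‖f y‖ₑ ^ r := by
          congr 1
          refine lintegral_congr fun y => ?_
          rw [lintegral_mul_const' _ _ (ENNReal.rpow_ne_top_of_nonneg hr0.le enorm_ne_top), hAy]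
      _ = A ^ r * ∫⁻ y, ‖f y‖ₑ ^ r := by
          rw [lintegral_const_mul'' _ (hf.enorm.pow_const r), ← mul_assoc]
          congr 1
          nth_rw 2 [← ENNReal.rpow_one A]
          rw [← ENNReal.rpow_add_of_nonneg _ _ (by linarith) zero_le_one]
          congr 1; ring
  rw [eLpNorm_eq_lintegral_rpow_enorm_toReal hp0 hp', eLpNorm_eq_lintegral_rpow_enorm_toReal hp0 hp']
  calc (∫⁻ x, ‖conv k f x‖ₑ ^ r) ^ (1 / r)
      ≤ (A ^ r * ∫⁻ y, ‖f y‖ₑ ^ r) ^ (1 / r) := by gcongr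
    _ = _ := by
      rw [ENNReal.mul_rpow_of_nonneg _ _ (by positivity), ← ENNReal.rpow_mul,
        mul_one_div_cancel hr0.ne', ENNReal.rpow_one]

/-! ### Smooth kernels: bounds, derivatives and adjoint of a convolution -/

lemma IsTest.continuous {k : E3 → ℝ} (hk : IsTest k) : Continuous k := hk.1.continuous

lemma IsTest.memLp {k : E3 → ℝ} (hk : IsTest k) (p : ℝ≥0∞) : MemLp k p volume :=
  hk.continuous.memLp_of_hasCompactSupport hk.2

lemma memLp_conv {k f : E3 → ℝ} (hk : MemLp k 1 volume) {p : ℝ≥0∞} (hf : MemLp f p volume)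
    (hp : 1 ≤ p) (hp' : p ≠ ⊤) : MemLp (conv k f) p volume :=
  ⟨aestronglyMeasurable_conv hk.1 hf.1,
    (eLpNorm_conv_le hk.1 hf.1 hp hp').trans_lt (ENNReal.mul_lt_top hk.2 hf.2)⟩

lemma eLpNorm_sub_left (k : E3 → ℝ) (hk : AEStronglyMeasurable k volume) (p : ℝ≥0∞) (x : E3) :
    eLpNorm (fun y => k (x - y)) p volume = eLpNorm k p volume :=
  eLpNorm_comp_measurePreserving hk (Measure.measurePreserving_sub_left volume x)

/-- The pointwise bound `‖k * f‖_∞ ≤ ‖k‖_{p'} ‖f‖_p`. -/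
lemma enorm_conv_le {k f : E3 → ℝ} (hk : AEStronglyMeasurable k volume)
    (hf : AEStronglyMeasurable f volume) (p q : ℝ≥0∞) [ENNReal.HolderTriple p q 1] (x : E3) :
    ‖conv k f x‖ₑ ≤ eLpNorm f p volume * eLpNorm k q volume := by
  calc ‖conv k f x‖ₑ ≤ ∫⁻ y, ‖f y * k (x - y)‖ₑ := enorm_integral_le_lintegral_enorm _
    _ = eLpNorm (f • fun y => k (x - y)) 1 volume := by
      rw [eLpNorm_one_eq_lintegral_enorm]; rfl
    _ ≤ eLpNorm f p volume * eLpNorm (fun y => k (x - y)) q volume :=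
      eLpNorm_smul_le_mul_eLpNorm (aestronglyMeasurable_sub_left hk x) hf
    _ = _ := by rw [eLpNorm_sub_left k hk]

lemma exists_bound_conv {k f : E3 → ℝ} (p q : ℝ≥0∞) [ENNReal.HolderTriple p q 1]
    (hk : MemLp k q volume) (hf : MemLp f p volume) : ∃ C : ℝ, ∀ x, |conv k f x| ≤ C := by
  have hfin := ENNReal.mul_ne_top hf.2.ne hk.2.ne
  refine ⟨(eLpNorm f p volume * eLpNorm k q volume).toReal, fun x => ?_⟩
  have h := ENNReal.toReal_mono hfin (enorm_conv_le hk.1 hf.1 p q x)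
  simpa using h

lemma integrable_conv_integrand {k f : E3 → ℝ} (hk : IsTest k) (hf : LocallyIntegrable f volume)
    (x : E3) : Integrable (fun y => f y * k (x - y)) volume :=
  hk.2.convolutionExists_right (ContinuousLinearMap.mul ℝ ℝ) hf hk.continuous x

lemma conv_sub {k f g : E3 → ℝ} (hk : IsTest k) (hf : LocallyIntegrable f volume)
    (hg : LocallyIntegrable g volume) : conv k (f - g) = conv k f - conv k g := by
  funext x
  simp only [conv, Pi.sub_apply, sub_mul]
  exact integral_sub (integrable_conv_integrand hk hf x) (integrable_conv_integrand hk hg x)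

lemma contDiff_conv {k f : E3 → ℝ} (hk : IsTest k) (hf : LocallyIntegrable f volume) :
    ContDiff ℝ ∞ (conv k f) :=
  hk.2.contDiff_convolution_right (n := ⊤) (ContinuousLinearMap.mul ℝ ℝ) hf hk.1

lemma IsTest.pderiv {k : E3 → ℝ} (hk : IsTest k) (i : Fin 3) : IsTest (pderiv i k) := by
  refine ⟨?_, ?_⟩
  · exact (hk.1.fderiv_right (m := ∞) (by simp)).clm_apply contDiff_const
  · exact (hk.2.fderiv_apply ℝ (EuclideanSpace.single i 1))

lemma pderiv_conv {k f : E3 → ℝ} (hk : IsTest k) (hf : LocallyIntegrable f volume) (i : Fin 3)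
    (x : E3) : NavierStokes.pderiv i (conv k f) x = conv (NavierStokes.pderiv i k) f x := by
  have hk1 : ContDiff ℝ 1 k := hk.1.of_le (by simp)
  have h := hk.2.hasFDerivAt_convolution_right (ContinuousLinearMap.mul ℝ ℝ) hf hk1 x
  rw [NavierStokes.pderiv, conv_eq_convolution, h.fderiv,
    convolution_precompR_apply (ContinuousLinearMap.mul ℝ ℝ) hf (hk.2.fderiv ℝ)
      (hk1.continuous_fderiv one_ne_zero)]
  rfl

lemma IsTest.conv {k ψ : E3 → ℝ} (hk : IsTest k) (hψ : IsTest ψ) : IsTest (conv k ψ) :=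
  ⟨contDiff_conv hk hψ.continuous.locallyIntegrable,
    hψ.2.convolution (ContinuousLinearMap.mul ℝ ℝ) hk.2⟩

lemma IsTest.sub_left {k : E3 → ℝ} (hk : IsTest k) (x : E3) : IsTest (fun y => k (x - y)) :=
  ⟨hk.1.comp (contDiff_const.sub contDiff_id), hk.2.comp_homeomorph (Homeomorph.subLeft x)⟩

lemma pderiv_sub_left {k : E3 → ℝ} (hk : IsTest k) (x y : E3) (i : Fin 3) :
    NavierStokes.pderiv i (fun y => k (x - y)) y = -NavierStokes.pderiv i k (x - y) := by
  have h1 : HasFDerivAt k (fderiv ℝ k (x - y)) (x - y) :=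
    (hk.1.differentiable (by simp) _).hasFDerivAt
  have h2 : HasFDerivAt (fun y : E3 => x - y) (-ContinuousLinearMap.id ℝ E3) y :=
    (hasFDerivAt_id y).const_sub x
  have h3 : HasFDerivAt (fun y => k (x - y)) _ y := h1.comp y h2
  rw [NavierStokes.pderiv, h3.fderiv]
  simp [NavierStokes.pderiv]

/-- Convolution with the reflected kernel is the adjoint of convolution. -/
lemma integral_conv_mul {k f g : E3 → ℝ} (hk : IsTest k) {p q : ℝ≥0∞} [ENNReal.HolderTriple p q 1]
    (hf : MemLp f p volume) (hg : MemLp g q volume) (hp : 1 ≤ p) (hp' : p ≠ ⊤) :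
    ∫ x, conv k f x * g x = ∫ y, f y * conv (fun z => k (-z)) g y := by
  -- Fubini is justified by `|k| * |f| ∈ L^p` (Young) paired with `|g| ∈ L^q`.
  have hint : Integrable (fun z : E3 × E3 => f z.2 * k (z.1 - z.2) * g z.1)
      ((volume : Measure E3).prod volume) := by
    have hm := (aestronglyMeasurable_conv_integrand hk.continuous.aestronglyMeasurable hf.1).mul
      (hg.1.comp_fst (ν := (volume : Measure E3)))
    change Integrable ((fun z : E3 × E3 => f z.2 * k (z.1 - z.2)) * fun z => g z.1) _
    refine (integrable_prod_iff hm).2 ⟨Eventually.of_forall fun x =>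
      (integrable_conv_integrand hk (hf.locallyIntegrable hp) x).mul_const (g x), ?_⟩
    have h1 : MemLp (conv (fun x => ‖k x‖) (fun x => ‖f x‖)) p volume :=
      memLp_conv (hk.memLp 1).norm hf.norm hp hp'
    have h2 : Integrable (fun x => conv (fun x => ‖k x‖) (fun x => ‖f x‖) x * ‖g x‖) volume :=
      memLp_one_iff_integrable.1 (hg.norm.mul h1)
    refine h2.congr (Eventually.of_forall fun x => ?_)
    simp only [Pi.mul_apply, norm_mul, integral_mul_const, NavierStokes.conv]
  calc ∫ x, conv k f x * g x = ∫ x, ∫ y, f y * k (x - y) * g x := by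
        simp only [NavierStokes.conv, integral_mul_const]
    _ = ∫ y, ∫ x, f y * k (x - y) * g x := integral_integral_swap hint
    _ = _ := by
        refine integral_congr_ae (Eventually.of_forall fun y => ?_)
        simp only [NavierStokes.conv, neg_sub, ← integral_const_mul]
        exact integral_congr_ae (Eventually.of_forall fun x => by ring)

/-! ### The standard mollifier and convergence in `L^p` -/

/-- A bump function at the origin supported in the ball of radius `1 / (n + 1)`. -/
noncomputable def bump (n : ℕ) : ContDiffBump (0 : E3) where
  rIn := 1 / (2 * ((n : ℝ) + 1))
  rOut := 1 / ((n : ℝ) + 1)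
  rIn_pos := by positivity
  rIn_lt_rOut := by
    apply one_div_lt_one_div_of_lt <;> nlinarith [(Nat.cast_nonneg n : (0 : ℝ) ≤ n)]

/-- The standard mollifier. -/
noncomputable def moll (n : ℕ) : E3 → ℝ := (bump n).normed volume

lemma isTest_moll (n : ℕ) : IsTest (moll n) :=
  ⟨(bump n).contDiff_normed (n := ⊤), (bump n).hasCompactSupport_normed⟩

lemma moll_neg (n : ℕ) (x : E3) : moll n (-x) = moll n x := (bump n).normed_neg x

lemma eLpNorm_moll (n : ℕ) : eLpNorm (moll n) 1 volume = 1 := by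
  have h := ofReal_integral_eq_lintegral_ofReal ((bump n).integrable_normed (μ := volume))
    (Eventually.of_forall fun x => (bump n).nonneg_normed x)
  rw [(bump n).integral_normed] at h
  rw [eLpNorm_one_eq_lintegral_enorm, ← ENNReal.ofReal_one, h]
  refine lintegral_congr fun x => ?_
  exact Real.enorm_of_nonneg ((bump n).nonneg_normed x)

lemma eLpNorm_conv_moll_le (n : ℕ) {f : E3 → ℝ} (hf : AEStronglyMeasurable f volume)
    {p : ℝ≥0∞} (hp : 1 ≤ p) (hp' : p ≠ ⊤) :
    eLpNorm (conv (moll n) f) p volume ≤ eLpNorm f p volume := by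
  simpa [eLpNorm_moll] using
    eLpNorm_conv_le (isTest_moll n).continuous.aestronglyMeasurable hf hp hp'

lemma memLp_conv_moll {f : E3 → ℝ} {p : ℝ≥0∞} (hf : MemLp f p volume) (hp : 1 ≤ p) (hp' : p ≠ ⊤)
    (n : ℕ) : MemLp (conv (moll n) f) p volume :=
  memLp_conv ((isTest_moll n).memLp 1) hf hp hp'

lemma dist_conv_moll_le {g : E3 → ℝ} (hg : AEStronglyMeasurable g volume) {n : ℕ} {x : E3} {ε : ℝ}
    (h : ∀ y, dist y x < 1 / ((n : ℝ) + 1) → dist (g y) (g x) ≤ ε) :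
    dist (conv (moll n) g x) (g x) ≤ ε := by
  rw [conv_swap]
  exact (bump n).dist_normed_convolution_le (μ := volume) hg fun y hy => h y hy

/-- Uniform continuity makes the error uniformly small, and the error lives in the closed unit
neighbourhood `K` of the support, which has finite measure. For `p = ⊤` the exponent `p.toReal⁻¹` is
`0`, so the same estimate applies. -/
lemma tendsto_conv_moll_of_continuous {g : E3 → ℝ} (hg : Continuous g) (hc : HasCompactSupport g)
    {p : ℝ≥0∞} :
    Tendsto (fun n => eLpNorm (conv (moll n) g - g) p volume) atTop (𝓝 0) := by
  set K := Metric.cthickening 1 (tsupport g)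
  have hK : IsCompact K := hc.isCompact.cthickening
  have hKv : volume K ≠ ⊤ := hK.measure_lt_top.ne
  have hp1 : (0 : ℝ) ≤ p.toReal⁻¹ := by positivity
  have hC : (volume K) ^ p.toReal⁻¹ ≠ ⊤ := ENNReal.rpow_ne_top_of_nonneg hp1 hKv
  rw [ENNReal.tendsto_nhds_zero]
  intro ε hε
  obtain ⟨δ, hδ, hδε⟩ : ∃ δ : ℝ, 0 < δ ∧ (volume K) ^ p.toReal⁻¹ * ENNReal.ofReal δ ≤ ε := by
    have ht : Tendsto (fun δ : ℝ => (volume K) ^ p.toReal⁻¹ * ENNReal.ofReal δ) (𝓝[>] 0) (𝓝 0) := by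
      have h1 : Tendsto (fun δ : ℝ => ENNReal.ofReal δ) (𝓝[>] 0) (𝓝 0) := by
        have := (ENNReal.continuous_ofReal.tendsto (0 : ℝ)).mono_left
          (nhdsWithin_le_nhds (s := Ioi (0 : ℝ)))
        simpa using this
      simpa using ENNReal.Tendsto.const_mul h1 (Or.inr hC)
    obtain ⟨δ, h1, h2⟩ := ((ENNReal.tendsto_nhds_zero.1 ht ε hε).and self_mem_nhdsWithin).exists
    exact ⟨δ, h2, h1⟩
  obtain ⟨η, hη, hgη⟩ := Metric.uniformContinuous_iff.1 
    (hc.uniformContinuous_of_continuous hg) δ hδ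
  have hlim : Tendsto (fun n : ℕ => 1 / ((n : ℝ) + 1)) atTop (𝓝 0) :=
    tendsto_one_div_add_atTop_nhds_zero_nat
  filter_upwards [hlim.eventually (gt_mem_nhds hη)] with n hn
  have hbd : ∀ x, ‖(conv (moll n) g - g) x‖ ≤ δ := fun x => by
    rw [Pi.sub_apply, ← dist_eq_norm]
    exact dist_conv_moll_le hg.aestronglyMeasurable fun y hy => (hgη (hy.trans hn)).le
  have hsupp : Function.support (conv (moll n) g - g) ⊆ K := by
    intro x hx
    by_contra hxK
    apply hx
    rw [Pi.sub_apply, ← norm_eq_zero, ← dist_eq_norm]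
    refine le_antisymm (dist_conv_moll_le hg.aestronglyMeasurable fun y hy => ?_) dist_nonneg
    have h1 : (1 : ℝ) / (n + 1) ≤ 1 := by
      rw [div_le_one (by positivity)]; linarith [(Nat.cast_nonneg n : (0 : ℝ) ≤ n)]
    have hy0 : g y = 0 := by
      by_contra hgy
      refine hxK (Metric.mem_cthickening_of_dist_le x y 1 _ (subset_tsupport g hgy) ?_)
      rw [dist_comm]; linarith
    have hx0 : g x = 0 := by
      by_contra hgx
      exact hxK (Metric.self_subset_cthickening _ (subset_tsupport g hgx))
    simp [hx0, hy0]
  rw [← eLpNorm_restrict_eq_of_support_subset hsupp]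
  refine (eLpNorm_le_of_ae_bound (Eventually.of_forall hbd)).trans ?_
  simpa using hδε

/-- Mollifications converge in `Lᵖ`, `1 ≤ p < ∞`. -/
lemma tendsto_conv_moll {f : E3 → ℝ} {p : ℝ≥0∞} (hf : MemLp f p volume) (hp : 1 ≤ p)
    (hp' : p ≠ ⊤) : Tendsto (fun n => eLpNorm (conv (moll n) f - f) p volume) atTop (𝓝 0) := by
  rw [ENNReal.tendsto_nhds_zero]
  intro ε hε
  have hε3 : ε / 3 ≠ 0 := (ENNReal.div_pos hε.ne' (by norm_num)).ne'
  obtain ⟨g, hgc, hfg, hg, hgL⟩ := hf.exists_hasCompactSupport_eLpNorm_sub_le hp' hε3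
  filter_upwards [ENNReal.tendsto_nhds_zero.1 (tendsto_conv_moll_of_continuous hg hgc)
    (ε / 3) (pos_iff_ne_zero.2 hε3)] with n hn
  have hfl := hf.locallyIntegrable hp
  have hgl := hgL.locallyIntegrable hp
  -- The operator `conv (moll n)` is a contraction of `L^p`, so replacing `f` by `g` costs at most
  -- `ε / 3` twice.
  have h1 : conv (moll n) f - f
      = conv (moll n) (f - g) + ((conv (moll n) g - g) - (f - g)) := by
    rw [conv_sub (isTest_moll n) hfl hgl]; abel
  have hm := (memLp_conv_moll (hf.sub hgL) hp hp' n).1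
  have hm2 := ((memLp_conv_moll hgL hp hp' n).sub hgL).1
  rw [h1]
  calc _ ≤ eLpNorm (conv (moll n) (f - g)) p volume
        + eLpNorm ((conv (moll n) g - g) - (f - g)) p volume :=
        eLpNorm_add_le hm (hm2.sub (hf.sub hgL).1) hp
    _ ≤ eLpNorm (f - g) p volume + (eLpNorm (conv (moll n) g - g) p volume
        + eLpNorm (f - g) p volume) := by
        gcongr
        · exact eLpNorm_conv_moll_le n (hf.sub hgL).1 hp hp'
        · exact eLpNorm_sub_le hm2 (hf.sub hgL).1 hp
    _ ≤ ε / 3 + (ε / 3 + ε / 3) := by gcongr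
    _ = ε := by rw [← add_assoc, ENNReal.add_thirds]

/-! ### Weak derivatives, integration by parts and Liouville's theorem -/

/-- `g` is the distributional derivative `∂ᵢ f`. -/
def IsWeakDeriv (i : Fin 3) (f g : E3 → ℝ) : Prop :=
  ∀ ψ : E3 → ℝ, IsTest ψ → ∫ x, f x * pderiv i ψ x = -∫ x, g x * ψ x

/-- The definition of the weak derivative is tested with `y ↦ k (x - y)`; the sign from
differentiating the reflected kernel cancels the sign in the definition. -/
lemma IsWeakDeriv.conv_pderiv {i : Fin 3} {f g k : E3 → ℝ} (h : IsWeakDeriv i f g)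
    (hk : IsTest k) : conv (pderiv i k) f = conv k g := by
  funext x
  have h1 := h _ (hk.sub_left x)
  simp_rw [pderiv_sub_left hk x _ i, mul_neg, integral_neg] at h1
  simpa [conv] using h1

lemma IsWeakDeriv.pderiv_conv {i : Fin 3} {f g k : E3 → ℝ} (h : IsWeakDeriv i f g)
    (hk : IsTest k) (hf : LocallyIntegrable f volume) : pderiv i (conv k f) = conv k g := by
  funext x
  rw [NavierStokes.pderiv_conv hk hf, h.conv_pderiv hk]

lemma integral_mul_pderiv {f g : E3 → ℝ} (hf : ContDiff ℝ ∞ f) (hg : ContDiff ℝ ∞ g) (i : Fin 3)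
    (h1 : Integrable (fun x => pderiv i f x * g x) volume)
    (h2 : Integrable (fun x => f x * pderiv i g x) volume)
    (h3 : Integrable (fun x => f x * g x) volume) :
    ∫ x, f x * pderiv i g x = -∫ x, pderiv i f x * g x :=
  integral_mul_fderiv_eq_neg_fderiv_mul_of_integrable h1 h2 h3
    (fun _ _ => hf.differentiable (by simp) _) (fun _ _ => hg.differentiable (by simp) _)

lemma continuous_pderiv {f : E3 → ℝ} (hf : ContDiff ℝ ∞ f) (i : Fin 3) :
    Continuous (pderiv i f) :=
  (hf.continuous_fderiv (by simp)).clm_apply continuous_const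

lemma isWeakDeriv_of_contDiff {f : E3 → ℝ} (hf : ContDiff ℝ ∞ f) (i : Fin 3) :
    IsWeakDeriv i f (pderiv i f) := fun _ hψ =>
  integral_mul_pderiv hf hψ.1 i
    (((continuous_pderiv hf i).mul hψ.continuous).integrable_of_hasCompactSupport hψ.2.mul_left)
    ((hf.continuous.mul (hψ.pderiv i).continuous).integrable_of_hasCompactSupport
      (hψ.pderiv i).2.mul_left)
    ((hf.continuous.mul hψ.continuous).integrable_of_hasCompactSupport hψ.2.mul_left)

lemma fderiv_apply_eq_sum (f : E3 → ℝ) (x v : E3) : fderiv ℝ f x v = ∑ i, v i * pderiv i f x := by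
  conv_lhs => rw [← (EuclideanSpace.basisFun (Fin 3) ℝ).sum_repr v]
  simp [pderiv]

lemma locallyIntegrable_of_memLp_two {f : E3 → ℝ} (hf : MemLp f 2 volume) :
    LocallyIntegrable f volume := hf.locallyIntegrable (by norm_num)

/-- Liouville's theorem: a weakly harmonic function in `L²` vanishes. -/
lemma ae_eq_zero_of_weakly_harmonic {w : E3 → ℝ} (hw : MemLp w 2 volume)
    (h : ∀ ψ, IsTest ψ → ∫ x, w x * ∑ i, pderiv i (pderiv i ψ) x = 0) : w =ᵐ[volume] 0 := by
  have hloc := locallyIntegrable_of_memLp_two hw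
  have hmem : ∀ k, IsTest k → MemLp (conv k w) 2 volume := fun k hk =>
    memLp_conv (hk.memLp 1) hw (by norm_num) (by norm_num)
  have hzero : ∀ n, conv (moll n) w = 0 := by
    intro n
    set k := moll n with hk_def
    have hk : IsTest k := isTest_moll n
    -- Testing with the reflected, translated kernel shows that the mollification of `w` is
    -- classically harmonic.
    have hlap : ∀ x, ∑ i, conv (pderiv i (pderiv i k)) w x = 0 := by
      intro x
      have h1 := h _ (hk.sub_left x)
      have h2 : ∀ i y, pderiv i (pderiv i (fun y => k (x - y))) y
          = pderiv i (pderiv i k) (x - y) := by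
        intro i y
        have h3 : pderiv i (fun y => k (x - y)) = fun y => -(pderiv i k (x - y)) :=
          funext fun y => pderiv_sub_left hk x y i
        have h4 := pderiv_sub_left (hk.pderiv i) x y i
        rw [h3]
        simp only [pderiv, fderiv_fun_neg] at h4 ⊢
        simp [h4]
      simp_rw [h2, Finset.mul_sum] at h1
      rw [integral_finsetSum] at h1
      · exact h1
      · exact fun i _ => integrable_conv_integrand ((hk.pderiv i).pderiv i) hloc x
    -- No boundary terms arise: the mollification and its first and second derivatives are all in
    -- `L²`, since the derivatives fall on the kernel. Summing over `i` gives a vanishing Dirichlet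
    -- integral.
    have hparts : ∀ i, ∫ x, conv k w x * conv (pderiv i (pderiv i k)) w x
        = -∫ x, conv (pderiv i k) w x ^ 2 := by
      intro i
      have e1 : pderiv i (conv k w) = conv (pderiv i k) w :=
        funext fun x => pderiv_conv hk hloc i x
      have e2 : pderiv i (conv (pderiv i k) w) = conv (pderiv i (pderiv i k)) w :=
        funext fun x => pderiv_conv (hk.pderiv i) hloc i x
      have h1 := hmem _ hk
      have h2 := hmem _ (hk.pderiv i)
      have h3 := hmem _ ((hk.pderiv i).pderiv i)
      have := integral_mul_pderiv (contDiff_conv hk hloc) (contDiff_conv (hk.pderiv i) hloc) i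
        (by rw [e1]; exact h2.integrable_mul h2) (by rw [e2]; exact h1.integrable_mul h3)
        (h1.integrable_mul h2)
      rw [e1, e2] at this
      simpa [sq] using this
    have hsum : ∑ i, ∫ x, conv (pderiv i k) w x ^ 2 = 0 := by
      have h1 : ∑ i, ∫ x, conv k w x * conv (pderiv i (pderiv i k)) w x = 0 := by
        rw [← integral_finsetSum]
        · simp_rw [← Finset.mul_sum, hlap]; simp
        · exact fun i _ => (hmem _ hk).integrable_mul (hmem _ ((hk.pderiv i).pderiv i))
      simp_rw [hparts, Finset.sum_neg_distrib] at h1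
      linarith
    have hgrad : ∀ i, conv (pderiv i k) w = 0 := by
      intro i
      have h1 : ∫ x, conv (pderiv i k) w x ^ 2 = 0 :=
        (Finset.sum_eq_zero_iff_of_nonneg fun i _ => integral_nonneg fun x => sq_nonneg _).1 hsum i
          (Finset.mem_univ i)
      have h2 := (integral_eq_zero_iff_of_nonneg (fun x => sq_nonneg _)
        (hmem _ (hk.pderiv i)).integrable_sq).1 h1
      refine Continuous.ae_eq_iff_eq volume (contDiff_conv (hk.pderiv i) hloc).continuous
        continuous_const |>.1 (h2.mono fun x hx => ?_)
      exact (pow_eq_zero_iff two_ne_zero).1 hx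
    have hconst : ∀ x, conv k w x = conv k w 0 := by
      intro x
      refine is_const_of_fderiv_eq_zero (𝕜 := ℝ)
        ((contDiff_conv hk hloc).differentiable (by simp)) (fun y => ?_) x 0
      ext v
      rw [fderiv_apply_eq_sum]
      simp [pderiv_conv hk hloc, hgrad]
    -- A constant in `L²` of a space of infinite measure is zero.
    have h2 : MemLp (fun _ : E3 => conv k w 0) 2 volume := by
      have := hmem k hk
      rwa [show conv k w = fun _ => conv k w 0 from funext hconst] at this
    rcases (memLp_const_iff (by norm_num) (by norm_num)).1 h2 with h3 | h3
    · exact funext fun x => by rw [hconst x, h3]; rfl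
    · simp at h3
  have hlim := tendsto_conv_moll hw (by norm_num) (by norm_num)
  simp_rw [hzero, zero_sub, eLpNorm_neg] at hlim
  have h0 : eLpNorm w 2 volume = 0 := tendsto_nhds_unique tendsto_const_nhds hlim
  exact (eLpNorm_eq_zero_iff hw.1 (by norm_num)).1 h0

/-! ### Calculus of partial derivatives and of test functions -/

lemma pderiv_comm {f : E3 → ℝ} (hf : ContDiff ℝ ∞ f) (i j : Fin 3) (x : E3) :
    pderiv i (pderiv j f) x = pderiv j (pderiv i f) x := by
  have h1 : DifferentiableAt ℝ (fderiv ℝ f) x :=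
    (hf.fderiv_right (m := ∞) (by simp)).differentiable (by simp) x
  have h2 : ∀ i j, pderiv i (pderiv j f) x
      = fderiv ℝ (fderiv ℝ f) x (EuclideanSpace.single i 1) (EuclideanSpace.single j 1) := by
    intro i j
    have := h1.hasFDerivAt.clm_apply (hasFDerivAt_const (EuclideanSpace.single j (1 : ℝ)) x)
    rw [pderiv, show pderiv j f = fun y => fderiv ℝ f y (EuclideanSpace.single j 1) from rfl,
      this.fderiv]
    simp
  rw [h2, h2]
  refine hf.contDiffAt.isSymmSndFDerivAt ?_ _ _
  simp only [minSmoothness_of_isRCLikeNormedField]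
  exact WithTop.coe_le_coe.2 (le_top : (2 : ℕ∞) ≤ ⊤)

lemma pderiv_add {f g : E3 → ℝ} (hf : ContDiff ℝ ∞ f) (hg : ContDiff ℝ ∞ g) (i : Fin 3) :
    pderiv i (fun x => f x + g x) = fun x => pderiv i f x + pderiv i g x := by
  funext x
  simp [pderiv, fderiv_fun_add (hf.differentiable (by simp) x) (hg.differentiable (by simp) x)]

lemma pderiv_sub {f g : E3 → ℝ} (hf : ContDiff ℝ ∞ f) (hg : ContDiff ℝ ∞ g) (i : Fin 3) :
    pderiv i (fun x => f x - g x) = fun x => pderiv i f x - pderiv i g x := by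
  funext x
  simp [pderiv, fderiv_fun_sub (hf.differentiable (by simp) x) (hg.differentiable (by simp) x)]

lemma pderiv_const_mul {f : E3 → ℝ} (hf : ContDiff ℝ ∞ f) (c : ℝ) (i : Fin 3) :
    pderiv i (fun x => c * f x) = fun x => c * pderiv i f x := by
  funext x
  simp [pderiv, fderiv_const_mul (hf.differentiable (by simp) x)]

lemma pderiv_mul {f g : E3 → ℝ} (hf : ContDiff ℝ ∞ f) (hg : ContDiff ℝ ∞ g) (i : Fin 3) :
    pderiv i (fun x => f x * g x) = fun x => pderiv i f x * g x + f x * pderiv i g x := by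
  funext x
  simp [pderiv, fderiv_fun_mul (hf.differentiable (by simp) x) (hg.differentiable (by simp) x)]
  ring

lemma pderiv_sum {f : Fin 3 → E3 → ℝ} (hf : ∀ j, ContDiff ℝ ∞ (f j)) (i : Fin 3) :
    pderiv i (fun x => ∑ j, f j x) = fun x => ∑ j, pderiv i (f j) x := by
  funext x
  rw [pderiv, fderiv_fun_sum fun j _ => (hf j).differentiable (by simp) x]
  simp [pderiv]

lemma isTest_zero : IsTest 0 := ⟨contDiff_const, HasCompactSupport.zero⟩

lemma IsTest.add {f g : E3 → ℝ} (hf : IsTest f) (hg : IsTest g) : IsTest (fun x => f x + g x) :=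
  ⟨hf.1.add hg.1, hf.2.add hg.2⟩

lemma IsTest.const_mul {f : E3 → ℝ} (hf : IsTest f) (c : ℝ) : IsTest (fun x => c * f x) :=
  ⟨contDiff_const.mul hf.1, hf.2.mul_left⟩

lemma IsTest.sub {f g : E3 → ℝ} (hf : IsTest f) (hg : IsTest g) : IsTest (fun x => f x - g x) := by
  simpa [sub_eq_add_neg] using hf.add (hg.const_mul (-1))

lemma IsTest.sum {f : Fin 3 → E3 → ℝ} (hf : ∀ i, IsTest (f i)) : IsTest (fun x => ∑ i, f i x) := by
  simpa [Fin.sum_univ_three] using ((hf 0).add (hf 1)).add (hf 2)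

/-! ### Vector fields and density of solenoidal test fields -/

/-- The vector field with given components. -/
noncomputable def field (a : Fin 3 → E3 → ℝ) (x : E3) : E3 := WithLp.toLp 2 fun i => a i x

@[simp] lemma field_apply (a : Fin 3 → E3 → ℝ) (x : E3) (i : Fin 3) : field a x i = a i x := rfl

lemma inner_eq_sum (v w : E3) : inner ℝ v w = ∑ i, v i * w i := by
  simp [PiLp.inner_apply, mul_comm]

lemma field_eq_sum (a : Fin 3 → E3 → ℝ) :
    field a = fun x => ∑ i, a i x • EuclideanSpace.single i (1 : ℝ) := by
  funext x
  ext j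
  simp [Finset.sum_apply, Pi.single_apply]

lemma memLp_field {a : Fin 3 → E3 → ℝ} {p : ℝ≥0∞} (ha : ∀ i, MemLp (a i) p volume) :
    MemLp (field a) p volume := by
  rw [field_eq_sum]
  refine memLp_finsetSum _ fun i _ => ?_
  have h := (ContinuousLinearMap.toSpanSingleton ℝ (EuclideanSpace.single i (1 : ℝ))).comp_memLp'
    (ha i)
  exact h

lemma memLp_component {v : E3 → E3} {p : ℝ≥0∞} (hv : MemLp v p volume) (i : Fin 3) :
    MemLp (fun x => v x i) p volume :=
  (EuclideanSpace.proj (𝕜 := ℝ) i).comp_memLp' hv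

/-- Smooth compactly supported divergence-free vector fields on `ℝ³`. -/
structure IsSolenoidal (φ : E3 → E3) : Prop where
  test : ∀ i, IsTest (fun x => φ x i)
  div_free : ∀ x, ∑ i, pderiv i (fun y => φ y i) x = 0

lemma IsSolenoidal.contDiff {φ : E3 → E3} (h : IsSolenoidal φ) : ContDiff ℝ ∞ φ :=
  contDiff_euclidean.2 fun i => (h.test i).1

lemma IsSolenoidal.hasCompactSupport {φ : E3 → E3} (h : IsSolenoidal φ) : HasCompactSupport φ := by
  have h1 : HasCompactSupport (fun x => ∑ i, φ x i • EuclideanSpace.single i (1 : ℝ)) := by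
    simp only [Fin.sum_univ_three]
    exact (((h.test 0).2.smul_right).add (h.test 1).2.smul_right).add (h.test 2).2.smul_right
  rwa [← field_eq_sum (fun i x => φ x i)] at h1

lemma IsSolenoidal.memLp {φ : E3 → E3} (h : IsSolenoidal φ) (p : ℝ≥0∞) : MemLp φ p volume :=
  h.contDiff.continuous.memLp_of_hasCompactSupport h.hasCompactSupport

/-- The Hilbert space `L²(ℝ³; ℝ³)`. -/
abbrev L2 : Type := Lp E3 2 (volume : Measure E3)

/-- The classes of solenoidal test fields in `L²`. -/
noncomputable def solenoidal : Submodule ℝ L2 where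
  carrier := {f | ∃ φ, IsSolenoidal φ ∧ f =ᵐ[volume] φ}
  zero_mem' := ⟨0, ⟨fun _ => isTest_zero, fun x => by simp [pderiv]⟩, Lp.coeFn_zero _ _ _⟩
  add_mem' := by
    rintro f g ⟨φ, hφ, hf⟩ ⟨ψ, hψ, hg⟩
    refine ⟨fun x => φ x + ψ x, ⟨fun i => (hφ.test i).add (hψ.test i), fun x => ?_⟩,
      (Lp.coeFn_add f g).trans (hf.add hg)⟩
    have h : ∀ i, pderiv i (fun y => (φ y + ψ y) i)
        = fun x => pderiv i (fun y => φ y i) x + pderiv i (fun y => ψ y i) x := fun i =>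
      pderiv_add (hφ.test i).1 (hψ.test i).1 i
    simp_rw [h, Finset.sum_add_distrib, hφ.div_free, hψ.div_free, add_zero]
  smul_mem' := by
    rintro c f ⟨φ, hφ, hf⟩
    refine ⟨fun x => c • φ x, ⟨fun i => (hφ.test i).const_mul c, fun x => ?_⟩,
      (Lp.coeFn_smul c f).trans (hf.mono fun x hx => by simp [hx])⟩
    have h : ∀ i, pderiv i (fun y => (c • φ y) i)
        = fun x => c * pderiv i (fun y => φ y i) x := fun i =>
      pderiv_const_mul (hφ.test i).1 c i
    simp_rw [h, ← Finset.mul_sum, hφ.div_free, mul_zero]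

lemma inner_toLp {v w : E3 → E3} (hv : MemLp v 2 volume) (hw : MemLp w 2 volume) :
    inner ℝ (hv.toLp v) (hw.toLp w) = ∫ x, ∑ i, v x i * w x i := by
  rw [L2.inner_def]
  refine integral_congr_ae ?_
  filter_upwards [hv.coeFn_toLp, hw.coeFn_toLp] with x h1 h2
  rw [h1, h2, inner_eq_sum]

lemma integrable_mul_of_memLp_two {f g : E3 → ℝ} (hf : MemLp f 2 volume) (hg : MemLp g 2 volume) :
    Integrable (fun x => f x * g x) volume := hf.integrable_mul hg

lemma inner_toLp_eq_sum {v w : E3 → E3} (hv : MemLp v 2 volume) (hw : MemLp w 2 volume) :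
    inner ℝ (hv.toLp v) (hw.toLp w) = ∑ i, ∫ x, v x i * w x i := by
  rw [inner_toLp, integral_finsetSum]
  exact fun i _ => integrable_mul_of_memLp_two (memLp_component hv i) (memLp_component hw i)

lemma memLp_grad {ψ : E3 → ℝ} (hψ : IsTest ψ) :
    MemLp (field fun i => pderiv i ψ) 2 (volume : Measure E3) :=
  memLp_field fun i => (hψ.pderiv i).memLp 2

/-- Solenoidal test fields are dense among the divergence-free `L²` fields. -/
lemma mem_closure_solenoidal {w : E3 → E3} (hw : MemLp w 2 volume) (hdiv : WeakDivFree w) :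
    hw.toLp w ∈ solenoidal.topologicalClosure := by
  have : CompleteSpace solenoidal.topologicalClosure :=
    solenoidal.isClosed_topologicalClosure.completeSpace_coe
  obtain ⟨a, ha, b, hb, hab⟩ :=
    solenoidal.topologicalClosure.exists_add_mem_mem_orthogonal (hw.toLp w)
  suffices hb0 : b = 0 by rw [hab, hb0, add_zero]; exact ha
  -- The component `b` orthogonal to the solenoidal fields is also orthogonal to gradients: `w` is,
  -- by weak incompressibility, and `a` is, as a limit of solenoidal test fields.
  have hgrad : ∀ ψ (hψ : IsTest ψ), inner ℝ b ((memLp_grad hψ).toLp _) = 0 := by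
    intro ψ hψ
    have h1 : inner ℝ (hw.toLp w) ((memLp_grad hψ).toLp _) = 0 := by
      rw [inner_toLp]; simpa using hdiv ψ hψ
    have h2 : inner ℝ a ((memLp_grad hψ).toLp _) = 0 := by
      have h3 : solenoidal.topologicalClosure ≤ (Submodule.span ℝ {(memLp_grad hψ).toLp _})ᗮ := by
        refine Submodule.topologicalClosure_minimal _ ?_ (Submodule.isClosed_orthogonal _)
        rintro f ⟨φ, hφ, hf⟩
        rw [Submodule.mem_orthogonal_singleton_iff_inner_left]
        have : f = (hφ.memLp 2).toLp φ := by
          apply Lp.ext; exact hf.trans (hφ.memLp 2).coeFn_toLp.symm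
        rw [this, inner_toLp_eq_sum]
        have h4 : ∀ i, ∫ x, φ x i * field (fun i => pderiv i ψ) x i
            = -∫ x, pderiv i (fun y => φ y i) x * ψ x := fun i =>
          isWeakDeriv_of_contDiff (hφ.test i).1 i ψ hψ
        simp_rw [h4, Finset.sum_neg_distrib]
        rw [← integral_finsetSum _ fun i _ => integrable_mul_of_memLp_two
          (((hφ.test i).pderiv i).memLp 2) (hψ.memLp 2)]
        simp_rw [← Finset.sum_mul, hφ.div_free]
        simp
      exact Submodule.mem_orthogonal_singleton_iff_inner_left.1 (h3 ha)
    have h3 : b = hw.toLp w - a := by rw [hab]; abel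
    rw [h3, inner_sub_left, h1, h2, sub_zero]
  have hbm := Lp.memLp b
  have hbb : hbm.toLp b = b := Lp.toLp_coeFn b hbm
  have hharm : ∀ j, (fun x => b x j) =ᵐ[volume] 0 := by
    intro j
    refine ae_eq_zero_of_weakly_harmonic (memLp_component hbm j) fun f hf => ?_
    set lap : E3 → ℝ := fun x => ∑ i, pderiv i (pderiv i f) x with hlap
    have hlapt : IsTest lap := IsTest.sum fun i => (hf.pderiv i).pderiv i
    set e : Fin 3 → ℝ := fun i => if i = j then 1 else 0 with he
    -- The field `∇∂ⱼf - eⱼ Δf` is solenoidal. Since `b` is orthogonal to it and to `∇∂ⱼf`, what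
    -- remains is `∫ bⱼ Δf = 0`, so Liouville's theorem applies to each component of `b`.
    set φ : E3 → E3 := field fun i x => pderiv i (pderiv j f) x - e i * lap x with hφ
    have hφs : IsSolenoidal φ := by
      refine ⟨fun i => ((hf.pderiv j).pderiv i).sub (hlapt.const_mul _), fun x => ?_⟩
      have h1 : ∀ i, pderiv i (fun y => φ y i) x
          = pderiv i (pderiv i (pderiv j f)) x - e i * pderiv i lap x := by
        intro i
        have h2 := pderiv_sub ((hf.pderiv j).pderiv i).1 (hlapt.const_mul (e i)).1 i
        rw [pderiv_const_mul hlapt.1] at h2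
        exact congrFun h2 x
      simp_rw [h1, Finset.sum_sub_distrib]
      have h2 : pderiv j lap x = ∑ i, pderiv i (pderiv i (pderiv j f)) x := by
        rw [hlap, pderiv_sum fun i => ((hf.pderiv i).pderiv i).1]
        refine Finset.sum_congr rfl fun i _ => ?_
        rw [pderiv_comm (hf.pderiv i).1 j i,
          show pderiv j (pderiv i f) = pderiv i (pderiv j f) from
            funext fun y => pderiv_comm hf.1 j i y]
      simp [he, h2]
    have h1 := hgrad _ (hf.pderiv j)
    have h2 : inner ℝ b ((hφs.memLp 2).toLp φ) = 0 := by
      rw [real_inner_comm]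
      exact hb _ (subset_closure ⟨φ, hφs, (hφs.memLp 2).coeFn_toLp⟩)
    rw [← hbb, inner_toLp_eq_sum] at h1 h2
    have h3 : ∀ i, ∫ x, b x i * φ x i = (∫ x, b x i * field (fun i => pderiv i (pderiv j f)) x i)
        - e i * ∫ x, b x i * lap x := by
      intro i
      rw [← integral_const_mul, ← integral_sub]
      · exact integral_congr_ae (Eventually.of_forall fun x => by simp [hφ]; ring)
      · exact integrable_mul_of_memLp_two (memLp_component hbm i) (((hf.pderiv j).pderiv i).memLp 2)
      · exact (integrable_mul_of_memLp_two (memLp_component hbm i) (hlapt.memLp 2)).const_mul _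
    have h4 : ∑ i, ∫ x, b x i * φ x i = 0 := h2
    simp_rw [h3, Finset.sum_sub_distrib] at h4
    have h5 : ∑ i, ∫ x, b x i * field (fun i => pderiv i (pderiv j f)) x i = 0 := h1
    rw [h5] at h4
    simpa [he] using h4
  apply Lp.ext
  filter_upwards [hharm 0, hharm 1, hharm 2, Lp.coeFn_zero E3 2 (volume : Measure E3)]
    with x h0 h1 h2 h3
  rw [h3]
  ext i
  fin_cases i <;> simp_all

/-! ### Cutoffs and the Sobolev embedding -/

lemma norm_fderiv_le (f : E3 → ℝ) (x : E3) : ‖fderiv ℝ f x‖ ≤ ∑ i, |pderiv i f x| := by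
  refine ContinuousLinearMap.opNorm_le_bound _ (by positivity) fun v => ?_
  rw [fderiv_apply_eq_sum, Finset.sum_mul]
  refine (norm_sum_le _ _).trans (Finset.sum_le_sum fun i _ => ?_)
  rw [norm_mul, mul_comm, Real.norm_eq_abs (pderiv i f x)]
  gcongr
  exact PiLp.norm_apply_le v i

/-- A smooth cutoff function, equal to `1` on the ball of radius `n + 1`. -/
noncomputable def cutoff (n : ℕ) (x : E3) : ℝ :=
  (⟨1, 2, one_pos, one_lt_two⟩ : ContDiffBump (0 : E3)) (((n : ℝ) + 1)⁻¹ • x)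

lemma isTest_cutoff (n : ℕ) : IsTest (cutoff n) := by
  refine ⟨(ContDiffBump.contDiff _).comp (contDiff_const_smul _), ?_⟩
  have h : ((n : ℝ) + 1)⁻¹ ≠ 0 := by positivity
  exact (ContDiffBump.hasCompactSupport _).comp_homeomorph (Homeomorph.smulOfNeZero _ h)

lemma abs_cutoff_le (n : ℕ) (x : E3) : |cutoff n x| ≤ 1 := by
  rw [cutoff, abs_of_nonneg (ContDiffBump.nonneg _)]
  exact ContDiffBump.le_one _

lemma cutoff_eventually_eq_one (x : E3) : ∀ᶠ n in atTop, cutoff n x = 1 := by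
  filter_upwards [eventually_ge_atTop ⌈‖x‖⌉₊] with n hn
  have h1 : ‖x‖ ≤ n := (Nat.le_ceil _).trans (by exact_mod_cast hn)
  refine ContDiffBump.one_of_mem_closedBall _ ?_
  have h2 : (0 : ℝ) < (n : ℝ) + 1 := by positivity
  simp only [mem_closedBall_zero_iff, norm_smul, norm_inv, Real.norm_eq_abs, abs_of_pos h2]
  rw [inv_mul_le_iff₀ h2]
  linarith

/-- Dilating a fixed bump by `n + 1` multiplies its gradient by `(n + 1)⁻¹ ≤ 1`. Boundedness
suffices in the Sobolev inequality, where it produces the term with `‖v‖₂`. -/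
lemma exists_bound_fderiv_cutoff : ∃ M : ℝ≥0, ∀ n x, ‖fderiv ℝ (cutoff n) x‖ ≤ M := by
  set b : ContDiffBump (0 : E3) := ⟨1, 2, one_pos, one_lt_two⟩
  have hb : ContDiff ℝ 1 b := b.contDiff
  obtain ⟨M, hM⟩ := (hb.continuous_fderiv one_ne_zero).bounded_above_of_compact_support
    (b.hasCompactSupport.fderiv ℝ)
  refine ⟨M.toNNReal, fun n x => ?_⟩
  have h : ((n : ℝ) + 1)⁻¹ ≤ 1 := inv_le_one_of_one_le₀ (by linarith [(Nat.cast_nonneg n : (0 : ℝ) ≤ n)])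
  have h0 : (0 : ℝ) ≤ ((n : ℝ) + 1)⁻¹ := by positivity
  have hM0 : 0 ≤ M := (norm_nonneg _).trans (hM 0)
  have : fderiv ℝ (cutoff n) x = ((n : ℝ) + 1)⁻¹ • fderiv ℝ b (((n : ℝ) + 1)⁻¹ • x) :=
    fderiv_comp_smul (f := b) _
  rw [this, norm_smul, Real.norm_of_nonneg h0, Real.coe_toNNReal _ hM0]
  calc _ ≤ 1 * M := by gcongr; exact hM _
    _ = M := one_mul _

/-- The Sobolev embedding `H¹(ℝ³) ⊆ L⁶(ℝ³)`. -/
lemma exists_eLpNorm_six_le : ∃ C : ℝ≥0, ∀ (v : E3 → ℝ) (g : Fin 3 → E3 → ℝ),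
    MemLp v 2 volume → (∀ i, MemLp (g i) 2 volume) → (∀ i, IsWeakDeriv i v (g i)) →
    eLpNorm v 6 volume ≤ C * (∑ i, eLpNorm (g i) 2 volume + eLpNorm v 2 volume) := by
  obtain ⟨M, hM⟩ := exists_bound_fderiv_cutoff
  set C₀ := SNormLESNormFDerivOfEqConst ℝ (volume : Measure E3) 2
  refine ⟨C₀ * (1 + M), fun v g hv hg hvg => ?_⟩
  have hloc := locallyIntegrable_of_memLp_two hv
  have h12 : (1 : ℝ≥0∞) ≤ 2 := by norm_num
  have h2t : (2 : ℝ≥0∞) ≠ ⊤ := by norm_num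
  -- The Gagliardo–Nirenberg–Sobolev inequality (`1/6 = 1/2 - 1/3`) requires a smooth function of
  -- compact support, hence both a mollification and a cutoff.
  set w : ℕ → E3 → ℝ := fun n x => cutoff n x * conv (moll n) v x with hw
  have hcs : ∀ n, ContDiff ℝ ∞ (conv (moll n) v) := fun n => contDiff_conv (isTest_moll n) hloc
  have hwt : ∀ n, IsTest (w n) := fun n =>
    ⟨(isTest_cutoff n).1.mul (hcs n), (isTest_cutoff n).2.mul_right⟩
  have hfd : ∀ n x, ‖fderiv ℝ (w n) x‖
      ≤ (∑ i, |conv (moll n) (g i) x|) + M * |conv (moll n) v x| := by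
    intro n x
    have h1 := fderiv_fun_mul ((isTest_cutoff n).1.differentiable (by simp) x)
      ((hcs n).differentiable (by simp) x)
    rw [hw]
    simp only
    rw [h1]
    refine (norm_add_le _ _).trans (add_le_add ?_ ?_)
    · rw [norm_smul]
      have h2 := norm_fderiv_le (conv (moll n) v) x
      simp_rw [(hvg _).pderiv_conv (isTest_moll n) hloc] at h2
      calc _ ≤ 1 * ∑ i, |conv (moll n) (g i) x| := by
            gcongr
            exact abs_cutoff_le n x
        _ = _ := one_mul _
    · rw [norm_smul, mul_comm]
      gcongr
      · exact hM n x
      · exact le_rfl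
  have hbound : ∀ n, eLpNorm (w n) 6 volume
      ≤ (C₀ * (1 + M) : ℝ≥0) * (∑ i, eLpNorm (g i) 2 volume + eLpNorm v 2 volume) := by
    intro n
    have h1 := eLpNorm_le_eLpNorm_fderiv_of_eq (volume : Measure E3) (u := w n) (p := 2) (p' := 6)
      ((hwt n).1.of_le (by simp)) (hwt n).2 (by norm_num) (by simp) (by simp; norm_num)
    have hmg := fun i => memLp_conv_moll (hg i) h12 h2t n
    have hmv := memLp_conv_moll hv h12 h2t n
    have h2 : eLpNorm (fderiv ℝ (w n)) 2 volume
        ≤ ∑ i, eLpNorm (g i) 2 volume + M * eLpNorm v 2 volume := by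
      calc eLpNorm (fderiv ℝ (w n)) 2 volume
          ≤ eLpNorm ((fun x => ∑ i, |conv (moll n) (g i) x|)
              + (fun x => (M : ℝ) * |conv (moll n) v x|)) 2 volume :=
            eLpNorm_mono_real (hfd n)
        _ ≤ eLpNorm (∑ i, fun x => |conv (moll n) (g i) x|) 2 volume
              + eLpNorm ((M : ℝ) • fun x => |conv (moll n) v x|) 2 volume := by
            have : (fun x => ∑ i, |conv (moll n) (g i) x|)
                = ∑ i, fun x => |conv (moll n) (g i) x| := by ext; simp
            rw [this]
            refine eLpNorm_add_le ?_ ?_ h12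
            · exact (memLp_finsetSum' _ fun i _ => (hmg i).abs).1
            · exact (hmv.abs.const_smul (M : ℝ)).1
        _ ≤ (∑ i, eLpNorm (g i) 2 volume) + M * eLpNorm v 2 volume := by
            gcongr
            · refine (eLpNorm_sum_le (fun i _ => (hmg i).abs.1) h12).trans
                (Finset.sum_le_sum fun i _ => ?_)
              exact (eLpNorm_norm (conv (moll n) (g i))).trans_le
                (eLpNorm_conv_moll_le n (hg i).1 h12 h2t)
            · rw [eLpNorm_const_smul]
              gcongr
              · simp
              · exact (eLpNorm_norm (conv (moll n) v)).trans_le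
                  (eLpNorm_conv_moll_le n hv.1 h12 h2t)
    refine h1.trans ?_
    push_cast
    rw [mul_assoc]
    gcongr
    refine h2.trans ?_
    rw [mul_add]
    gcongr
    · exact le_mul_of_one_le_left' le_self_add
    · exact le_add_self
  -- Along a subsequence the mollifications converge almost everywhere, and lower semicontinuity of
  -- the norm transfers the uniform `L⁶` bound to `v`.
  obtain ⟨ns, hns, hae⟩ := (tendstoInMeasure_of_tendsto_eLpNorm (by norm_num)
    (fun n => (memLp_conv_moll hv h12 h2t n).1) hv.1
    (tendsto_conv_moll hv h12 h2t)).exists_seq_tendsto_ae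
  refine Lp.eLpNorm_le_of_ae_tendsto (u := atTop) (f := fun n => w (ns n))
    (Eventually.of_forall fun n => hbound (ns n))
    (fun n => (hwt _).continuous.aestronglyMeasurable) (hae.mono fun x hx => ?_)
  refine hx.congr' ?_
  filter_upwards [hns.tendsto_atTop.eventually (cutoff_eventually_eq_one x)] with n hn
  simp [hw, hn]

/-! ### Products of convergent sequences and the weak chain rule -/

/-- Convergence in `Lᵖ` of a sequence of functions. -/
structure TendstoLp (p : ℝ≥0∞) (F : ℕ → E3 → ℝ) (f : E3 → ℝ) : Prop where
  memLp : ∀ n, MemLp (F n) p volume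
  memLp_lim : MemLp f p volume
  tendsto : Tendsto (fun n => eLpNorm (F n - f) p volume) atTop (𝓝 0)

lemma tendstoLp_moll {f : E3 → ℝ} {p : ℝ≥0∞} (hf : MemLp f p volume) (hp : 1 ≤ p) (hp' : p ≠ ⊤) :
    TendstoLp p (fun n => conv (moll n) f) f :=
  ⟨memLp_conv_moll hf hp hp', hf, tendsto_conv_moll hf hp hp'⟩

lemma tendstoLp_const {f : E3 → ℝ} {p : ℝ≥0∞} (hf : MemLp f p volume) :
    TendstoLp p (fun _ => f) f :=
  ⟨fun _ => hf, hf, by simp⟩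

lemma eLpNorm_mul_le {f g : E3 → ℝ} (hf : AEStronglyMeasurable f volume)
    (hg : AEStronglyMeasurable g volume) (p q s : ℝ≥0∞) [ENNReal.HolderTriple p q s] :
    eLpNorm (fun x => f x * g x) s volume ≤ eLpNorm f p volume * eLpNorm g q volume := by
  have h := eLpNorm_smul_le_mul_eLpNorm (p := p) (q := q) (r := s) hg hf
  exact h

/-- Hölder applied to `FH - fh = (F - f) H + f (H - h)`, with `‖H‖` controlled by `‖H - h‖ + ‖h‖`.
-/
lemma TendstoLp.mul {p q s : ℝ≥0∞} [ENNReal.HolderTriple p q s] (hs : 1 ≤ s)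
    (hq : 1 ≤ q) {F H : ℕ → E3 → ℝ} {f h : E3 → ℝ} (hF : TendstoLp p F f) (hH : TendstoLp q H h) :
    TendstoLp s (fun n x => F n x * H n x) (fun x => f x * h x) := by
  refine ⟨fun n => (hH.memLp n).mul' (hF.memLp n), hH.memLp_lim.mul' hF.memLp_lim, ?_⟩
  have hlim : Tendsto (fun n => eLpNorm (F n - f) p volume *
      (eLpNorm (H n - h) q volume + eLpNorm h q volume)
      + eLpNorm f p volume * eLpNorm (H n - h) q volume) atTop (𝓝 0) := by
    have h1 : Tendsto (fun n => eLpNorm (H n - h) q volume + eLpNorm h q volume) atTop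
        (𝓝 (0 + eLpNorm h q volume)) := hH.tendsto.add_const _
    have h2 := ENNReal.Tendsto.mul hF.tendsto (Or.inr (by simpa using hH.memLp_lim.2.ne)) h1
      (Or.inr ENNReal.zero_ne_top)
    have h4 := ENNReal.Tendsto.const_mul (a := eLpNorm f p volume) hH.tendsto
      (Or.inr hF.memLp_lim.2.ne)
    simpa using h2.add h4
  refine tendsto_of_tendsto_of_tendsto_of_le_of_le tendsto_const_nhds hlim
    (fun _ => zero_le) fun n => ?_
  have hd1 := (hF.memLp n).sub hF.memLp_lim
  have hd2 := (hH.memLp n).sub hH.memLp_lim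
  have e : (fun x => F n x * H n x) - (fun x => f x * h x)
      = (fun x => (F n - f) x * H n x) + fun x => f x * (H n - h) x := by
    funext x; simp only [Pi.sub_apply, Pi.add_apply]; ring
  have hHn : eLpNorm (H n) q volume ≤ eLpNorm (H n - h) q volume + eLpNorm h q volume := by
    conv_lhs => rw [← sub_add_cancel (H n) h]
    exact eLpNorm_add_le hd2.1 hH.memLp_lim.1 hq
  rw [e]
  refine (eLpNorm_add_le (hd1.1.mul (hH.memLp n).1) (hF.memLp_lim.1.mul hd2.1) hs).trans
    (add_le_add ?_ (eLpNorm_mul_le hF.memLp_lim.1 hd2.1 p q s))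
  refine (eLpNorm_mul_le hd1.1 (hH.memLp n).1 p q s).trans ?_
  gcongr

lemma TendstoLp.integral_mul {p q : ℝ≥0∞} [ENNReal.HolderTriple p q 1] (hq : 1 ≤ q)
    {F H : ℕ → E3 → ℝ} {f h : E3 → ℝ} (hF : TendstoLp p F f) (hH : TendstoLp q H h) :
    Tendsto (fun n => ∫ x, F n x * H n x) atTop (𝓝 (∫ x, f x * h x)) := by
  have hm := hF.mul le_rfl hq hH
  exact tendsto_integral_of_L1' _ hm.memLp_lim.1
    (Eventually.of_forall fun n => memLp_one_iff_integrable.1 (hm.memLp n)) hm.tendsto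

lemma memLp_top_conv {k f : E3 → ℝ} (hk : IsTest k) {p q : ℝ≥0∞} [ENNReal.HolderTriple p q 1]
    (hf : MemLp f p volume) : MemLp (conv k f) ⊤ volume := by
  obtain ⟨C, hC⟩ := exists_bound_conv p q (hk.memLp q) hf
  exact memLp_top_of_bound (aestronglyMeasurable_conv hk.continuous.aestronglyMeasurable hf.1) C
    (Eventually.of_forall hC)

lemma integrable_mul_top {f g : E3 → ℝ} (hf : MemLp f 1 volume) (hg : MemLp g ⊤ volume) :
    Integrable (fun x => f x * g x) volume :=
  memLp_one_iff_integrable.1 (hg.mul' hf)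

lemma memLp_one_mul {f g : E3 → ℝ} (hf : MemLp f 2 volume) (hg : MemLp g 2 volume) :
    MemLp (fun x => f x * g x) 1 volume := hg.mul' hf

/-- The weak chain rule `∂ᵢ (v²) = 2 v ∂ᵢ v` for `v ∈ H¹`. -/
lemma IsWeakDeriv.sq {i : Fin 3} {v g : E3 → ℝ} (h : IsWeakDeriv i v g) (hv : MemLp v 2 volume)
    (hg : MemLp g 2 volume) :
    IsWeakDeriv i (fun x => v x * v x) (fun x => 2 * (v x * g x)) := by
  intro ψ hψ
  have hloc := locallyIntegrable_of_memLp_two hv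
  have h12 : (1 : ℝ≥0∞) ≤ 2 := by norm_num
  have hvt := tendstoLp_moll hv h12 (by norm_num)
  have hgt := tendstoLp_moll hg h12 (by norm_num)
  have l1 := (hvt.mul (s := 1) le_rfl h12 hvt).integral_mul le_top
    (tendstoLp_const ((hψ.pderiv i).memLp ⊤))
  have l2 := ((hvt.mul (s := 1) le_rfl h12 hgt).integral_mul le_top
    (tendstoLp_const (hψ.memLp ⊤))).const_mul (-2)
  -- For the smooth mollifications this is the classical product rule. Both sides pass to the limit
  -- as `L¹` products tested against bounded functions.
  have e : ∀ n, ∫ x, conv (moll n) v x * conv (moll n) v x * NavierStokes.pderiv i ψ x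
      = -2 * ∫ x, conv (moll n) v x * conv (moll n) g x * ψ x := by
    intro n
    have hc := contDiff_conv (isTest_moll n) hloc
    have h1 := isWeakDeriv_of_contDiff (hc.mul hc) i ψ hψ
    rw [pderiv_mul hc hc, h.pderiv_conv (isTest_moll n) hloc] at h1
    refine h1.trans ?_
    rw [← integral_const_mul, ← integral_neg]
    congr 1; funext x; ring
  simp_rw [e] at l1
  have := tendsto_nhds_unique l1 l2
  rw [this, neg_mul, ← integral_const_mul]
  congr 2; funext x; ring

/-! ### Cancellations in the convective term at a fixed time -/

/-- The regularity of a time slice of the velocity field used to make sense of, and to cancel, the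
convective term. -/
structure IsRegularSlice (q r : ℝ≥0∞) (v : E3 → E3) (g : E3 → Fin 3 → Fin 3 → ℝ) : Prop where
  memLp : MemLp v 2 volume
  grad_memLp : ∀ i j, MemLp (fun x => g x i j) 2 volume
  grad : IsWeakGradient v g
  div_free : WeakDivFree v
  memLp_four : ∀ k : Fin 3, k ≠ 2 → MemLp (fun x => v x k) 4 volume
  memLp_q : ∀ k : Fin 3, k ≠ 2 → MemLp (fun x => v x k) q volume
  memLp_r : MemLp (fun x => v x 2) r volume

lemma IsWeakGradient.isWeakDeriv {v : E3 → E3} {g : E3 → Fin 3 → Fin 3 → ℝ}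
    (h : IsWeakGradient v g) (i j : Fin 3) : IsWeakDeriv i (fun x => v x j) (fun x => g x i j) :=
  fun ψ hψ => h ψ hψ i j

lemma WeakDivFree.sum_conv_pderiv {v : E3 → E3} (h : WeakDivFree v) (hv : MemLp v 2 volume)
    {k : E3 → ℝ} (hk : IsTest k) (x : E3) : ∑ i, conv (pderiv i k) (fun y => v y i) x = 0 := by
  have h1 := h _ (hk.sub_left x)
  simp_rw [pderiv_sub_left hk, mul_neg, Finset.sum_neg_distrib, integral_neg, neg_eq_zero] at h1
  rw [integral_finsetSum] at h1
  · exact h1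
  · exact fun i _ => integrable_conv_integrand (hk.pderiv i)
      (locallyIntegrable_of_memLp_two (memLp_component hv i)) x

/-- Mollification turns the weak condition `div v = 0` into a pointwise one on the trace of the
mollified gradient. The integrations by parts below rely on this form. -/
lemma sum_conv_grad {v : E3 → E3} {g : E3 → Fin 3 → Fin 3 → ℝ} (hv : MemLp v 2 volume)
    (hdiv : WeakDivFree v) (hg : IsWeakGradient v g) {k : E3 → ℝ} (hk : IsTest k) (x : E3) :
    ∑ i, conv k (fun y => g y i i) x = 0 := by
  rw [← hdiv.sum_conv_pderiv hv hk x]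
  exact Finset.sum_congr rfl fun i _ => by rw [(hg.isWeakDeriv i i).conv_pderiv hk]

/-- The regularized convective terms without commutator cancel. -/
lemma sum_integral_conv_mul_conv_eq_zero {v : E3 → E3} {g : E3 → Fin 3 → Fin 3 → ℝ}
    (hv : MemLp v 2 volume) (hgm : ∀ i j, MemLp (fun x => g x i j) 2 volume)
    (hdiv : WeakDivFree v) (hg : IsWeakGradient v g) {k : E3 → ℝ} (hk : IsTest k) :
    ∑ i, ∑ j, ∫ x, conv k (fun y => v y i) x * conv k (fun y => v y j) x
      * conv k (fun y => g y i j) x = 0 := by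
  have h12 : (1 : ℝ≥0∞) ≤ 2 := by norm_num
  have h2t : (2 : ℝ≥0∞) ≠ ⊤ := by norm_num
  set w : Fin 3 → E3 → ℝ := fun i => conv k (fun y => v y i) with hw
  set γ : Fin 3 → Fin 3 → E3 → ℝ := fun i j => conv k (fun y => g y i j) with hγ
  have hvc := fun i => memLp_component hv i
  have hloc := fun i => locallyIntegrable_of_memLp_two (hvc i)
  have hw2 : ∀ i, MemLp (w i) 2 volume := fun i => memLp_conv (hk.memLp 1) (hvc i) h12 h2t
  have hwt : ∀ i, MemLp (w i) ⊤ volume := fun i => memLp_top_conv (p := 2) (q := 2) hk (hvc i)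
  have hγ2 : ∀ i j, MemLp (γ i j) 2 volume := fun i j =>
    memLp_conv (hk.memLp 1) (hgm i j) h12 h2t
  have hwc : ∀ i, ContDiff ℝ ∞ (w i) := fun i => contDiff_conv hk (hloc i)
  have hwγ : ∀ i j, pderiv i (w j) = γ i j := fun i j =>
    (hg.isWeakDeriv i j).pderiv_conv hk (hloc j)
  have htr : ∀ x, ∑ i, γ i i x = 0 := fun x => sum_conv_grad hv hdiv hg hk x
  have i1 : ∀ i j, Integrable (fun x => w i x * w j x * γ i j x) volume := fun i j =>
    (integrable_mul_top (memLp_one_mul (hw2 i) (hγ2 i j)) (hwt j)).congr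
      (Eventually.of_forall fun x => by ring)
  have i2 : ∀ i j, Integrable (fun x => γ i i x * w j x * w j x) volume := fun i j =>
    integrable_mul_top (memLp_one_mul (hγ2 i i) (hw2 j)) (hwt j)
  -- Integrating `wᵢ wⱼ ∂ᵢwⱼ` by parts reproduces the same integral with opposite sign, plus `∂ᵢwᵢ
  -- wⱼ²`, which sums to zero over `i`.
  have key : ∀ i j, 2 * ∫ x, w i x * w j x * γ i j x = -∫ x, γ i i x * w j x * w j x := by
    intro i j
    have e : pderiv i (fun x => w i x * w j x) = fun x => γ i i x * w j x + w i x * γ i j x := by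
      rw [pderiv_mul (hwc i) (hwc j), hwγ, hwγ]
    have e2 : (fun x => pderiv i (fun x => w i x * w j x) x * w j x)
        = fun x => γ i i x * w j x * w j x + w i x * w j x * γ i j x := by
      rw [e]; funext x; ring
    have h := integral_mul_pderiv ((hwc i).mul (hwc j)) (hwc j) i
      (by rw [e2]; exact (i2 i j).add (i1 i j)) (by rw [hwγ]; exact i1 i j)
      (integrable_mul_top (memLp_one_mul (hw2 i) (hw2 j)) (hwt j))
    rw [e2, integral_add (i2 i j) (i1 i j), hwγ] at h
    linarith
  have hsum : ∀ j, ∑ i, ∫ x, w i x * w j x * γ i j x = 0 := by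
    intro j
    have h1 : 2 * ∑ i, ∫ x, w i x * w j x * γ i j x = -∑ i, ∫ x, γ i i x * w j x * w j x := by
      rw [Finset.mul_sum, ← Finset.sum_neg_distrib]
      exact Finset.sum_congr rfl fun i _ => key i j
    rw [← integral_finsetSum _ fun i _ => i2 i j] at h1
    simp_rw [← Finset.sum_mul, htr] at h1
    simpa using h1
  rw [Finset.sum_comm]
  exact Finset.sum_eq_zero fun j _ => hsum j

/-- Integration by parts moving the derivative in `∫ a ∂₃w₃` to the horizontal components, for a
solenoidal mollified field `w`. -/
lemma integral_mul_conv_grad_two {v : E3 → E3} {g : E3 → Fin 3 → Fin 3 → ℝ}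
    (hv : MemLp v 2 volume) (hgm : ∀ i j, MemLp (fun x => g x i j) 2 volume)
    (hdiv : WeakDivFree v) (hg : IsWeakGradient v g) {k : E3 → ℝ} (hk : IsTest k)
    {a : E3 → ℝ} {c : Fin 3 → E3 → ℝ} (ha : ContDiff ℝ ∞ a) (ha1 : MemLp a 1 volume)
    (hc1 : ∀ i, MemLp (c i) 1 volume) (hac : ∀ i, pderiv i a = fun x => 2 * c i x) :
    ∫ x, a x * conv k (fun y => g y 2 2) x
      = 2 * (∫ x, c 0 x * conv k (fun y => v y 0) x)
        + 2 * ∫ x, c 1 x * conv k (fun y => v y 1) x := by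
  have hvc := fun i => memLp_component hv i
  have hloc := fun i => locallyIntegrable_of_memLp_two (hvc i)
  have hwt : ∀ i, MemLp (conv k (fun y => v y i)) ⊤ volume := fun i =>
    memLp_top_conv (p := 2) (q := 2) hk (hvc i)
  have hγt : ∀ i j, MemLp (conv k (fun y => g y i j)) ⊤ volume := fun i j =>
    memLp_top_conv (p := 2) (q := 2) hk (hgm i j)
  have hi : ∀ i, Integrable (fun x => a x * conv k (fun y => g y i i) x) volume := fun i =>
    integrable_mul_top ha1 (hγt i i)
  have key : ∀ i, ∫ x, a x * conv k (fun y => g y i i) x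
      = -(2 * ∫ x, c i x * conv k (fun y => v y i) x) := by
    intro i
    have hd := (hg.isWeakDeriv i i).pderiv_conv hk (hloc i)
    have e : (fun x => pderiv i a x * conv k (fun y => v y i) x)
        = fun x => 2 * (c i x * conv k (fun y => v y i) x) := by
      rw [hac]; funext x; ring
    have h := integral_mul_pderiv ha (contDiff_conv hk (hloc i)) i
      (by rw [e]; exact (integrable_mul_top (hc1 i) (hwt i)).const_mul 2)
      (by rw [hd]; exact hi i) (integrable_mul_top ha1 (hwt i))
    rw [hd, e, integral_const_mul] at h
    exact h
  -- Incompressibility trades `∂₃w₃` for `-∂₁w₁ - ∂₂w₂`, after which `key` is used only for the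
  -- horizontal indices.
  have hsum : ∑ i, ∫ x, a x * conv k (fun y => g y i i) x = 0 := by
    rw [← integral_finsetSum _ fun i _ => hi i]
    simp_rw [← Finset.mul_sum, sum_conv_grad hv hdiv hg hk]
    simp
  rw [Fin.sum_univ_three] at hsum
  linarith [key 0, key 1]

/-! ### Limit and uniform bound of the regularized convective term -/

section

/-- The regularized convective term `∑ ∫ (vᵢvⱼ)_ε ∂ᵢ(vⱼ)_ε`. -/
noncomputable def convective (k : E3 → ℝ) (v : E3 → E3) (g : E3 → Fin 3 → Fin 3 → ℝ) : ℝ :=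
  ∑ i, ∑ j, ∫ x, conv k (fun y => v y i * v y j) x * conv k (fun y => g y i j) x

/-- The exponent `s` with `1/s = 1/r + 1/2`. -/
lemma exists_holder_exponent {q r : ℝ≥0∞} (h : ENNReal.HolderTriple q r 2) :
    ∃ s : ℝ≥0∞, ENNReal.HolderTriple r 2 s ∧ ENNReal.HolderTriple s q 1 ∧ 1 ≤ s ∧ s ≠ ⊤ := by
  have h1 := h.inv_add_inv_eq_inv
  have h2 : r⁻¹ + 2⁻¹ + q⁻¹ = 1 := by
    rw [add_right_comm, add_comm r⁻¹, h1, ENNReal.inv_two_add_inv_two]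
  -- Since `1/q + 1/r = 1/2`, adding `1/2` shows that this exponent is also conjugate to `q`.
  refine ⟨(r⁻¹ + 2⁻¹)⁻¹, ⟨by rw [inv_inv]⟩, ⟨by rw [inv_inv, inv_one, h2]⟩, ?_, ?_⟩
  · rw [ENNReal.one_le_inv, ← h2]
    exact le_self_add
  · rw [ENNReal.inv_ne_top]
    simp

lemma one_le_of_holder {q r : ℝ≥0∞} (h : ENNReal.HolderTriple q r 2) : 1 ≤ q := by
  have h1 := h.inv_add_inv_eq_inv
  rw [← ENNReal.inv_le_one]
  calc q⁻¹ ≤ q⁻¹ + r⁻¹ := le_self_add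
    _ = 2⁻¹ := h1
    _ ≤ 1 := by simp

instance : ENNReal.HolderTriple 4 4 2 where
  inv_add_inv_eq_inv := by
    rw [show (4 : ℝ≥0∞) = 2 * 2 by norm_num, ENNReal.mul_inv (by simp) (by simp), ← mul_add,
      ENNReal.inv_two_add_inv_two, mul_one]

variable {q r : ℝ≥0∞} {v : E3 → E3} {g : E3 → Fin 3 → Fin 3 → ℝ}

/-- Products of velocity components other than `v₃²` are in `L²`. -/
lemma IsRegularSlice.exists_exponents [hqr : ENNReal.HolderTriple q r 2] (h : IsRegularSlice q r v g)
    (hq : q ≠ ⊤) (hr : r ≠ ⊤) (i j : Fin 3) (hij : ¬(i = 2 ∧ j = 2)) :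
    ∃ a b : ℝ≥0∞, ENNReal.HolderTriple a b 2 ∧ a ≠ ⊤ ∧ b ≠ ⊤ ∧
      MemLp (fun x => v x i) a volume ∧ MemLp (fun x => v x j) b volume := by
  by_cases hi : i = 2
  · subst hi
    have hj : j ≠ 2 := fun hj => hij ⟨rfl, hj⟩
    exact ⟨r, q, hqr.symm, hr, hq, h.memLp_r, h.memLp_q j hj⟩
  · by_cases hj : j = 2
    · subst hj
      exact ⟨q, r, hqr, hq, hr, h.memLp_q i hi, h.memLp_r⟩
    · exact ⟨4, 4, inferInstance, by norm_num, by norm_num, h.memLp_four i hi, h.memLp_four j hj⟩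

lemma IsRegularSlice.pderiv_conv_sq (h : IsRegularSlice q r v g) {k : E3 → ℝ} (hk : IsTest k)
    (i : Fin 3) : pderiv i (NavierStokes.conv k (fun y => v y 2 * v y 2))
      = fun x => 2 * NavierStokes.conv k (fun y => v y 2 * g y i 2) x := by
  have hv := memLp_component h.memLp 2
  rw [((h.grad.isWeakDeriv i 2).sq hv (h.grad_memLp i 2)).pderiv_conv hk
    ((memLp_one_mul hv hv).locallyIntegrable le_rfl)]
  funext x
  simp only [conv]
  rw [← integral_const_mul]
  congr 1; funext y; ring

/-- This rewriting avoids any estimate of `v₃²` in `L²`: on the right each product pairs `v₃ ∂ᵢv₃ ∈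
L^s` with a horizontal component in `L^q`. -/
lemma IsRegularSlice.convective_two_two (h : IsRegularSlice q r v g) {k : E3 → ℝ}
    (hk : IsTest k) :
    ∫ x, conv k (fun y => v y 2 * v y 2) x * conv k (fun y => g y 2 2) x
      = 2 * (∫ x, conv k (fun y => v y 2 * g y 0 2) x * conv k (fun y => v y 0) x)
        + 2 * ∫ x, conv k (fun y => v y 2 * g y 1 2) x * conv k (fun y => v y 1) x := by
  have hv := memLp_component h.memLp 2
  have hvv := memLp_one_mul hv hv
  exact integral_mul_conv_grad_two (c := fun i => conv k (fun y => v y 2 * g y i 2)) h.memLp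
    h.grad_memLp h.div_free h.grad hk
    (contDiff_conv hk (hvv.locallyIntegrable le_rfl))
    (memLp_conv (hk.memLp 1) hvv le_rfl (by norm_num))
    (fun i => memLp_conv (hk.memLp 1) (memLp_one_mul hv (h.grad_memLp i 2)) le_rfl (by norm_num))
    (fun i => h.pderiv_conv_sq hk i)

/-- The same integration by parts when the mollification precedes the product, so that both
regularizations can be compared through the same limit. -/
lemma IsRegularSlice.convective_two_two' (h : IsRegularSlice q r v g) {k : E3 → ℝ}
    (hk : IsTest k) :
    ∫ x, conv k (fun y => v y 2) x * conv k (fun y => v y 2) x * conv k (fun y => g y 2 2) x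
      = 2 * (∫ x, conv k (fun y => v y 2) x * conv k (fun y => g y 0 2) x
          * conv k (fun y => v y 0) x)
        + 2 * ∫ x, conv k (fun y => v y 2) x * conv k (fun y => g y 1 2) x
          * conv k (fun y => v y 1) x := by
  have h12 : (1 : ℝ≥0∞) ≤ 2 := by norm_num
  have h2t : (2 : ℝ≥0∞) ≠ ⊤ := by norm_num
  have hv := memLp_component h.memLp 2
  have hJ := memLp_conv (hk.memLp 1) hv h12 h2t
  have hloc := locallyIntegrable_of_memLp_two hv
  have hc := contDiff_conv hk hloc
  refine integral_mul_conv_grad_two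
    (a := fun x => conv k (fun y => v y 2) x * conv k (fun y => v y 2) x)
    (c := fun i x => conv k (fun y => v y 2) x * conv k (fun y => g y i 2) x) h.memLp
    h.grad_memLp h.div_free h.grad hk (hc.mul hc) (memLp_one_mul hJ hJ)
    (fun i => memLp_one_mul hJ (memLp_conv (hk.memLp 1) (h.grad_memLp i 2) h12 h2t)) fun i => ?_
  rw [pderiv_mul hc hc, (h.grad.isWeakDeriv i 2).pderiv_conv hk hloc]
  funext x; ring

/-- The regularized convective terms of a regular slice tend to zero. -/
lemma IsRegularSlice.tendsto_convective [hqr : ENNReal.HolderTriple q r 2]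
    (h : IsRegularSlice q r v g) (hq : q ≠ ⊤) (hr : r ≠ ⊤) :
    Tendsto (fun n => convective (moll n) v g) atTop (𝓝 0) := by
  have h12 : (1 : ℝ≥0∞) ≤ 2 := by norm_num
  have h2t : (2 : ℝ≥0∞) ≠ ⊤ := by norm_num
  have hgt := fun i j => tendstoLp_moll (h.grad_memLp i j) h12 h2t
  -- Mollifying before or after taking the product gives the same limit, entry by entry. The sum
  -- over the second kind is identically zero, which forces the limits to sum to zero.
  have key : ∀ i j, ∃ L, Tendsto (fun n => ∫ x, conv (moll n) (fun y => v y i * v y j) x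
        * conv (moll n) (fun y => g y i j) x) atTop (𝓝 L) ∧
      Tendsto (fun n => ∫ x, conv (moll n) (fun y => v y i) x * conv (moll n) (fun y => v y j) x
        * conv (moll n) (fun y => g y i j) x) atTop (𝓝 L) := by
    intro i j
    by_cases hij : i = 2 ∧ j = 2
    · obtain ⟨rfl, rfl⟩ := hij
      obtain ⟨s, hs1, hs2, hs3, hs4⟩ := exists_holder_exponent hqr
      have hq1 := one_le_of_holder hqr
      have hr1 := one_le_of_holder hqr.symm
      have e1 : ∀ i : Fin 3, i ≠ 2 → Tendsto (fun n => ∫ x, conv (moll n)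
          (fun y => v y 2 * g y i 2) x * conv (moll n) (fun y => v y i) x) atTop
          (𝓝 (∫ x, v x 2 * g x i 2 * v x i)) := fun i hi =>
        (tendstoLp_moll ((h.grad_memLp i 2).mul' h.memLp_r) hs3 hs4).integral_mul hq1
          (tendstoLp_moll (h.memLp_q i hi) hq1 hq)
      have e2 : ∀ i : Fin 3, i ≠ 2 → Tendsto (fun n => ∫ x, conv (moll n) (fun y => v y 2) x
          * conv (moll n) (fun y => g y i 2) x * conv (moll n) (fun y => v y i) x) atTop
          (𝓝 (∫ x, v x 2 * g x i 2 * v x i)) := fun i hi =>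
        ((tendstoLp_moll h.memLp_r hr1 hr).mul hs3 h12 (hgt i 2)).integral_mul hq1
          (tendstoLp_moll (h.memLp_q i hi) hq1 hq)
      refine ⟨2 * (∫ x, v x 2 * g x 0 2 * v x 0) + 2 * ∫ x, v x 2 * g x 1 2 * v x 1, ?_, ?_⟩
      · simp_rw [h.convective_two_two (isTest_moll _)]
        exact ((e1 0 (by decide)).const_mul 2).add ((e1 1 (by decide)).const_mul 2)
      · simp_rw [h.convective_two_two' (isTest_moll _)]
        exact ((e2 0 (by decide)).const_mul 2).add ((e2 1 (by decide)).const_mul 2)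
    · obtain ⟨a, b, hab, ha, hb, hva, hvb⟩ := h.exists_exponents hq hr i j hij
      have hva' := tendstoLp_moll hva (one_le_of_holder hab) ha
      have hvb' := tendstoLp_moll hvb (one_le_of_holder hab.symm) hb
      exact ⟨_, (tendstoLp_moll (hvb.mul' hva) h12 h2t).integral_mul h12 (hgt i j),
        (hva'.mul h12 (one_le_of_holder hab.symm) hvb').integral_mul h12 (hgt i j)⟩
  choose L hL hL' using key
  have l1 : Tendsto (fun n => convective (moll n) v g) atTop (𝓝 (∑ i, ∑ j, L i j)) :=
    tendsto_finsetSum _ fun i _ => tendsto_finsetSum _ fun j _ => hL i j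
  have l2 := tendsto_finsetSum Finset.univ fun i _ =>
    tendsto_finsetSum Finset.univ fun j _ => hL' i j
  simp_rw [sum_integral_conv_mul_conv_eq_zero h.memLp h.grad_memLp h.div_free h.grad
    (isTest_moll _)] at l2
  rwa [← tendsto_nhds_unique tendsto_const_nhds l2] at l1

lemma mul_le_sq_add_sq (a b : ℝ≥0∞) : a * b ≤ a ^ 2 + b ^ 2 := by
  rcases le_total a b with hab | hab
  · calc a * b ≤ b * b := by gcongr
      _ ≤ a ^ 2 + b ^ 2 := by rw [← sq]; exact le_add_self
  · calc a * b ≤ a * a := by gcongr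
      _ ≤ a ^ 2 + b ^ 2 := by rw [← sq]; exact le_self_add

lemma enorm_integral_mul_le {f h : E3 → ℝ} (hf : AEStronglyMeasurable f volume)
    (hh : AEStronglyMeasurable h volume) (p p' : ℝ≥0∞) [ENNReal.HolderTriple p p' 1] :
    ‖∫ x, f x * h x‖ₑ ≤ eLpNorm f p volume * eLpNorm h p' volume :=
  (enorm_integral_le_lintegral_enorm _).trans <|
    (eLpNorm_one_eq_lintegral_enorm (f := fun x => f x * h x)).symm.trans_le
      (eLpNorm_mul_le hf hh p p' 1)

/-- The regularized convective terms are bounded uniformly in the regularization. -/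
lemma IsRegularSlice.enorm_convective_le [hqr : ENNReal.HolderTriple q r 2]
    (h : IsRegularSlice q r v g) (hq : q ≠ ⊤) {D : ℝ≥0∞}
    (h4 : ∀ i : Fin 3, i ≠ 2 → eLpNorm (fun x => v x i) 4 volume ^ 4 ≤ D)
    (hqD : ∀ i : Fin 3, i ≠ 2 →
      (eLpNorm (fun x => v x i) q volume * eLpNorm (fun x => v x 2) r volume) ^ 2 ≤ D)
    (hg : ∀ i j, eLpNorm (fun x => g x i j) 2 volume ^ 2 ≤ D) (n : ℕ) :
    ‖convective (moll n) v g‖ₑ ≤ 9 * (8 * D) := by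
  have h12 : (1 : ℝ≥0∞) ≤ 2 := by norm_num
  have h2t : (2 : ℝ≥0∞) ≠ ⊤ := by norm_num
  have hq1 := one_le_of_holder hqr
  have hvm := fun i => (memLp_component h.memLp i).1
  have hJg : ∀ i j, eLpNorm (conv (moll n) fun y => g y i j) 2 volume ^ 2 ≤ D := fun i j =>
    le_trans (by gcongr; exact eLpNorm_conv_moll_le n (h.grad_memLp i j).1 h12 h2t) (hg i j)
  have hJgm := fun i j => (memLp_conv_moll (h.grad_memLp i j) h12 h2t n).1
  -- The case in which the product `vᵢvⱼ` is itself in `L²`; it gives `3 D`, enlarged to the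
  -- constant needed for `i = j = 2`.
  have gen : ∀ i j (a b : ℝ≥0∞), ENNReal.HolderTriple a b 2 →
      (eLpNorm (fun x => v x i) a volume * eLpNorm (fun x => v x j) b volume) ^ 2 ≤ 2 * D →
      ‖∫ x, conv (moll n) (fun y => v y i * v y j) x * conv (moll n) (fun y => g y i j) x‖ₑ
        ≤ 8 * D := by
    intro i j a b hab hD
    have hm : AEStronglyMeasurable (fun y => v y i * v y j) volume := (hvm i).mul (hvm j)
    calc _ ≤ eLpNorm (conv (moll n) fun y => v y i * v y j) 2 volume
          * eLpNorm (conv (moll n) fun y => g y i j) 2 volume :=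
          enorm_integral_mul_le (aestronglyMeasurable_conv
            (isTest_moll n).continuous.aestronglyMeasurable hm) (hJgm i j) 2 2
      _ ≤ eLpNorm (conv (moll n) fun y => v y i * v y j) 2 volume ^ 2
          + eLpNorm (conv (moll n) fun y => g y i j) 2 volume ^ 2 := mul_le_sq_add_sq _ _
      _ ≤ 2 * D + D := by
          gcongr ?_ + ?_
          · refine le_trans ?_ hD
            gcongr
            exact (eLpNorm_conv_moll_le n hm h12 h2t).trans
              (eLpNorm_mul_le (hvm i) (hvm j) a b 2)
          · exact hJg i j
      _ = 3 * D := by ring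
      _ ≤ 8 * D := by gcongr; norm_num
  have hterm : ∀ i j, ‖∫ x, conv (moll n) (fun y => v y i * v y j) x
      * conv (moll n) (fun y => g y i j) x‖ₑ ≤ 8 * D := by
    intro i j
    have hD2 : D ≤ 2 * D := le_mul_of_one_le_left' h12
    by_cases hi : i = 2 <;> by_cases hj : j = 2
    · subst hi hj
      obtain ⟨s, hs1, hs2, hs3, hs4⟩ := exists_holder_exponent hqr
      have hb : ∀ i : Fin 3, i ≠ 2 → ‖∫ x, conv (moll n) (fun y => v y 2 * g y i 2) x
          * conv (moll n) (fun y => v y i) x‖ₑ ≤ 2 * D := by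
        intro i hi
        have hm : AEStronglyMeasurable (fun y => v y 2 * g y i 2) volume :=
          (hvm 2).mul (h.grad_memLp i 2).1
        calc _ ≤ eLpNorm (conv (moll n) fun y => v y 2 * g y i 2) s volume
              * eLpNorm (conv (moll n) fun y => v y i) q volume :=
              enorm_integral_mul_le (aestronglyMeasurable_conv
                (isTest_moll n).continuous.aestronglyMeasurable hm)
                (memLp_conv_moll (h.memLp_q i hi) hq1 hq n).1 s q
          _ ≤ (eLpNorm (fun x => v x 2) r volume * eLpNorm (fun x => g x i 2) 2 volume)
              * eLpNorm (fun x => v x i) q volume := by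
              gcongr
              · exact (eLpNorm_conv_moll_le n hm hs3 hs4).trans
                  (eLpNorm_mul_le (hvm 2) (h.grad_memLp i 2).1 r 2 s)
              · exact eLpNorm_conv_moll_le n (hvm i) hq1 hq
          _ = (eLpNorm (fun x => v x i) q volume * eLpNorm (fun x => v x 2) r volume)
              * eLpNorm (fun x => g x i 2) 2 volume := by ring
          _ ≤ _ := mul_le_sq_add_sq _ _
          _ ≤ D + D := add_le_add (hqD i hi) (hg i 2)
          _ = 2 * D := by ring
      rw [h.convective_two_two (isTest_moll n)]
      refine (enorm_add_le _ _).trans ?_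
      rw [enorm_mul, enorm_mul]
      have h2e : ‖(2 : ℝ)‖ₑ = 2 := by
        rw [Real.enorm_of_nonneg (by norm_num)]; simp
      rw [h2e]
      -- Two horizontal terms, each at most `2 D` and carrying the factor `2` of the chain rule:
      -- this is the origin of the `8`.
      calc _ ≤ 2 * (2 * D) + 2 * (2 * D) := by
            gcongr
            · exact hb 0 (by decide)
            · exact hb 1 (by decide)
        _ = 8 * D := by ring
    · subst hi
      refine gen 2 j r q hqr.symm ((le_of_eq ?_).trans ((hqD j hj).trans hD2))
      rw [mul_comm]
    · subst hj
      exact gen i 2 q r hqr ((hqD i hi).trans hD2)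
    · refine gen i j 4 4 inferInstance ?_
      calc (eLpNorm (fun x => v x i) 4 volume * eLpNorm (fun x => v x j) 4 volume) ^ 2
          = eLpNorm (fun x => v x i) 4 volume ^ 2 * eLpNorm (fun x => v x j) 4 volume ^ 2 := by
            ring
        _ ≤ _ := mul_le_sq_add_sq _ _
        _ = eLpNorm (fun x => v x i) 4 volume ^ 4 + eLpNorm (fun x => v x j) 4 volume ^ 4 := by
            ring
        _ ≤ D + D := add_le_add (h4 i hi) (h4 j hj)
        _ = 2 * D := by ring
  rw [convective]
  calc _ ≤ ∑ i : Fin 3, ‖∑ j, ∫ x, conv (moll n) (fun y => v y i * v y j) x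
          * conv (moll n) (fun y => g y i j) x‖ₑ := enorm_sum_le _ _
    _ ≤ ∑ i : Fin 3, ∑ j : Fin 3, 8 * D := by
        refine Finset.sum_le_sum fun i _ => (enorm_sum_le _ _).trans ?_
        exact Finset.sum_le_sum fun j _ => hterm i j
    _ = 9 * (8 * D) := by
        simp only [Finset.sum_const, Finset.card_univ, Fintype.card_fin, nsmul_eq_mul]
        ring

end

/-! ### An abstract energy identity in a Hilbert space -/

lemma intervalIntegrable_of_bounded {T C : ℝ} {f : ℝ → ℝ}
    (hf : AEStronglyMeasurable f (volume.restrict (Ioc 0 T))) (hC : ∀ τ ∈ Icc 0 T, |f τ| ≤ C)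
    {s t : ℝ} (hs : s ∈ Icc 0 T) (ht : t ∈ Icc 0 T) : IntervalIntegrable f volume s t := by
  have h0 : IntervalIntegrable f volume 0 T := by
    rw [intervalIntegrable_iff_integrableOn_Ioc_of_le (hs.1.trans hs.2)]
    refine Integrable.of_bound hf C ?_
    exact (ae_restrict_mem measurableSet_Ioc).mono fun x hx => hC x (Ioc_subset_Icc_self hx)
  refine h0.mono_set ?_
  rw [uIcc_of_le (hs.1.trans hs.2)]
  exact uIcc_subset_Icc hs ht

section Hilbert

variable {H : Type*} [NormedAddCommGroup H] [InnerProductSpace ℝ H] {T C : ℝ} {v F : ℝ → H}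
  {W : Submodule ℝ H}

lemma abs_inner_le_of_bound (hC : ∀ τ ∈ Icc 0 T, ‖F τ‖ ≤ C) (w : H) {τ : ℝ} (hτ : τ ∈ Icc 0 T) :
    |inner ℝ (F τ) w| ≤ C * ‖w‖ :=
  (abs_real_inner_le_norm _ _).trans (by gcongr; exact hC τ hτ)

/-- A weak evolution identity tested against `W` may be tested against the closure of `W`. -/
lemma weak_identity_closure (hC : ∀ τ ∈ Icc 0 T, ‖F τ‖ ≤ C)
    (hmeas : ∀ w ∈ W, AEStronglyMeasurable (fun τ => inner ℝ (F τ) w) (volume.restrict (Ioc 0 T)))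
    (hid : ∀ w ∈ W, ∀ t ∈ Icc 0 T, inner ℝ (v t - v 0) w = ∫ τ in (0 : ℝ)..t, inner ℝ (F τ) w)
    {w : H} (hw : w ∈ W.topologicalClosure) :
    AEStronglyMeasurable (fun τ => inner ℝ (F τ) w) (volume.restrict (Ioc 0 T)) ∧
      ∀ t ∈ Icc 0 T, inner ℝ (v t - v 0) w = ∫ τ in (0 : ℝ)..t, inner ℝ (F τ) w := by
  obtain ⟨x, hxW, hx⟩ := mem_closure_iff_seq_limit.1 hw
  have hpt : ∀ a : H, Tendsto (fun n => inner ℝ a (x n)) atTop (𝓝 (inner ℝ a w)) := fun a =>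
    tendsto_const_nhds.inner hx
  refine ⟨aestronglyMeasurable_of_tendsto_ae atTop (fun n => hmeas (x n) (hxW n))
    (Eventually.of_forall fun τ => hpt (F τ)), fun t ht => ?_⟩
  obtain ⟨B, hB⟩ := (hx.norm.isBoundedUnder_le).eventually_le
  have hC0 : 0 ≤ C := (norm_nonneg _).trans (hC t ht)
  -- Dominated convergence with the constant `C * B`, where `B` eventually bounds the norms of the
  -- convergent sequence. Only scalar pairings of `F` need be measurable.
  have hlim : Tendsto (fun n => ∫ τ in (0 : ℝ)..t, inner ℝ (F τ) (x n)) atTop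
      (𝓝 (∫ τ in (0 : ℝ)..t, inner ℝ (F τ) w)) := by
    refine intervalIntegral.tendsto_integral_filter_of_dominated_convergence (fun _ => C * B)
      (Eventually.of_forall fun n => ?_) ?_ intervalIntegrable_const
      (Eventually.of_forall fun τ _ => hpt (F τ))
    · rw [uIoc_of_le ht.1]
      exact (hmeas (x n) (hxW n)).mono_measure
        (Measure.restrict_mono (Ioc_subset_Ioc_right ht.2) le_rfl)
    · filter_upwards [hB] with n hn
      refine Eventually.of_forall fun τ hτ => ?_
      rw [uIoc_of_le ht.1] at hτ
      refine (abs_inner_le_of_bound hC (x n) ⟨hτ.1.le, hτ.2.trans ht.2⟩).trans ?_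
      gcongr
  refine tendsto_nhds_unique (hpt (v t - v 0)) (hlim.congr fun n => ?_)
  exact (hid (x n) (hxW n) t ht).symm

/-- The energy identity for a weak evolution equation with bounded right-hand side. -/
lemma energy_identity_of_weak (hC : ∀ τ ∈ Icc 0 T, ‖F τ‖ ≤ C)
    (hv : ∀ t ∈ Icc 0 T, v t ∈ W.topologicalClosure)
    (hmeas : ∀ w ∈ W, AEStronglyMeasurable (fun τ => inner ℝ (F τ) w) (volume.restrict (Ioc 0 T)))
    (hid : ∀ w ∈ W, ∀ t ∈ Icc 0 T, inner ℝ (v t - v 0) w = ∫ τ in (0 : ℝ)..t, inner ℝ (F τ) w)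
    (hm : AEStronglyMeasurable (fun τ => inner ℝ (F τ) (v τ)) (volume.restrict (Ioc 0 T)))
    {t : ℝ} (ht : t ∈ Icc 0 T) :
    1 / 2 * ‖v t‖ ^ 2 - 1 / 2 * ‖v 0‖ ^ 2 = ∫ τ in (0 : ℝ)..t, inner ℝ (F τ) (v τ) := by
  have h0T : (0 : ℝ) ∈ Icc 0 T := ⟨le_rfl, ht.1.trans ht.2⟩
  have hC0 : 0 ≤ C := (norm_nonneg _).trans (hC t ht)
  have hii : ∀ w ∈ W.topologicalClosure, ∀ s ∈ Icc 0 T, ∀ t ∈ Icc 0 T,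
      IntervalIntegrable (fun τ => inner ℝ (F τ) w) volume s t := fun w hw s hs t ht =>
    intervalIntegrable_of_bounded (weak_identity_closure hC hmeas hid hw).1
      (fun τ hτ => abs_inner_le_of_bound hC w hτ) hs ht
  have hst : ∀ w ∈ W.topologicalClosure, ∀ s ∈ Icc 0 T, ∀ t ∈ Icc 0 T,
      inner ℝ (v t - v s) w = ∫ τ in s..t, inner ℝ (F τ) w := by
    intro w hw s hs t ht
    have h1 := (weak_identity_closure hC hmeas hid hw).2
    rw [← intervalIntegral.integral_interval_sub_left (hii w hw 0 h0T t ht) (hii w hw 0 h0T s hs),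
      ← h1 t ht, ← h1 s hs, ← inner_sub_left, sub_sub_sub_cancel_right]
  -- The increment `v t - v s` lies in the closure, so it may serve as its own test vector.
  have hlip : ∀ s ∈ Icc 0 T, ∀ t ∈ Icc 0 T, ‖v t - v s‖ ≤ C * |t - s| := by
    intro s hs t ht
    have h1 := hst _ (sub_mem (hv t ht) (hv s hs)) s hs t ht
    have h2 : ‖∫ τ in s..t, inner ℝ (F τ) (v t - v s)‖ ≤ C * ‖v t - v s‖ * |t - s| :=
      intervalIntegral.norm_integral_le_of_norm_le_const fun τ hτ =>
        abs_inner_le_of_bound hC _ (uIcc_subset_Icc hs ht (uIoc_subset_uIcc hτ))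
    rw [← h1, real_inner_self_eq_norm_sq, Real.norm_of_nonneg (by positivity)] at h2
    rcases (norm_nonneg (v t - v s)).eq_or_lt with h3 | h3
    · rw [← h3]; positivity
    · nlinarith
  obtain ⟨B, hB⟩ : ∃ B, ∀ τ ∈ Icc 0 T, |inner ℝ (F τ) (v τ)| ≤ B := by
    refine ⟨C * (‖v 0‖ + C * T), fun τ hτ => (abs_inner_le_of_bound hC _ hτ).trans ?_⟩
    have h1 := hlip 0 h0T τ hτ
    have h2 : ‖v τ‖ ≤ ‖v 0‖ + ‖v τ - v 0‖ := norm_le_norm_add_norm_sub' _ _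
    rw [sub_zero, abs_of_nonneg hτ.1] at h1
    have h3 : C * τ ≤ C * T := by gcongr; exact hτ.2
    gcongr
    linarith
  have hvi : ∀ s ∈ Icc 0 T, ∀ t ∈ Icc 0 T,
      IntervalIntegrable (fun τ => inner ℝ (F τ) (v τ)) volume s t := fun s hs t ht =>
    intervalIntegrable_of_bounded hm hB hs ht
  set k : ℝ → ℝ := fun t => 1 / 2 * ‖v t‖ ^ 2 - ∫ τ in (0 : ℝ)..t, inner ℝ (F τ) (v τ) with hk
  -- Testing with the midpoint `(v t + v s)/2` produces exactly `½‖v t‖² - ½‖v s‖²`. The midpoint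
  -- differs from `v τ` by at most `C |t - s|`, so the defect `k` has quadratic increments; its
  -- derivative vanishes and it is constant.
  have hquad : ∀ s ∈ Icc 0 T, ∀ t ∈ Icc 0 T, ‖k t - k s‖ ≤ C ^ 2 * ‖‖t - s‖ ^ 2‖ := by
    intro s hs t ht
    have hmem : (1 / 2 : ℝ) • (v t + v s) ∈ W.topologicalClosure :=
      Submodule.smul_mem _ _ (add_mem (hv t ht) (hv s hs))
    have e : k t - k s = ∫ τ in s..t, inner ℝ (F τ) ((1 / 2 : ℝ) • (v t + v s) - v τ) := by
      simp_rw [inner_sub_right]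
      rw [intervalIntegral.integral_sub (hii _ hmem s hs t ht) (hvi s hs t ht),
        ← hst _ hmem s hs t ht,
        ← intervalIntegral.integral_interval_sub_left (hvi 0 h0T t ht) (hvi 0 h0T s hs)]
      have : inner ℝ (v t - v s) ((1 / 2 : ℝ) • (v t + v s))
          = 1 / 2 * ‖v t‖ ^ 2 - 1 / 2 * ‖v s‖ ^ 2 := by
        rw [inner_smul_right, inner_add_right, inner_sub_left, inner_sub_left,
          real_inner_self_eq_norm_sq, real_inner_self_eq_norm_sq, real_inner_comm (v t) (v s)]
        ring
      rw [this, hk]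
      ring
    rw [e]
    have h2 : ‖∫ τ in s..t, inner ℝ (F τ) ((1 / 2 : ℝ) • (v t + v s) - v τ)‖
        ≤ C * (C * |t - s|) * |t - s| := by
      refine intervalIntegral.norm_integral_le_of_norm_le_const fun τ hτ => ?_
      have hτ' := uIoc_subset_uIcc hτ
      have hτT := uIcc_subset_Icc hs ht hτ'
      refine (abs_inner_le_of_bound hC _ hτT).trans ?_
      gcongr
      have e2 : (1 / 2 : ℝ) • (v t + v s) - v τ
          = (1 / 2 : ℝ) • (v t - v τ) + (1 / 2 : ℝ) • (v s - v τ) := by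
        rw [← smul_add, show v t - v τ + (v s - v τ) = v t + v s - (2 : ℝ) • v τ by
          rw [two_smul]; abel, smul_sub, smul_smul]
        norm_num
      have h3 := hlip τ hτT t ht
      have h4 := hlip τ hτT s hs
      have h5 : |t - τ| ≤ |t - s| :=
        abs_sub_right_of_mem_uIcc hτ'
      have h6 : |s - τ| ≤ |t - s| := by
        rw [abs_sub_comm s τ]; exact abs_sub_left_of_mem_uIcc hτ'
      rw [e2]
      refine (norm_add_le _ _).trans ?_
      rw [norm_smul, norm_smul]
      norm_num
      nlinarith [mul_le_mul_of_nonneg_left h5 hC0, mul_le_mul_of_nonneg_left h6 hC0]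
    refine h2.trans_eq ?_
    rw [norm_pow, Real.norm_eq_abs, Real.norm_eq_abs, abs_abs]
    ring
  have hder : ∀ s ∈ Icc 0 T, HasDerivWithinAt k 0 (Icc 0 T) s := by
    intro s hs
    rw [hasDerivWithinAt_iff_isLittleO]
    have h1 : (fun t => k t - k s) =O[𝓝[Icc 0 T] s] fun t => ‖t - s‖ ^ 2 :=
      Asymptotics.IsBigO.of_bound (C ^ 2)
        (eventually_mem_nhdsWithin.mono fun t ht => hquad s hs t ht)
    have h2 := h1.trans_isLittleO
      ((Asymptotics.isLittleO_pow_sub_sub s one_lt_two).mono nhdsWithin_le_nhds)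
    simpa using h2
  have hconst := constant_of_derivWithin_zero (fun s hs => (hder s hs).differentiableWithinAt)
    (fun s hs => (hder s (Ico_subset_Icc_self hs)).derivWithin
      (uniqueDiffOn_Icc (hs.1.trans_lt hs.2) s (Ico_subset_Icc_self hs))) t ht
  simp only [hk, intervalIntegral.integral_same] at hconst
  linarith

end Hilbert

/-! ### Weak time derivatives of scalar functions -/

/-- A test function on `(0,T)` is, on `[0,T]`, the derivative of an admissible test function in
time. -/
lemma exists_time_primitive {T : ℝ} (hT : 0 < T) {ζ : ℝ → ℝ} (hζ : ContDiff ℝ ∞ ζ)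
    (hsupp : tsupport ζ ⊆ Ioo 0 T) :
    ∃ θ : ℝ → ℝ, ContDiff ℝ ∞ θ ∧ HasCompactSupport θ ∧ tsupport θ ⊆ Iio T ∧
      ∀ t, 0 ≤ t → HasDerivAt θ (ζ t) t := by
  -- The primitive is anchored at `T`, so that it vanishes to the right of the support of `ζ`,
  -- including near `T`.
  set P : ℝ → ℝ := fun t => ∫ s in T..t, ζ s with hP
  have hPd : ∀ t, HasDerivAt P (ζ t) t := fun t =>
    intervalIntegral.integral_hasDerivAt_right (hζ.continuous.intervalIntegrable _ _)
      (hζ.continuous.stronglyMeasurableAtFilter _ _) hζ.continuous.continuousAt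
  have hPc : ContDiff ℝ ∞ P := by
    have hd : deriv P = ζ := funext fun t => (hPd t).deriv
    rw [contDiff_infty_iff_deriv]
    exact ⟨fun t => (hPd t).differentiableAt, by rw [hd]; exact hζ⟩
  -- To the left of the support the primitive is a constant, possibly nonzero. The factor cuts it
  -- off between `-2` and `-1`, away from the times `t ≥ 0` where the derivative matters.
  set χ : ℝ → ℝ := fun t => Real.smoothTransition (t + 2) with hχ
  have hχc : ContDiff ℝ ∞ χ := Real.smoothTransition.contDiff.comp (contDiff_id.add contDiff_const)
  have hcomp : IsCompact (tsupport ζ) := isCompact_Icc.of_isClosed_subset (isClosed_tsupport ζ)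
    (hsupp.trans Ioo_subset_Icc_self)
  obtain ⟨b, hb0, hbT, hb⟩ : ∃ b, 0 < b ∧ b < T ∧ tsupport ζ ⊆ Iic b := by
    rcases (tsupport ζ).eq_empty_or_nonempty with h | h
    · exact ⟨T / 2, by linarith, by linarith, by simp [h]⟩
    · obtain ⟨b, hb, hmax⟩ := hcomp.exists_isGreatest h
      exact ⟨b, (hsupp hb).1, (hsupp hb).2, hmax⟩
  have hP0 : ∀ t, b < t → P t = 0 := by
    intro t ht
    rw [hP]
    refine intervalIntegral.integral_zero_ae (Eventually.of_forall fun s hs => ?_)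
    have hs' : b < s := by
      rcases uIoc_subset_uIcc hs with hs
      exact (lt_min hbT ht).trans_le hs.1
    exact image_eq_zero_of_notMem_tsupport fun h => absurd (hb h) (not_le.2 hs')
  have hsub : Function.support (fun t => χ t * P t) ⊆ Icc (-2) b := by
    intro t ht
    constructor
    · by_contra h
      refine ht ?_
      simp [hχ, Real.smoothTransition.zero_of_nonpos (show t + 2 ≤ 0 by linarith)]
    · by_contra h
      exact ht (by simp [hP0 t (not_le.1 h)])
  have hts : tsupport (fun t => χ t * P t) ⊆ Icc (-2) b := closure_minimal hsub isClosed_Icc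
  refine ⟨fun t => χ t * P t, hχc.mul hPc, ?_, fun t ht => (hts ht).2.trans_lt hbT, fun t ht => ?_⟩
  · exact isCompact_Icc.of_isClosed_subset (isClosed_tsupport _) hts
  · refine (hPd t).congr_of_eventuallyEq ?_
    filter_upwards [lt_mem_nhds (show (-1 : ℝ) < t by linarith)] with s hs
    simp [hχ, Real.smoothTransition.one_of_one_le (show 1 ≤ s + 2 by linarith)]

/-- A continuous solution of `m' = a` in the sense of distributions on `[0,T)` with initial value
`m₀` is given by integration of `a`. -/
lemma eq_add_integral_of_weak {T m₀ : ℝ} (hT : 0 < T) {m a : ℝ → ℝ} (hm : ContinuousOn m (Icc 0 T))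
    (ha : IntegrableOn a (Ioo 0 T))
    (h : ∀ θ : ℝ → ℝ, ContDiff ℝ ∞ θ → HasCompactSupport θ → tsupport θ ⊆ Iio T →
      ∫ t in Ioo 0 T, (deriv θ t * m t + θ t * a t) = -(θ 0 * m₀)) :
    ∀ t ∈ Icc 0 T, m t = m₀ + ∫ s in (0 : ℝ)..t, a s := by
  have hai : IntervalIntegrable a volume 0 T := by
    rw [intervalIntegrable_iff_integrableOn_Ioo_of_le hT.le]; exact ha
  set A : ℝ → ℝ := fun t => ∫ s in (0 : ℝ)..t, a s with hA
  have hAac : AbsolutelyContinuousOnInterval A 0 T :=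
    hai.absolutelyContinuousOnInterval_intervalIntegral (by simp)
  have hAc : ContinuousOn A (Icc 0 T) := by
    have := hAac.continuousOn; rwa [uIcc_of_le hT.le] at this
  have hAd : ∀ᵐ t, t ∈ Ioc 0 T → deriv A t = a t := by
    filter_upwards [hai.ae_hasDerivAt_integral] with t ht hmem
    have hmem' : t ∈ uIcc 0 T := by rw [uIcc_of_le hT.le]; exact Ioc_subset_Icc_self hmem
    exact (ht hmem' 0 (by simp)).deriv
  set k : ℝ → ℝ := fun t => m t - A t - m₀ with hk
  have hkc : ContinuousOn k (Icc 0 T) := (hm.sub hAc).sub continuousOn_const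
  -- The fundamental lemma of the calculus of variations. For a test function `ζ = θ'`, integration
  -- by parts against `A` has no boundary term because `θ T = 0` and `A 0 = 0`, and the constant
  -- `m₀` is matched by `∫ ζ = -θ 0`.
  have hzero : ∀ᵐ t, t ∈ Ioo 0 T → k t = 0 := by
    refine isOpen_Ioo.ae_eq_zero_of_integral_contDiff_smul_eq_zero
      ((hkc.mono Ioo_subset_Icc_self).locallyIntegrableOn measurableSet_Ioo) ?_
    intro ζ hζ _ hsupp
    obtain ⟨θ, hθ, hθc, hθT, hθd⟩ := exists_time_primitive hT hζ hsupp
    have hθT0 : θ T = 0 := image_eq_zero_of_notMem_tsupport fun h => lt_irrefl T (hθT h)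
    have h1 := h θ hθ hθc hθT
    rw [← integral_Ioc_eq_integral_Ioo, ← intervalIntegral.integral_of_le hT.le] at h1
    have hθac : AbsolutelyContinuousOnInterval θ 0 T :=
      ContDiffOn.absolutelyContinuousOnInterval (hθ.of_le (by simp)).contDiffOn
    have h2 := hθac.integral_mul_deriv_eq_deriv_mul hAac
    have e1 : ∫ t in (0 : ℝ)..T, θ t * deriv A t = ∫ t in (0 : ℝ)..T, θ t * a t := by
      refine intervalIntegral.integral_congr_ae ?_
      filter_upwards [hAd] with t ht hmem
      rw [uIoc_of_le hT.le] at hmem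
      rw [ht hmem]
    have hdζ : ∀ t ∈ uIcc 0 T, deriv θ t = ζ t := fun t ht => by
      rw [uIcc_of_le hT.le] at ht; exact (hθd t ht.1).deriv
    have e2 : ∫ t in (0 : ℝ)..T, deriv θ t * A t = ∫ t in (0 : ℝ)..T, ζ t * A t :=
      intervalIntegral.integral_congr fun t ht => by simp only [hdζ t ht]
    have e3 : ∫ t in (0 : ℝ)..T, (deriv θ t * m t + θ t * a t)
        = ∫ t in (0 : ℝ)..T, (ζ t * m t + θ t * a t) :=
      intervalIntegral.integral_congr fun t ht => by simp only [hdζ t ht]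
    have e4 : ∫ t in (0 : ℝ)..T, ζ t = θ T - θ 0 :=
      intervalIntegral.integral_eq_sub_of_hasDerivAt
        (fun t ht => by rw [uIcc_of_le hT.le] at ht; exact hθd t ht.1)
        (hζ.continuous.intervalIntegrable _ _)
    have hic : ∀ f : ℝ → ℝ, ContinuousOn f (Icc 0 T) →
        IntervalIntegrable (fun t => ζ t * f t) volume 0 T := fun f hf => by
      refine ContinuousOn.intervalIntegrable ?_
      rw [uIcc_of_le hT.le]
      exact hζ.continuous.continuousOn.mul hf
    have i2 : IntervalIntegrable (fun t => θ t * a t) volume 0 T :=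
      hai.continuousOn_mul hθ.continuous.continuousOn
    rw [e3, intervalIntegral.integral_add (hic m hm) i2] at h1
    rw [e1, e2, hθT0] at h2
    rw [hθT0] at e4
    have hA0 : A 0 = 0 := by simp [hA]
    have hsuppk : ∀ t, t ∉ Ioc 0 T → ζ t • k t = 0 := fun t ht => by
      rw [image_eq_zero_of_notMem_tsupport fun h => ht (Ioo_subset_Ioc_self (hsupp h)), zero_smul]
    rw [← setIntegral_eq_integral_of_forall_compl_eq_zero hsuppk,
      ← intervalIntegral.integral_of_le hT.le]
    have e5 : ∫ t in (0 : ℝ)..T, ζ t • k t = (∫ t in (0 : ℝ)..T, ζ t * m t)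
        - (∫ t in (0 : ℝ)..T, ζ t * A t) - (∫ t in (0 : ℝ)..T, ζ t) * m₀ := by
      rw [← intervalIntegral.integral_sub (hic m hm) (hic A hAc),
        ← intervalIntegral.integral_mul_const, ← intervalIntegral.integral_sub
          ((hic m hm).sub (hic A hAc)) ((hζ.continuous.intervalIntegrable _ _).mul_const _)]
      refine intervalIntegral.integral_congr fun t _ => ?_
      simp only [hk, smul_eq_mul]
      ring
    rw [e5, e4]
    rw [hA0] at h2
    linarith
  -- Continuity upgrades the almost-everywhere identity to every time, endpoints included.
  have hall : EqOn k 0 (Icc 0 T) := by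
    have h1 : k =ᵐ[volume.restrict (Icc 0 T)] 0 := by
      rw [← restrict_Ioo_eq_restrict_Icc]
      exact (ae_restrict_iff' measurableSet_Ioo).2 hzero
    exact Measure.eqOn_Icc_of_ae_eq volume hT.ne h1 hkc continuousOn_const
  intro t ht
  have := hall ht
  simp only [hk, Pi.zero_apply] at this
  linarith

/-! ### Leray–Hopf solutions: integrability and the weak form at every time -/

section

lemma ae_memLp_slice {T : ℝ} {f : ℝ × E3 → ℝ} (hf : MemLp f 2 (slab T)) :
    ∀ᵐ t ∂(volume.restrict (Ioo 0 T)), MemLp (fun x => f (t, x)) 2 volume := by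
  have h1 : Integrable (fun z => f z ^ 2) (slab T) := hf.integrable_sq
  filter_upwards [hf.1.prodMk_left, h1.prod_right_ae] with t ht1 ht2
  exact (memLp_two_iff_integrable_sq ht1).2 ht2

lemma memLp_two_slab {T E : ℝ} {f : ℝ → E3 → ℝ}
    (hf : AEStronglyMeasurable (fun z : ℝ × E3 => f z.1 z.2) (slab T))
    (hm : ∀ t ∈ Icc 0 T, MemLp (f t) 2 volume) (hE : ∀ t ∈ Icc 0 T, ∫ x, f t x ^ 2 ≤ E) :
    MemLp (fun z : ℝ × E3 => f z.1 z.2) 2 (slab T) := by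
  rw [memLp_two_iff_integrable_sq hf]
  have hm2 : AEStronglyMeasurable (fun z : ℝ × E3 => f z.1 z.2 ^ 2)
      ((volume.restrict (Ioo 0 T)).prod volume) := hf.pow 2
  refine (integrable_prod_iff hm2).2 ⟨?_, ?_⟩
  · filter_upwards [ae_restrict_mem measurableSet_Ioo] with t ht
    exact (hm t (Ioo_subset_Icc_self ht)).integrable_sq
  · refine Integrable.of_bound hm2.norm.integral_prod_right' E ?_
    filter_upwards [ae_restrict_mem measurableSet_Ioo] with t ht
    rw [Real.norm_of_nonneg (integral_nonneg fun x => norm_nonneg _)]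
    simpa using hE t (Ioo_subset_Icc_self ht)

lemma memLp_two_slab_const {T : ℝ} {f : E3 → ℝ} (hf : MemLp f 2 volume) :
    MemLp (fun z : ℝ × E3 => f z.2) 2 (slab T) :=
  memLp_two_slab (f := fun _ => f) hf.1.comp_snd (fun _ _ => hf) (fun _ _ => le_rfl)

lemma norm_sq_eq_sum (v : E3) : ‖v‖ ^ 2 = ∑ i, v i ^ 2 := by
  rw [EuclideanSpace.norm_sq_eq]
  simp

lemma dissipation_nonneg (G : ℝ → E3 → Fin 3 → Fin 3 → ℝ) (t : ℝ) : 0 ≤ dissipation G t :=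
  integral_nonneg fun _ => integral_nonneg fun _ =>
    Finset.sum_nonneg fun _ _ => Finset.sum_nonneg fun _ _ => sq_nonneg _

variable {T : ℝ} {u₀ : E3 → E3} {u : ℝ → E3 → E3} {G : ℝ → E3 → Fin 3 → Fin 3 → ℝ}

lemma IsLerayHopf.integral_norm_sq_le (hu : IsLerayHopf T u₀ u G) {t : ℝ} (ht : t ∈ Icc 0 T) :
    ∫ x, ‖u t x‖ ^ 2 ≤ ∫ x, ‖u₀ x‖ ^ 2 := by
  have h1 := hu.energy_inequality t ht
  have h2 := dissipation_nonneg G t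
  simp only [energy] at h1
  linarith

/-- The energy inequality with the dissipation discarded. It bounds the norm at every time, whereas
the `L^∞` condition does so only almost everywhere. -/
lemma IsLerayHopf.eLpNorm_le (hu : IsLerayHopf T u₀ u G) {t : ℝ} (ht : t ∈ Icc 0 T) :
    eLpNorm (u t) 2 volume ≤ eLpNorm u₀ 2 volume := by
  rw [(hu.memLp t ht).eLpNorm_eq_integral_rpow_norm (by norm_num) (by norm_num),
    hu.initial_memLp.eLpNorm_eq_integral_rpow_norm (by norm_num) (by norm_num)]
  simp only [ENNReal.toReal_ofNat, Real.rpow_ofNat]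
  exact ENNReal.ofReal_le_ofReal (Real.rpow_le_rpow (integral_nonneg fun x => by positivity)
    (hu.integral_norm_sq_le ht) (by norm_num))

lemma eLpNorm_component_le (v : E3 → E3) (p : ℝ≥0∞) (i : Fin 3) :
    eLpNorm (fun x => v x i) p volume ≤ eLpNorm v p volume :=
  eLpNorm_mono fun x => PiLp.norm_apply_le (v x) i

lemma IsLerayHopf.memLp_component (hu : IsLerayHopf T u₀ u G) {t : ℝ} (ht : t ∈ Icc 0 T)
    (i : Fin 3) : MemLp (fun x => u t x i) 2 volume :=
  NavierStokes.memLp_component (hu.memLp t ht) i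

lemma IsLerayHopf.aestronglyMeasurable (hu : IsLerayHopf T u₀ u G) (i : Fin 3) :
    AEStronglyMeasurable (fun z : ℝ × E3 => u z.1 z.2 i) (slab T) :=
  (EuclideanSpace.proj (𝕜 := ℝ) i).continuous.comp_aestronglyMeasurable hu.bounded.1

lemma IsLerayHopf.memLp_slab (hu : IsLerayHopf T u₀ u G) (i : Fin 3) :
    MemLp (fun z : ℝ × E3 => u z.1 z.2 i) 2 (slab T) := by
  refine memLp_two_slab (f := fun t x => u t x i) (E := ∫ x, ‖u₀ x‖ ^ 2)
    (hu.aestronglyMeasurable i) (fun t ht => hu.memLp_component ht i) fun t ht => ?_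
  refine le_trans ?_ (hu.integral_norm_sq_le ht)
  refine integral_mono (hu.memLp_component ht i).integrable_sq
    ((memLp_two_iff_integrable_sq_norm (hu.memLp t ht).1).1 (hu.memLp t ht)) fun x => ?_
  simp only [norm_sq_eq_sum]
  exact Finset.single_le_sum (f := fun i => u t x i ^ 2) (fun i _ => sq_nonneg _)
    (Finset.mem_univ i)

lemma IsLerayHopf.ae_memLp_grad (hu : IsLerayHopf T u₀ u G) :
    ∀ᵐ t ∂(volume.restrict (Ioo 0 T)), ∀ i j, MemLp (fun x => G t x i j) 2 volume := by
  rw [ae_all_iff]; intro i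
  rw [ae_all_iff]; intro j
  exact ae_memLp_slice (hu.grad_memLp i j)

/-- Separated variables give admissible space-time test fields. -/
lemma IsSolenoidal.smul_time {φ : E3 → E3} (hφ : IsSolenoidal φ) {θ : ℝ → ℝ} (hθ : ContDiff ℝ ∞ θ)
    (hθc : HasCompactSupport θ) (hθT : tsupport θ ⊆ Iio T) :
    IsSolenoidalTest T (fun t x => θ t • φ x) := by
  have hsub : tsupport (fun z : ℝ × E3 => θ z.1 • φ z.2) ⊆ tsupport θ ×ˢ tsupport φ := by
    refine closure_minimal (fun z hz => ⟨subset_tsupport _ ?_, subset_tsupport _ ?_⟩)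
      ((isClosed_tsupport _).prod (isClosed_tsupport _))
    · exact fun h => hz (by simp [h])
    · exact fun h => hz (by simp [h])
  refine ⟨(hθ.comp contDiff_fst).smul (hφ.contDiff.comp contDiff_snd), ?_, ?_, fun t x => ?_⟩
  · exact (hθc.isCompact.prod hφ.hasCompactSupport.isCompact).of_isClosed_subset
      (isClosed_tsupport _) hsub
  · exact fun z hz => ⟨hθT (hsub hz).1, mem_univ _⟩
  · have h : ∀ i, pderiv i (fun y => (θ t • φ y) i) x = θ t * pderiv i (fun y => φ y i) x :=
      fun i => congrFun (pderiv_const_mul (hφ.test i).1 (θ t) i) x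
    simp_rw [h, ← Finset.mul_sum, hφ.div_free, mul_zero]

/-- The right-hand side of the weak formulation tested with `φ`. -/
noncomputable def weakRhs (v : E3 → E3) (g : E3 → Fin 3 → Fin 3 → ℝ) (φ : E3 → E3) (x : E3) : ℝ :=
  -(∑ i, ∑ j, g x i j * pderiv i (fun y => φ y j) x)
    + ∑ i, ∑ j, v x i * v x j * pderiv i (fun y => φ y j) x

lemma integrable_weakRhs {v : E3 → E3} {g : E3 → Fin 3 → Fin 3 → ℝ} (hv : MemLp v 2 volume)
    (hg : ∀ i j, MemLp (fun x => g x i j) 2 volume) {φ : E3 → E3} (hφ : IsSolenoidal φ) :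
    Integrable (weakRhs v g φ) volume := by
  refine Integrable.add (Integrable.neg ?_) ?_ <;>
    refine integrable_finsetSum _ fun i _ => integrable_finsetSum _ fun j _ => ?_
  · exact integrable_mul_of_memLp_two (hg i j) (((hφ.test j).pderiv i).memLp 2)
  · exact integrable_mul_top (memLp_one_mul (memLp_component hv i) (memLp_component hv j))
      (((hφ.test j).pderiv i).memLp ⊤)

lemma IsLerayHopf.integrableOn_weakRhs (hu : IsLerayHopf T u₀ u G) {φ : E3 → E3}
    (hφ : IsSolenoidal φ) :
    IntegrableOn (fun t => ∫ x, weakRhs (u t) (G t) φ x) (Ioo 0 T) volume := by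
  have h : Integrable (fun z : ℝ × E3 => weakRhs (u z.1) (G z.1) φ z.2) (slab T) := by
    refine Integrable.add (Integrable.neg ?_) ?_ <;>
      refine integrable_finsetSum _ fun i _ => integrable_finsetSum _ fun j _ => ?_
    · exact (hu.grad_memLp i j).integrable_mul
        (memLp_two_slab_const (((hφ.test j).pderiv i).memLp 2))
    · have h1 := (hu.memLp_slab i).integrable_mul (hu.memLp_slab j)
      obtain ⟨C, hC⟩ := ((hφ.test j).pderiv i).continuous.bounded_above_of_compact_support
        ((hφ.test j).pderiv i).2
      exact h1.mul_bdd (c := C)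
        ((hφ.test j).pderiv i).continuous.aestronglyMeasurable.comp_snd
        (Eventually.of_forall fun z => hC z.2)
  exact Integrable.integral_prod_left h

/-- The integrated weak formulation at every time. -/
lemma IsLerayHopf.integral_inner_eq (hT : 0 < T) (hu : IsLerayHopf T u₀ u G) {φ : E3 → E3}
    (hφ : IsSolenoidal φ) : ∀ t ∈ Icc 0 T, ∫ x, inner ℝ (u t x) (φ x)
      = (∫ x, inner ℝ (u₀ x) (φ x)) + ∫ s in (0 : ℝ)..t, ∫ x, weakRhs (u s) (G s) φ x := by
  -- Separated test fields `θ(t) φ(x)` reduce the momentum equation to a scalar weak equation for `t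
  -- ↦ ∫ u(t)·φ`, which is continuous by weak continuity of `u`.
  refine eq_add_integral_of_weak hT (hu.weak_continuous φ (hφ.memLp 2))
    (hu.integrableOn_weakRhs hφ) fun θ hθ hθc hθT => ?_
  have h := hu.momentum _ (hφ.smul_time hθ hθc hθT)
  have e0 : ∫ x, inner ℝ (u₀ x) (θ 0 • φ x) = θ 0 * ∫ x, inner ℝ (u₀ x) (φ x) := by
    simp_rw [inner_smul_right, integral_const_mul]
  rw [e0] at h
  rw [← h]
  refine setIntegral_congr_ae measurableSet_Ioo ?_
  filter_upwards [(ae_restrict_iff' measurableSet_Ioo).1 hu.ae_memLp_grad] with t hgt ht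
  have hut := hu.memLp t (Ioo_subset_Icc_self ht)
  have i1 : Integrable (fun x => inner ℝ (u t x) (φ x)) volume := by
    simp_rw [inner_eq_sum]
    exact integrable_finsetSum _ fun i _ =>
      integrable_mul_of_memLp_two (NavierStokes.memLp_component hut i) ((hφ.test i).memLp 2)
  have i2 := integrable_weakRhs hut (hgt ht) hφ
  rw [← integral_const_mul, ← integral_const_mul,
    ← integral_add (i1.const_mul _) (i2.const_mul _)]
  refine integral_congr_ae (Eventually.of_forall fun x => ?_)
  have hd : deriv (fun s => θ s • φ x) t = deriv θ t • φ x :=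
    ((hθ.differentiable (by simp) t).hasDerivAt.smul_const (φ x)).deriv
  have hp : ∀ i j, pderiv i (fun y => (θ t • φ y) j) x = θ t * pderiv i (fun y => φ y j) x :=
    fun i j => congrFun (pderiv_const_mul (hφ.test j).1 (θ t) i) x
  simp only [hd, hp, inner_smul_right, weakRhs]
  have s1 : ∑ i, ∑ j, G t x i j * (θ t * pderiv i (fun y => φ y j) x)
      = θ t * ∑ i, ∑ j, G t x i j * pderiv i (fun y => φ y j) x := by
    simp_rw [Finset.mul_sum]
    exact Finset.sum_congr rfl fun i _ => Finset.sum_congr rfl fun j _ => by ring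
  have s2 : ∑ i, ∑ j, u t x i * u t x j * (θ t * pderiv i (fun y => φ y j) x)
      = θ t * ∑ i, ∑ j, u t x i * u t x j * pderiv i (fun y => φ y j) x := by
    simp_rw [Finset.mul_sum]
    exact Finset.sum_congr rfl fun i _ => Finset.sum_congr rfl fun j _ => by ring
  rw [s1, s2]
  ring

end

/-! ### The mollified momentum equation -/

/-- Convolution in space preserves joint measurability on the slab. -/
lemma aestronglyMeasurable_conv_slab {T : ℝ} {k : E3 → ℝ} (hk : Continuous k) {f : ℝ → E3 → ℝ}
    (hf : AEStronglyMeasurable (fun z : ℝ × E3 => f z.1 z.2) (slab T)) :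
    AEStronglyMeasurable (fun z : ℝ × E3 => conv k (f z.1) z.2) (slab T) := by
  -- A strongly measurable representative changes `f t` only on null sets for almost every `t`, so
  -- the convolution is unchanged at every `x` for those times.
  set f' := hf.mk _ with hf'
  have hsm : StronglyMeasurable f' := hf.stronglyMeasurable_mk
  refine ⟨fun z => ∫ y, f' (z.1, y) * k (z.2 - y), ?_, ?_⟩
  · have h : StronglyMeasurable (fun w : (ℝ × E3) × E3 => f' (w.1.1, w.2) * k (w.1.2 - w.2)) :=
      (hsm.comp_measurable (by fun_prop)).mul
        (hk.comp (by fun_prop : Continuous fun w : (ℝ × E3) × E3 => w.1.2 - w.2)).stronglyMeasurable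
    exact h.integral_prod_right'
  · have h1 : ∀ᵐ t ∂(volume.restrict (Ioo 0 T)), ∀ᵐ x ∂(volume : Measure E3), f t x = f' (t, x) :=
      Measure.ae_ae_of_ae_prod hf.ae_eq_mk
    have h2 : ∀ᵐ z : ℝ × E3 ∂(slab T), ∀ᵐ x ∂(volume : Measure E3), f z.1 x = f' (z.1, x) :=
      Measure.quasiMeasurePreserving_fst.ae h1
    filter_upwards [h2] with z hz
    exact integral_congr_ae (hz.mono fun y hy => by simp [hy])

lemma eLpNorm_field_le {a : Fin 3 → E3 → ℝ} (ha : ∀ i, AEStronglyMeasurable (a i) volume)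
    {p : ℝ≥0∞} (hp : 1 ≤ p) : eLpNorm (field a) p volume ≤ ∑ i, eLpNorm (a i) p volume := by
  have e : field a = ∑ i, fun x => a i x • EuclideanSpace.single i (1 : ℝ) := by
    rw [field_eq_sum]; ext; simp
  rw [e]
  refine (eLpNorm_sum_le (fun i _ => (ha i).smul_const _) hp).trans
    (Finset.sum_le_sum fun i _ => ?_)
  refine eLpNorm_mono fun x => ?_
  simp [norm_smul]

/-- The right-hand side `Δ(k * v) - div (k * (v ⊗ v))` of the mollified momentum equation. -/
noncomputable def forcing (k : E3 → ℝ) (v : E3 → E3) (j : Fin 3) (x : E3) : ℝ :=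
  ∑ i, (conv (pderiv i (pderiv i k)) (fun y => v y j) x
    - conv (pderiv i k) (fun y => v y i * v y j) x)

/-- The componentwise convolution of a vector field. -/
noncomputable def vconv (k : E3 → ℝ) (v : E3 → E3) : E3 → E3 :=
  field fun i => conv k fun y => v y i

section Slice

variable {k : E3 → ℝ} {v : E3 → E3}

/-- For `v ∈ L²` the products are only in `L¹`. Young's inequality is therefore used with exchanged
roles, the kernel carrying the exponent `p`. -/
lemma memLp_conv_mul (hk : IsTest k) (hv : MemLp v 2 volume) (i j : Fin 3) (p : ℝ≥0∞)
    (hp : 1 ≤ p) (hp' : p ≠ ⊤) : MemLp (conv k fun y => v y i * v y j) p volume := by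
  rw [conv_swap]
  exact memLp_conv (memLp_one_mul (memLp_component hv i) (memLp_component hv j)) (hk.memLp p) hp hp'

lemma memLp_conv_component (hk : IsTest k) (hv : MemLp v 2 volume) (j : Fin 3) :
    MemLp (conv k fun y => v y j) 2 volume :=
  memLp_conv (hk.memLp 1) (memLp_component hv j) (by norm_num) (by norm_num)

lemma memLp_forcing (hk : IsTest k) (hv : MemLp v 2 volume) (j : Fin 3) :
    MemLp (forcing k v j) 2 volume :=
  memLp_finsetSum _ fun i _ => (memLp_conv_component ((hk.pderiv i).pderiv i) hv j).sub
    (memLp_conv_mul (hk.pderiv i) hv i j 2 (by norm_num) (by norm_num))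

lemma memLp_vconv (hk : IsTest k) (hv : MemLp v 2 volume) : MemLp (vconv k v) 2 volume :=
  memLp_field fun i => memLp_conv_component hk hv i

/-- A bound for the forcing in terms of the energy only. -/
lemma exists_bound_forcing (hk : IsTest k) {B : ℝ≥0∞} (hB : B ≠ ⊤) :
    ∃ C : ℝ≥0∞, C ≠ ⊤ ∧ ∀ v : E3 → E3, MemLp v 2 volume → eLpNorm v 2 volume ≤ B →
      eLpNorm (field (forcing k v)) 2 volume ≤ C := by
  have h12 : (1 : ℝ≥0∞) ≤ 2 := by norm_num
  have h2t : (2 : ℝ≥0∞) ≠ ⊤ := by norm_num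
  -- The linear term uses Young with the kernel in `L¹`; the quadratic term uses `vᵢvⱼ` in `L¹`, of
  -- norm at most `B * B`, and the kernel in `L²`.
  refine ⟨∑ _j : Fin 3, ∑ i, (eLpNorm (pderiv i (pderiv i k)) 1 volume * B
    + (B * B) * eLpNorm (pderiv i k) 2 volume), ?_, fun v hv hvB => ?_⟩
  · refine ENNReal.sum_ne_top.2 fun j _ => ENNReal.sum_ne_top.2 fun i _ => ?_
    exact ENNReal.add_ne_top.2
      ⟨ENNReal.mul_ne_top (((hk.pderiv i).pderiv i).memLp 1).2.ne hB,
        ENNReal.mul_ne_top (ENNReal.mul_ne_top hB hB) ((hk.pderiv i).memLp 2).2.ne⟩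
  have hc : ∀ i, eLpNorm (fun x => v x i) 2 volume ≤ B := fun i =>
    (eLpNorm_component_le v 2 i).trans hvB
  refine (eLpNorm_field_le (fun j => (memLp_forcing hk hv j).1) h12).trans
    (Finset.sum_le_sum fun j _ => ?_)
  have hm1 := fun i => memLp_conv_component ((hk.pderiv i).pderiv i) hv j
  have hm2 := fun i => memLp_conv_mul (hk.pderiv i) hv i j 2 h12 h2t
  have e : forcing k v j = ∑ i, (conv (pderiv i (pderiv i k)) (fun y => v y j)
      - conv (pderiv i k) fun y => v y i * v y j) := by
    ext x; simp [forcing]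
  rw [e]
  refine (eLpNorm_sum_le (fun i _ => ((hm1 i).sub (hm2 i)).1) h12).trans
    (Finset.sum_le_sum fun i _ => ?_)
  refine (eLpNorm_sub_le (hm1 i).1 (hm2 i).1 h12).trans (add_le_add ?_ ?_)
  · refine (eLpNorm_conv_le ((hk.pderiv i).pderiv i).continuous.aestronglyMeasurable
      (memLp_component hv j).1 h12 h2t).trans ?_
    gcongr
    exact hc j
  · rw [conv_swap]
    refine (eLpNorm_conv_le (memLp_one_mul (memLp_component hv i) (memLp_component hv j)).1
      (hk.pderiv i).continuous.aestronglyMeasurable h12 h2t).trans ?_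
    gcongr
    refine (eLpNorm_mul_le (memLp_component hv i).1 (memLp_component hv j).1 2 2 1).trans ?_
    gcongr
    · exact hc i
    · exact hc j

/-- Testing the forcing with the mollified field itself. -/
lemma sum_integral_forcing_mul_conv {g : E3 → Fin 3 → Fin 3 → ℝ} (hk : IsTest k)
    (hv : MemLp v 2 volume) (hg : ∀ i j, MemLp (fun x => g x i j) 2 volume)
    (hvg : IsWeakGradient v g) :
    ∑ j, ∫ x, forcing k v j x * conv k (fun y => v y j) x
      = -(∑ i, ∑ j, ∫ x, conv k (fun y => g y i j) x ^ 2) + convective k v g := by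
  have h12 : (1 : ℝ≥0∞) ≤ 2 := by norm_num
  have h2t : (2 : ℝ≥0∞) ≠ ⊤ := by norm_num
  have hvc := fun i => memLp_component hv i
  have hloc := fun i => locallyIntegrable_of_memLp_two (hvc i)
  have hJ := fun j => memLp_conv_component hk hv j
  have hJt : ∀ j, MemLp (conv k fun y => v y j) ⊤ volume := fun j =>
    memLp_top_conv (p := 2) (q := 2) hk (hvc j)
  have hJg : ∀ i j, MemLp (conv k fun y => g y i j) 2 volume := fun i j =>
    memLp_conv (hk.memLp 1) (hg i j) h12 h2t
  have hJgt : ∀ i j, MemLp (conv k fun y => g y i j) ⊤ volume := fun i j =>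
    memLp_top_conv (p := 2) (q := 2) hk (hg i j)
  have hvv := fun i j => memLp_one_mul (hvc i) (hvc j)
  have hm1 := fun i j => memLp_conv_component ((hk.pderiv i).pderiv i) hv j
  have hm2 := fun i j => memLp_conv_mul (hk.pderiv i) hv i j 2 h12 h2t
  -- One of the two derivatives on the kernel is passed to `v` as its weak gradient; the other is
  -- integrated by parts onto the second factor.
  have t1 : ∀ i j, ∫ x, conv (pderiv i (pderiv i k)) (fun y => v y j) x * conv k (fun y => v y j) x
      = -∫ x, conv k (fun y => g y i j) x ^ 2 := by
    intro i j
    have hw := hvg.isWeakDeriv i j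
    have e1 : conv (pderiv i (pderiv i k)) (fun y => v y j)
        = pderiv i (conv k fun y => g y i j) := by
      rw [hw.conv_pderiv (hk.pderiv i)]
      exact funext fun x => (pderiv_conv hk (locallyIntegrable_of_memLp_two (hg i j)) i x).symm
    have h := integral_mul_pderiv (contDiff_conv hk (hloc j))
      (contDiff_conv hk (locallyIntegrable_of_memLp_two (hg i j))) i
      (by rw [hw.pderiv_conv hk (hloc j)]; exact integrable_mul_of_memLp_two (hJg i j) (hJg i j))
      (by rw [← e1]; exact integrable_mul_of_memLp_two (hJ j) (hm1 i j))
      (integrable_mul_of_memLp_two (hJ j) (hJg i j))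
    rw [hw.pderiv_conv hk (hloc j)] at h
    rw [e1]
    simp_rw [mul_comm (pderiv i _ _), sq]
    exact h
  have t2 : ∀ i j, ∫ x, conv (pderiv i k) (fun y => v y i * v y j) x * conv k (fun y => v y j) x
      = -∫ x, conv k (fun y => v y i * v y j) x * conv k (fun y => g y i j) x := by
    intro i j
    have hw := hvg.isWeakDeriv i j
    have hl := (hvv i j).locallyIntegrable le_rfl
    have e1 : conv (pderiv i k) (fun y => v y i * v y j)
        = pderiv i (conv k fun y => v y i * v y j) :=
      funext fun x => (pderiv_conv hk hl i x).symm
    have hJvv := memLp_conv_mul hk hv i j 1 le_rfl (by norm_num)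
    have h := integral_mul_pderiv (contDiff_conv hk hl) (contDiff_conv hk (hloc j)) i
      (by rw [← e1]; exact integrable_mul_top
            (memLp_conv_mul (hk.pderiv i) hv i j 1 le_rfl (by norm_num)) (hJt j))
      (by rw [hw.pderiv_conv hk (hloc j)]; exact integrable_mul_top hJvv (hJgt i j))
      (integrable_mul_top hJvv (hJt j))
    rw [hw.pderiv_conv hk (hloc j)] at h
    rw [e1]
    linarith
  have t3 : ∀ j, ∫ x, forcing k v j x * conv k (fun y => v y j) x
      = ∑ i, (-(∫ x, conv k (fun y => g y i j) x ^ 2)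
        + ∫ x, conv k (fun y => v y i * v y j) x * conv k (fun y => g y i j) x) := by
    intro j
    simp only [forcing, Finset.sum_mul]
    rw [integral_finsetSum]
    · refine Finset.sum_congr rfl fun i _ => ?_
      simp_rw [sub_mul]
      rw [integral_sub (integrable_mul_of_memLp_two (hm1 i j) (hJ j))
        (integrable_mul_of_memLp_two (hm2 i j) (hJ j)), t1, t2]
      ring
    · exact fun i _ => integrable_mul_of_memLp_two ((hm1 i j).sub (hm2 i j)) (hJ j)
  simp_rw [t3]
  rw [Finset.sum_comm, convective]
  simp_rw [Finset.sum_add_distrib, Finset.sum_neg_distrib]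

/-- Testing the forcing with `ψ` amounts to testing the momentum equation with `k * ψ`. -/
lemma sum_integral_forcing_mul {g : E3 → Fin 3 → Fin 3 → ℝ} (hk : IsTest k)
    (heven : ∀ x, k (-x) = k x) (hv : MemLp v 2 volume)
    (hg : ∀ i j, MemLp (fun x => g x i j) 2 volume) (hvg : IsWeakGradient v g)
    {ψ : E3 → E3} (hψ : IsSolenoidal ψ) :
    ∑ j, ∫ x, forcing k v j x * ψ x j = ∫ x, weakRhs v g (vconv k ψ) x := by
  have h12 : (1 : ℝ≥0∞) ≤ 2 := by norm_num
  have h2t : (2 : ℝ≥0∞) ≠ ⊤ := by norm_num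
  have hvc := fun i => memLp_component hv i
  have hvv := fun i j => memLp_one_mul (hvc i) (hvc j)
  have hm1 := fun i j => memLp_conv_component ((hk.pderiv i).pderiv i) hv j
  have hm2 := fun i j => memLp_conv_mul (hk.pderiv i) hv i j 2 h12 h2t
  have hψl := fun j => (hψ.test j).continuous.locallyIntegrable (μ := volume)
  -- The adjoint of a convolution uses the reflected kernel. First derivatives of an even kernel are
  -- odd, second ones even, and these parities fix the signs in `t1` and `t2`.
  have hodd : ∀ i x, pderiv i k (-x) = -pderiv i k x := by
    intro i x
    have h := pderiv_sub_left hk 0 (-x) i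
    have e : (fun y => k (0 - y)) = k := funext fun y => by rw [zero_sub, heven]
    rw [e] at h
    simpa using h
  have hev2 : ∀ i x, pderiv i (pderiv i k) (-x) = pderiv i (pderiv i k) x := by
    intro i x
    have h := pderiv_sub_left (hk.pderiv i) 0 x i
    have e : (fun y => pderiv i k (0 - y)) = fun y => -1 * pderiv i k y :=
      funext fun y => by rw [zero_sub, hodd]; ring
    rw [e, pderiv_const_mul (hk.pderiv i).1] at h
    simp only [zero_sub] at h
    linarith
  have hpd : ∀ i j, pderiv i (fun y => vconv k ψ y j) = conv (pderiv i k) fun y => ψ y j :=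
    fun i j => funext fun x => pderiv_conv hk (hψl j) i x
  have hpd2 : ∀ i j, pderiv i (conv (pderiv i k) fun y => ψ y j)
      = conv (pderiv i (pderiv i k)) fun y => ψ y j :=
    fun i j => funext fun x => pderiv_conv (hk.pderiv i) (hψl j) i x
  have t1 : ∀ i j, ∫ x, conv (pderiv i (pderiv i k)) (fun y => v y j) x * ψ x j
      = -∫ x, g x i j * conv (pderiv i k) (fun y => ψ y j) x := by
    intro i j
    rw [integral_conv_mul ((hk.pderiv i).pderiv i) (p := 2) (q := 2) (hvc j) ((hψ.test j).memLp 2)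
      h12 h2t]
    simp_rw [hev2]
    have h := hvg _ ((hk.pderiv i).conv (hψ.test j)) i j
    rwa [hpd2] at h
  have t2 : ∀ i j, ∫ x, conv (pderiv i k) (fun y => v y i * v y j) x * ψ x j
      = -∫ x, v x i * v x j * conv (pderiv i k) (fun y => ψ y j) x := by
    intro i j
    rw [integral_conv_mul (hk.pderiv i) (p := 1) (q := ⊤) (hvv i j) ((hψ.test j).memLp ⊤)
      le_rfl (by norm_num)]
    simp_rw [hodd]
    rw [← integral_neg]
    refine integral_congr_ae (Eventually.of_forall fun x => ?_)
    simp only [conv, mul_neg, integral_neg]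
  have t3 : ∀ j, ∫ x, forcing k v j x * ψ x j
      = ∑ i, (-(∫ x, g x i j * conv (pderiv i k) (fun y => ψ y j) x)
        + ∫ x, v x i * v x j * conv (pderiv i k) (fun y => ψ y j) x) := by
    intro j
    have hψ2 := (hψ.test j).memLp 2
    simp only [forcing, Finset.sum_mul]
    rw [integral_finsetSum]
    · refine Finset.sum_congr rfl fun i _ => ?_
      simp_rw [sub_mul]
      rw [integral_sub (integrable_mul_of_memLp_two (hm1 i j) hψ2)
        (integrable_mul_of_memLp_two (hm2 i j) hψ2), t1, t2]
      ring
    · exact fun i _ => integrable_mul_of_memLp_two ((hm1 i j).sub (hm2 i j)) hψ2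
  have hc := fun i j => ((hk.pderiv i).conv (hψ.test j))
  have i1 : ∀ i j, Integrable (fun x => g x i j * conv (pderiv i k) (fun y => ψ y j) x) volume :=
    fun i j => integrable_mul_of_memLp_two (hg i j) ((hc i j).memLp 2)
  have i2 : ∀ i j, Integrable (fun x => v x i * v x j * conv (pderiv i k) (fun y => ψ y j) x)
      volume := fun i j => integrable_mul_top (hvv i j) ((hc i j).memLp ⊤)
  simp only [weakRhs, hpd]
  have i3 : Integrable (fun x => -∑ i, ∑ j, g x i j * conv (pderiv i k) (fun y => ψ y j) x)
      volume :=
    (integrable_finsetSum _ fun i _ => integrable_finsetSum _ fun j _ => i1 i j).neg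
  rw [integral_add i3
    (integrable_finsetSum _ fun i _ => integrable_finsetSum _ fun j _ => i2 i j), integral_neg,
    integral_finsetSum _ fun i _ => integrable_finsetSum _ fun j _ => i1 i j,
    integral_finsetSum _ fun i _ => integrable_finsetSum _ fun j _ => i2 i j]
  simp_rw [integral_finsetSum _ fun j _ => i1 _ j, integral_finsetSum _ fun j _ => i2 _ j, t3]
  rw [Finset.sum_comm]
  simp_rw [Finset.sum_add_distrib, Finset.sum_neg_distrib]

lemma IsSolenoidal.vconv (hk : IsTest k) {ψ : E3 → E3} (hψ : IsSolenoidal ψ) :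
    IsSolenoidal (NavierStokes.vconv k ψ) := by
  have hψl := fun j => (hψ.test j).continuous.locallyIntegrable (μ := volume)
  refine ⟨fun i => hk.conv (hψ.test i), fun x => ?_⟩
  have h : ∀ i, pderiv i (fun y => NavierStokes.vconv k ψ y i) x
      = conv k (pderiv i fun y => ψ y i) x := fun i =>
    congrFun ((isWeakDeriv_of_contDiff (hψ.test i).1 i).pderiv_conv hk (hψl i)) x
  simp_rw [h]
  simp only [conv]
  rw [← integral_finsetSum _ fun i _ => integrable_conv_integrand hk
    ((hψ.test i).pderiv i).continuous.locallyIntegrable x]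
  simp_rw [← Finset.sum_mul, hψ.div_free]
  simp

/-- Together with `mem_closure_solenoidal` this makes the mollified velocity an admissible test
vector for its own equation. -/
lemma WeakDivFree.vconv (hk : IsTest k) (hv : MemLp v 2 volume) (hdiv : WeakDivFree v) :
    WeakDivFree (NavierStokes.vconv k v) := by
  intro ψ hψ
  have hloc := fun i => locallyIntegrable_of_memLp_two (memLp_component hv i)
  have hJ : ∀ j, MemLp (fun x => NavierStokes.vconv k v x j) 2 volume :=
    fun j => memLp_conv_component hk hv j
  rw [integral_finsetSum _ fun i _ => integrable_mul_of_memLp_two (hJ i) ((hψ.pderiv i).memLp 2)]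
  have h : ∀ i, ∫ x, NavierStokes.vconv k v x i * pderiv i ψ x
      = -∫ x, conv (pderiv i k) (fun y => v y i) x * ψ x := by
    intro i
    have := isWeakDeriv_of_contDiff (contDiff_conv hk (hloc i)) i ψ hψ
    rwa [show pderiv i (conv k fun y => v y i) = conv (pderiv i k) fun y => v y i from
      funext fun x => pderiv_conv hk (hloc i) i x] at this
  simp_rw [h, Finset.sum_neg_distrib]
  rw [← integral_finsetSum _ fun i _ =>
    integrable_mul_of_memLp_two (memLp_conv_component (hk.pderiv i) hv i) (hψ.memLp 2)]
  simp_rw [← Finset.sum_mul, hdiv.sum_conv_pderiv hv hk]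
  simp

end Slice

/-! ### Energy balance of the mollified solution -/

section

open Classical in
/-- The class in `L²` of a square-integrable field, and `0` for other fields. -/
noncomputable def toL2 (f : E3 → E3) : L2 := if h : MemLp f 2 volume then h.toLp f else 0

lemma toL2_eq {f : E3 → E3} (h : MemLp f 2 volume) : toL2 f = h.toLp f := dif_pos h

lemma half_norm_sq_toL2 {f : E3 → E3} (h : MemLp f 2 volume) :
    1 / 2 * ‖toL2 f‖ ^ 2 = energy f := by
  rw [toL2_eq h, ← real_inner_self_eq_norm_sq, inner_toLp, energy]
  simp_rw [norm_sq_eq_sum, sq]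

variable {T : ℝ} {u₀ : E3 → E3} {u : ℝ → E3 → E3} {G : ℝ → E3 → Fin 3 → Fin 3 → ℝ}

lemma IsLerayHopf.aestronglyMeasurable_forcing (hu : IsLerayHopf T u₀ u G) {k : E3 → ℝ}
    (hk : IsTest k) (j : Fin 3) :
    AEStronglyMeasurable (fun z : ℝ × E3 => forcing k (u z.1) j z.2) (slab T) := by
  refine Finset.aestronglyMeasurable_fun_sum _ fun i _ => AEStronglyMeasurable.sub ?_ ?_
  · exact aestronglyMeasurable_conv_slab (f := fun t y => u t y j)
      ((hk.pderiv i).pderiv i).continuous (hu.aestronglyMeasurable j)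
  · exact aestronglyMeasurable_conv_slab (f := fun t y => u t y i * u t y j)
      (hk.pderiv i).continuous ((hu.aestronglyMeasurable i).mul (hu.aestronglyMeasurable j))

lemma IsLerayHopf.ae_energy_slice (hu : IsLerayHopf T u₀ u G) :
    ∀ᵐ t ∂(volume.restrict (Ioc 0 T)), t ∈ Icc 0 T ∧ IsWeakGradient (u t) (G t) ∧
      ∀ i j, MemLp (fun x => G t x i j) 2 volume := by
  rw [← restrict_Ioo_eq_restrict_Ioc]
  filter_upwards [hu.grad, hu.ae_memLp_grad, ae_restrict_mem measurableSet_Ioo] with t h1 h2 h3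
  exact ⟨Ioo_subset_Icc_self h3, h1, h2⟩

lemma aestronglyMeasurable_integral_slab {f : ℝ × E3 → ℝ} (hf : AEStronglyMeasurable f (slab T)) :
    AEStronglyMeasurable (fun t => ∫ x, f (t, x)) (volume.restrict (Ioc 0 T)) := by
  rw [← restrict_Ioo_eq_restrict_Ioc]
  exact AEStronglyMeasurable.integral_prod_right' hf

/-- The energy balance of the mollified solution. -/
lemma IsLerayHopf.mollified_energy (hT : 0 < T) (hu : IsLerayHopf T u₀ u G) {k : E3 → ℝ}
    (hk : IsTest k) (heven : ∀ x, k (-x) = k x) {t : ℝ} (ht : t ∈ Icc 0 T) :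
    energy (vconv k (u t)) - energy (vconv k (u 0))
      = ∫ s in Ioc 0 t, (-(∑ i, ∑ j, ∫ x, conv k (fun y => G s y i j) x ^ 2)
        + convective k (u s) (G s)) := by
  have h0T : (0 : ℝ) ∈ Icc 0 T := ⟨le_rfl, hT.le⟩
  have hvm : ∀ t ∈ Icc 0 T, MemLp (vconv k (u t)) 2 volume := fun t ht =>
    memLp_vconv hk (hu.memLp t ht)
  have hFm : ∀ t ∈ Icc 0 T, MemLp (field (forcing k (u t))) 2 volume := fun t ht =>
    memLp_field (memLp_forcing hk (hu.memLp t ht))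
  set v : ℝ → L2 := fun t => toL2 (vconv k (u t)) with hv
  set F : ℝ → L2 := fun t => toL2 (field (forcing k (u t))) with hF
  -- The bound depends only on the kernel and the norm of `u₀`, hence is uniform in time.
  obtain ⟨C, hC, hCb⟩ := exists_bound_forcing hk hu.initial_memLp.2.ne
  have hbound : ∀ τ ∈ Icc 0 T, ‖F τ‖ ≤ C.toReal := by
    intro τ hτ
    simp only [hF, toL2_eq (hFm τ hτ), Lp.norm_toLp]
    exact ENNReal.toReal_mono hC (hCb _ (hu.memLp τ hτ) (hu.eLpNorm_le hτ))
  have hclosure : ∀ t ∈ Icc 0 T, v t ∈ solenoidal.topologicalClosure := by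
    intro t ht
    simp only [hv, toL2_eq (hvm t ht)]
    exact mem_closure_solenoidal _ ((hu.div_free t ht).vconv hk (hu.memLp t ht))
  have hrep : ∀ w ∈ solenoidal, ∃ ψ, ∃ hψ : IsSolenoidal ψ, w = (hψ.memLp 2).toLp ψ := by
    rintro w ⟨ψ, hψ, hw⟩
    exact ⟨ψ, hψ, Lp.ext (hw.trans (hψ.memLp 2).coeFn_toLp.symm)⟩
  have hFin : ∀ {ψ : E3 → E3} (hψ : MemLp ψ 2 volume), ∀ τ ∈ Icc 0 T,
      inner ℝ (F τ) (hψ.toLp ψ) = ∑ j, ∫ x, forcing k (u τ) j x * ψ x j := by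
    intro ψ hψ τ hτ
    simp only [hF, toL2_eq (hFm τ hτ)]
    exact inner_toLp_eq_sum _ _
  have hIoc : ∀ᵐ τ ∂(volume.restrict (Ioc 0 T)), τ ∈ Icc 0 T :=
    (ae_restrict_mem measurableSet_Ioc).mono fun τ h => Ioc_subset_Icc_self h
  have hmeas : ∀ w ∈ solenoidal,
      AEStronglyMeasurable (fun τ => inner ℝ (F τ) w) (volume.restrict (Ioc 0 T)) := by
    intro w hw
    obtain ⟨ψ, hψ, rfl⟩ := hrep w hw
    refine (Finset.aestronglyMeasurable_fun_sum Finset.univ fun j _ =>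
      aestronglyMeasurable_integral_slab
        ((hu.aestronglyMeasurable_forcing hk j).mul
          (hψ.test j).continuous.aestronglyMeasurable.comp_snd)).congr ?_
    filter_upwards [hIoc] with τ hτ
    exact (hFin (hψ.memLp 2) τ hτ).symm
  have hFv : ∀ τ ∈ Icc 0 T, inner ℝ (F τ) (v τ)
      = ∑ j, ∫ x, forcing k (u τ) j x * conv k (fun y => u τ y j) x := by
    intro τ hτ
    simp only [hv, toL2_eq (hvm τ hτ)]
    exact hFin (hvm τ hτ) τ hτ
  have hm : AEStronglyMeasurable (fun τ => inner ℝ (F τ) (v τ)) (volume.restrict (Ioc 0 T)) := by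
    refine (Finset.aestronglyMeasurable_fun_sum Finset.univ fun j _ =>
      aestronglyMeasurable_integral_slab
        ((hu.aestronglyMeasurable_forcing hk j).mul (aestronglyMeasurable_conv_slab
          (f := fun t y => u t y j) hk.continuous (hu.aestronglyMeasurable j)))).congr ?_
    filter_upwards [hIoc] with τ hτ
    exact (hFv τ hτ).symm
  have hid : ∀ w ∈ solenoidal, ∀ t ∈ Icc 0 T,
      inner ℝ (v t - v 0) w = ∫ τ in (0 : ℝ)..t, inner ℝ (F τ) w := by
    intro w hw t ht
    obtain ⟨ψ, hψ, rfl⟩ := hrep w hw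
    -- The evenness of `k` makes the mollification self-adjoint and moves it onto the test field.
    have hv1 : ∀ t ∈ Icc 0 T, inner ℝ (v t) ((hψ.memLp 2).toLp ψ)
        = ∫ x, inner ℝ (u t x) (vconv k ψ x) := by
      intro t ht
      simp only [hv, toL2_eq (hvm t ht)]
      rw [inner_toLp_eq_sum]
      simp_rw [inner_eq_sum]
      rw [integral_finsetSum _ fun i _ => integrable_mul_of_memLp_two (hu.memLp_component ht i)
        (((hψ.vconv hk).test i).memLp 2)]
      refine Finset.sum_congr rfl fun i _ => ?_
      have h := integral_conv_mul hk (p := 2) (q := 2) (hu.memLp_component ht i)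
        ((hψ.test i).memLp 2) (by norm_num) (by norm_num)
      simp_rw [heven] at h
      exact h
    have h1 := hu.integral_inner_eq hT (hψ.vconv hk)
    rw [inner_sub_left, hv1 t ht, hv1 0 h0T, h1 t ht, h1 0 h0T, intervalIntegral.integral_same,
      add_zero, add_sub_cancel_left]
    -- The field `G` is known to be a square-integrable weak gradient only at almost every time, so
    -- the right-hand sides are compared almost everywhere.
    refine intervalIntegral.integral_congr_ae ?_
    have h2 := (ae_restrict_iff' measurableSet_Ioc).1 hu.ae_energy_slice
    filter_upwards [h2] with τ hτ hmem
    rw [uIoc_of_le ht.1] at hmem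
    obtain ⟨h3, h4, h5⟩ := hτ ⟨hmem.1, hmem.2.trans ht.2⟩
    rw [hFin (hψ.memLp 2) τ h3]
    exact (sum_integral_forcing_mul hk heven (hu.memLp τ h3) h5 h4 hψ).symm
  have key := energy_identity_of_weak hbound hclosure hmeas hid hm ht
  simp only [hv] at key
  rw [half_norm_sq_toL2 (hvm t ht), half_norm_sq_toL2 (hvm 0 h0T)] at key
  rw [key, intervalIntegral.integral_of_le ht.1]
  refine setIntegral_congr_ae measurableSet_Ioc ?_
  have h2 := (ae_restrict_iff' measurableSet_Ioc).1 hu.ae_energy_slice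
  filter_upwards [h2] with τ hτ hmem
  obtain ⟨h3, h4, h5⟩ := hτ ⟨hmem.1, hmem.2.trans ht.2⟩
  rw [hFv τ h3, sum_integral_forcing_mul_conv hk (hu.memLp τ h3) h5 h4]

end

/-! ### Removal of the mollification -/

section

lemma aemeasurable_eLpNorm_slice {T : ℝ} {f : ℝ × E3 → ℝ} (hf : AEStronglyMeasurable f (slab T))
    {q : ℝ≥0∞} (hq : q ≠ ⊤) :
    AEMeasurable (fun t => eLpNorm (fun x => f (t, x)) q volume) (volume.restrict (Ioo 0 T)) := by
  rcases eq_or_ne q 0 with rfl | hq0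
  · simp
  simp_rw [eLpNorm_eq_lintegral_rpow_enorm_toReal hq0 hq]
  exact AEMeasurable.pow_const (AEMeasurable.lintegral_prod_right' (hf.enorm.pow_const _)) _

lemma energy_eq_sum {v : E3 → E3} (hv : MemLp v 2 volume) :
    energy v = 1 / 2 * ∑ i, ∫ x, v x i * v x i := by
  rw [energy, ← integral_finsetSum _ fun i _ =>
    integrable_mul_of_memLp_two (memLp_component hv i) (memLp_component hv i)]
  simp_rw [norm_sq_eq_sum, sq]

lemma tendsto_energy_vconv {v : E3 → E3} (hv : MemLp v 2 volume) :
    Tendsto (fun n => energy (vconv (moll n) v)) atTop (𝓝 (energy v)) := by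
  simp_rw [energy_eq_sum hv, fun n => energy_eq_sum (memLp_vconv (isTest_moll n) hv)]
  refine (tendsto_finsetSum _ fun i _ => ?_).const_mul _
  have h := tendstoLp_moll (memLp_component hv i) (by norm_num) (by norm_num)
  exact h.integral_mul (by norm_num) h

lemma eLpNorm_two_sq {f : E3 → ℝ} : eLpNorm f 2 volume ^ 2 = ∫⁻ x, ‖f x‖ₑ ^ 2 := by
  have h := eLpNorm_nnreal_pow_eq_lintegral (f := f) (μ := volume) (p := 2) (by norm_num)
  simpa using h

variable {T : ℝ} {u₀ : E3 → E3} {u : ℝ → E3 → E3} {G : ℝ → E3 → Fin 3 → Fin 3 → ℝ}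

lemma IsLerayHopf.lintegral_grad_lt_top (hu : IsLerayHopf T u₀ u G) (i j : Fin 3) :
    ∫⁻ t in Ioo 0 T, eLpNorm (fun x => G t x i j) 2 volume ^ 2 < ⊤ := by
  have hG := hu.grad_memLp i j
  have h := eLpNorm_nnreal_pow_eq_lintegral (f := fun z : ℝ × E3 => G z.1 z.2 i j) (μ := slab T)
    (p := 2) (by norm_num)
  simp only [ENNReal.coe_ofNat, NNReal.coe_ofNat, ENNReal.rpow_ofNat] at h
  simp_rw [eLpNorm_two_sq]
  rw [slab, lintegral_prod _ (hG.1.enorm.pow_const 2), ← slab] at h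
  rw [← h]
  exact ENNReal.pow_lt_top hG.2

lemma dissipation_eq (hG : ∀ᵐ s ∂(volume.restrict (Ioc 0 T)),
      ∀ i j, MemLp (fun x => G s x i j) 2 volume) {t : ℝ} (ht : t ≤ T) :
    dissipation G t = ∫ s in Ioc 0 t, ∑ i, ∑ j, ∫ x, G s x i j * G s x i j := by
  rw [dissipation, restrict_Ioo_eq_restrict_Ioc]
  refine integral_congr_ae ?_
  filter_upwards [ae_restrict_of_ae_restrict_of_subset (Ioc_subset_Ioc_right ht) hG] with s hs
  simp_rw [sq]
  rw [integral_finsetSum _ fun i _ => integrable_finsetSum _ fun j _ =>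
    integrable_mul_of_memLp_two (hs i j) (hs i j)]
  exact Finset.sum_congr rfl fun i _ => integral_finsetSum _ fun j _ =>
    integrable_mul_of_memLp_two (hs i j) (hs i j)

/-- Energy equality under integrability in time of the norms that control the convective term. -/
theorem IsLerayHopf.energy_equality (hT : 0 < T) (hu : IsLerayHopf T u₀ u G) {q r : ℝ≥0∞}
    [hqr : ENNReal.HolderTriple q r 2] (hq : q ≠ ⊤) (hr : r ≠ ⊤)
    (h4 : ∀ i : Fin 3, i ≠ 2 →
      ∫⁻ t in Ioo 0 T, eLpNorm (fun x => u t x i) 4 volume ^ 4 < ⊤)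
    (hprod : ∀ i : Fin 3, i ≠ 2 → ∫⁻ t in Ioo 0 T,
      (eLpNorm (fun x => u t x i) q volume * eLpNorm (fun x => u t x 2) r volume) ^ 2 < ⊤)
    (hqfin : ∀ i : Fin 3, i ≠ 2 →
      ∀ᵐ t ∂(volume.restrict (Ioo 0 T)), eLpNorm (fun x => u t x i) q volume < ⊤)
    (hrfin : ∀ᵐ t ∂(volume.restrict (Ioo 0 T)), eLpNorm (fun x => u t x 2) r volume < ⊤)
    {t : ℝ} (ht : t ∈ Icc 0 T) : energy (u t) + dissipation G t = energy u₀ := by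
  have h0T : (0 : ℝ) ∈ Icc 0 T := ⟨le_rfl, hT.le⟩
  set D₁ : ℝ → ℝ≥0∞ := fun t => ∑ i ∈ Finset.univ.erase (2 : Fin 3),
    eLpNorm (fun x => u t x i) 4 volume ^ 4 with hD₁
  set D₂ : ℝ → ℝ≥0∞ := fun t => ∑ i ∈ Finset.univ.erase (2 : Fin 3),
    (eLpNorm (fun x => u t x i) q volume * eLpNorm (fun x => u t x 2) r volume) ^ 2 with hD₂
  set D₃ : ℝ → ℝ≥0∞ := fun t => ∑ i, ∑ j, eLpNorm (fun x => G t x i j) 2 volume ^ 2 with hD₃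
  -- The majorant in time: it dominates every quantity required by
  -- `IsRegularSlice.enorm_convective_le` and is integrable by hypothesis together with the bound on
  -- the gradient.
  set D : ℝ → ℝ≥0∞ := fun t => D₁ t + D₂ t + D₃ t with hD
  have hum := fun i {p : ℝ≥0∞} (hp : p ≠ ⊤) =>
    aemeasurable_eLpNorm_slice (hu.aestronglyMeasurable i) hp
  have m1 : ∀ i, AEMeasurable (fun t => eLpNorm (fun x => u t x i) 4 volume ^ 4)
      (volume.restrict (Ioo 0 T)) := fun i => (hum i (by norm_num)).pow_const 4
  have m2 : ∀ i, AEMeasurable (fun t => (eLpNorm (fun x => u t x i) q volume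
      * eLpNorm (fun x => u t x 2) r volume) ^ 2) (volume.restrict (Ioo 0 T)) :=
    fun i => ((hum i hq).mul (hum 2 hr)).pow_const 2
  have m3 : ∀ i j, AEMeasurable (fun t => eLpNorm (fun x => G t x i j) 2 volume ^ 2)
      (volume.restrict (Ioo 0 T)) := fun i j =>
    (aemeasurable_eLpNorm_slice (hu.grad_memLp i j).1 (by norm_num)).pow_const 2
  have mD₁ : AEMeasurable D₁ (volume.restrict (Ioo 0 T)) :=
    Finset.aemeasurable_fun_sum _ fun i _ => m1 i
  have mD₂ : AEMeasurable D₂ (volume.restrict (Ioo 0 T)) :=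
    Finset.aemeasurable_fun_sum _ fun i _ => m2 i
  have mD₃i : ∀ i, AEMeasurable (fun t => ∑ j, eLpNorm (fun x => G t x i j) 2 volume ^ 2)
      (volume.restrict (Ioo 0 T)) := fun i => Finset.aemeasurable_fun_sum _ fun j _ => m3 i j
  have mD₃ : AEMeasurable D₃ (volume.restrict (Ioo 0 T)) :=
    Finset.aemeasurable_fun_sum _ fun i _ => mD₃i i
  have mD : AEMeasurable D (volume.restrict (Ioo 0 T)) := (mD₁.add mD₂).add mD₃
  have hDfin : ∫⁻ t in Ioo 0 T, D t ≠ ⊤ := by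
    simp only [hD]
    rw [lintegral_add_right' _ mD₃, lintegral_add_left' mD₁]
    simp only [hD₁, hD₂, hD₃]
    rw [lintegral_finsetSum' _ fun i _ => m1 i, lintegral_finsetSum' _ fun i _ => m2 i,
      lintegral_finsetSum' _ fun i _ => mD₃i i]
    simp_rw [fun i => lintegral_finsetSum' Finset.univ fun j _ => m3 i j]
    refine ENNReal.add_ne_top.2 ⟨ENNReal.add_ne_top.2 ⟨?_, ?_⟩, ?_⟩
    · exact ENNReal.sum_ne_top.2 fun i hi => (h4 i (Finset.ne_of_mem_erase hi)).ne
    · exact ENNReal.sum_ne_top.2 fun i hi => (hprod i (Finset.ne_of_mem_erase hi)).ne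
    · exact ENNReal.sum_ne_top.2 fun i _ => ENNReal.sum_ne_top.2 fun j _ =>
        (hu.lintegral_grad_lt_top i j).ne
  have b1 : ∀ s, ∀ i : Fin 3, i ≠ 2 → eLpNorm (fun x => u s x i) 4 volume ^ 4 ≤ D s := by
    intro s i hi
    refine le_trans ?_ ((le_self_add (b := D₂ s)).trans le_self_add)
    exact Finset.single_le_sum (f := fun i => eLpNorm (fun x => u s x i) 4 volume ^ 4)
      (fun _ _ => zero_le) (Finset.mem_erase.2 ⟨hi, Finset.mem_univ i⟩)
  have b2 : ∀ s, ∀ i : Fin 3, i ≠ 2 → (eLpNorm (fun x => u s x i) q volume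
      * eLpNorm (fun x => u s x 2) r volume) ^ 2 ≤ D s := by
    intro s i hi
    refine le_trans ?_ ((le_add_self (b := D₁ s)).trans le_self_add)
    exact Finset.single_le_sum (f := fun i => (eLpNorm (fun x => u s x i) q volume
      * eLpNorm (fun x => u s x 2) r volume) ^ 2)
      (fun _ _ => zero_le) (Finset.mem_erase.2 ⟨hi, Finset.mem_univ i⟩)
  have b3 : ∀ s i j, eLpNorm (fun x => G s x i j) 2 volume ^ 2 ≤ D s := by
    intro s i j
    refine le_trans ?_ (le_add_self (a := D₃ s))
    refine (Finset.single_le_sum (f := fun j => eLpNorm (fun x => G s x i j) 2 volume ^ 2)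
      (fun _ _ => zero_le) (Finset.mem_univ j)).trans ?_
    exact Finset.single_le_sum (f := fun i => ∑ j, eLpNorm (fun x => G s x i j) 2 volume ^ 2)
      (fun _ _ => zero_le) (Finset.mem_univ i)
  -- Almost every slice is regular; the `L⁴` bounds of the horizontal components come from
  -- finiteness of `D`.
  have hreg : ∀ᵐ s ∂(volume.restrict (Ioc 0 T)), IsRegularSlice q r (u s) (G s) ∧ D s < ⊤ := by
    have hq' : ∀ᵐ t ∂(volume.restrict (Ioo 0 T)), ∀ i : Fin 3, i ≠ 2 →
        eLpNorm (fun x => u t x i) q volume < ⊤ := by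
      rw [ae_all_iff]; intro i
      by_cases hi : i = 2
      · simp [hi]
      · filter_upwards [hqfin i hi] with t ht _ using ht
    have hDt := ae_lt_top' mD hDfin
    rw [restrict_Ioo_eq_restrict_Ioc] at hq' hrfin hDt
    filter_upwards [hu.ae_energy_slice, hq', hrfin, hDt] with s ⟨hs1, hs2, hs3⟩ hs4 hs5 hs6
    have hms := fun i => (hu.memLp_component hs1 i).1
    refine ⟨⟨hu.memLp s hs1, hs3, hs2, hu.div_free s hs1, fun i hi => ⟨hms i, ?_⟩,
      fun i hi => ⟨hms i, hs4 i hi⟩, ⟨hms 2, hs5⟩⟩, hs6⟩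
    exact (ENNReal.pow_lt_top_iff.1 ((b1 s i hi).trans_lt hs6)).resolve_right (by norm_num)
  have hreg' := ae_restrict_of_ae_restrict_of_subset (Ioc_subset_Ioc_right ht.2) hreg
  set F : ℕ → ℝ → ℝ := fun n s => -(∑ i, ∑ j, ∫ x, conv (moll n) (fun y => G s y i j) x ^ 2)
    + convective (moll n) (u s) (G s) with hF
  have hFm : ∀ n, AEStronglyMeasurable (F n) (volume.restrict (Ioc 0 t)) := by
    intro n
    have hc := (isTest_moll n).continuous
    have hJG : ∀ i j, AEStronglyMeasurable
        (fun z : ℝ × E3 => conv (moll n) (fun y => G z.1 y i j) z.2) (slab T) := fun i j =>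
      aestronglyMeasurable_conv_slab (f := fun t y => G t y i j) hc (hu.grad_memLp i j).1
    have hJu : ∀ i j, AEStronglyMeasurable
        (fun z : ℝ × E3 => conv (moll n) (fun y => u z.1 y i * u z.1 y j) z.2) (slab T) :=
      fun i j => aestronglyMeasurable_conv_slab (f := fun t y => u t y i * u t y j) hc
        ((hu.aestronglyMeasurable i).mul (hu.aestronglyMeasurable j))
    refine AEStronglyMeasurable.mono_measure ?_ (Measure.restrict_mono_set _ (Ioc_subset_Ioc_right ht.2))
    refine AEStronglyMeasurable.add (AEStronglyMeasurable.neg ?_) ?_ <;>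
      refine Finset.aestronglyMeasurable_fun_sum _ fun i _ =>
        Finset.aestronglyMeasurable_fun_sum _ fun j _ => ?_
    · exact aestronglyMeasurable_integral_slab ((hJG i j).pow 2)
    · exact aestronglyMeasurable_integral_slab ((hJu i j).mul (hJG i j))
  have hlim : Tendsto (fun n => ∫ s in Ioc 0 t, F n s) atTop
      (𝓝 (∫ s in Ioc 0 t, (-(∑ i, ∑ j, ∫ x, G s x i j * G s x i j) + 0))) := by
    refine tendsto_integral_of_dominated_convergence (fun s => (81 * D s).toReal) hFm ?_ ?_ ?_
    · refine integrable_toReal_of_lintegral_ne_top ?_ ?_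
      · refine AEMeasurable.mono_measure ?_
          (Measure.restrict_mono_set _ (Ioc_subset_Ioc_right ht.2))
        rw [← restrict_Ioo_eq_restrict_Ioc]
        exact mD.const_mul _
      · refine ne_top_of_le_ne_top ?_ (lintegral_mono_set (Ioc_subset_Ioc_right ht.2))
        rw [← restrict_Ioo_eq_restrict_Ioc, lintegral_const_mul' _ _ (by norm_num)]
        exact ENNReal.mul_ne_top (by norm_num) hDfin
    · intro n
      filter_upwards [hreg'] with s ⟨hs, hs'⟩
      have hle : ‖F n s‖ₑ ≤ 81 * D s := by
        refine (enorm_add_le _ _).trans ?_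
        -- Nine entries of the gradient, plus `72 D` for the convective term.
        calc _ ≤ 9 * D s + 9 * (8 * D s) := by
              gcongr ?_ + ?_
              · rw [enorm_neg]
                calc _ ≤ ∑ i : Fin 3, ‖∑ j, ∫ x, conv (moll n) (fun y => G s y i j) x ^ 2‖ₑ :=
                      enorm_sum_le _ _
                  _ ≤ ∑ i : Fin 3, ∑ j : Fin 3, D s := by
                      refine Finset.sum_le_sum fun i _ => (enorm_sum_le _ _).trans ?_
                      refine Finset.sum_le_sum fun j _ => ?_
                      have hm := hs.grad_memLp i j
                      have hJ := memLp_conv_moll hm (by norm_num) (by norm_num) n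
                      simp_rw [sq]
                      refine (enorm_integral_mul_le hJ.1 hJ.1 2 2).trans ?_
                      rw [← sq]
                      refine le_trans ?_ (b3 s i j)
                      gcongr
                      exact eLpNorm_conv_moll_le n hm.1 (by norm_num) (by norm_num)
                  _ = 9 * D s := by
                      simp only [Finset.sum_const, Finset.card_univ, Fintype.card_fin,
                        nsmul_eq_mul]
                      ring
              · exact hs.enorm_convective_le hq (b1 s) (b2 s) (b3 s) n
          _ = 81 * D s := by ring
      rw [← toReal_enorm]
      exact ENNReal.toReal_mono (ENNReal.mul_ne_top (by norm_num) hs'.ne) hle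
    · filter_upwards [hreg'] with s ⟨hs, _⟩
      refine Tendsto.add (Tendsto.neg (tendsto_finsetSum _ fun i _ => tendsto_finsetSum _
        fun j _ => ?_)) (hs.tendsto_convective hq hr)
      have h := tendstoLp_moll (hs.grad_memLp i j) (by norm_num) (by norm_num)
      simp_rw [sq]
      exact h.integral_mul (by norm_num) h
  have hE := (tendsto_energy_vconv (hu.memLp t ht)).sub (tendsto_energy_vconv (hu.memLp 0 h0T))
  simp_rw [fun n => hu.mollified_energy hT (isTest_moll n) (moll_neg n) ht] at hE
  -- Strong `L²` convergence of the mollified velocity at the two fixed times identifies the limit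
  -- of the left-hand side.
  have key := tendsto_nhds_unique hE hlim
  simp_rw [add_zero] at key
  rw [integral_neg, ← dissipation_eq (hreg.mono fun s hs => hs.1.grad_memLp) ht.2] at key
  have h0 : energy (u 0) = energy u₀ := by
    rw [energy, energy]
    congr 1
    exact integral_congr_ae (hu.initial.mono fun x hx => by simp only [hx])
  linarith

end

/-! ### Interpolation inequalities and arithmetic of the exponents -/

section

lemma rpow_mul_rpow_le_add {α β : ℝ} (hα : 0 ≤ α) (hβ : 0 ≤ β) (h : α + β = 1) (a b : ℝ≥0∞) :
    a ^ α * b ^ β ≤ a + b := by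
  calc a ^ α * b ^ β ≤ (a + b) ^ α * (a + b) ^ β := by
        gcongr
        · exact le_self_add
        · exact le_add_self
    _ = a + b := by rw [← ENNReal.rpow_add_of_nonneg _ _ hα hβ, h, ENNReal.rpow_one]

lemma eLpNorm_ofReal_rpow {f : E3 → ℝ} {a : ℝ} (ha : 0 < a) :
    eLpNorm f (ENNReal.ofReal a) volume ^ a = ∫⁻ x, ‖f x‖ₑ ^ a := by
  rw [eLpNorm_eq_lintegral_rpow_enorm_toReal (by simpa using ha) (by simp),
    ENNReal.toReal_ofReal ha.le, ← ENNReal.rpow_mul, one_div, inv_mul_cancel₀ ha.ne',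
    ENNReal.rpow_one]

lemma eLpNorm_four_pow {f : E3 → ℝ} :
    eLpNorm f 4 volume ^ 4 = ∫⁻ x, ‖f x‖ₑ ^ (4 : ℝ) := by
  have h := eLpNorm_ofReal_rpow (f := f) (a := 4) (by norm_num)
  rw [← h]; simp

/-- Interpolation of the `L⁴` norm. -/
lemma eLpNorm_four_pow_le {f : E3 → ℝ} (hf : AEStronglyMeasurable f volume) {a b α β : ℝ}
    (ha : 0 < a) (hb : 0 < b) (hα : 0 ≤ α) (hβ : 0 ≤ β) (h : α + β = 1)
    (h4 : a * α + b * β = 4) :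
    eLpNorm f 4 volume ^ 4 ≤ eLpNorm f (ENNReal.ofReal a) volume ^ (a * α)
      * eLpNorm f (ENNReal.ofReal b) volume ^ (b * β) := by
  rw [ENNReal.rpow_mul, ENNReal.rpow_mul, eLpNorm_ofReal_rpow ha, eLpNorm_ofReal_rpow hb,
    eLpNorm_four_pow]
  refine le_trans (le_of_eq ?_) (ENNReal.lintegral_mul_norm_pow_le (hf.enorm.pow_const a)
    (hf.enorm.pow_const b) hα hβ h)
  refine lintegral_congr fun x => ?_
  rw [← ENNReal.rpow_mul, ← ENNReal.rpow_mul,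
    ← ENNReal.rpow_add_of_nonneg _ _ (by positivity) (by positivity), h4]

/-- The endpoint of the interpolation, needed for Shinbrot's class with `q = ∞`, `p = 2`. -/
lemma eLpNorm_four_pow_le_top {f : E3 → ℝ} (hf : AEStronglyMeasurable f volume) :
    eLpNorm f 4 volume ^ 4 ≤ eLpNorm f ⊤ volume ^ 2 * eLpNorm f 2 volume ^ 2 := by
  rw [eLpNorm_four_pow, eLpNorm_two_sq, eLpNorm_exponent_top]
  calc _ ≤ ∫⁻ x, eLpNormEssSup f volume ^ 2 * ‖f x‖ₑ ^ 2 := by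
        refine lintegral_mono_ae ?_
        filter_upwards [ae_le_eLpNormEssSup (f := f) (μ := volume)] with x hx
        calc ‖f x‖ₑ ^ (4 : ℝ) = ‖f x‖ₑ ^ 2 * ‖f x‖ₑ ^ 2 := by
              rw [← pow_add]; exact ENNReal.rpow_ofNat _ 4
          _ ≤ _ := by gcongr
    _ = _ := lintegral_const_mul'' _ (hf.enorm.pow_const 2)

lemma add_sq_le (a b : ℝ≥0∞) : (a + b) ^ 2 ≤ 4 * (a ^ 2 + b ^ 2) := by
  rcases le_total a b with h | h
  · calc (a + b) ^ 2 ≤ (b + b) ^ 2 := by gcongr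
      _ = 4 * b ^ 2 := by ring
      _ ≤ _ := by gcongr; exact le_add_self
  · calc (a + b) ^ 2 ≤ (a + a) ^ 2 := by gcongr
      _ = 4 * a ^ 2 := by ring
      _ ≤ _ := by gcongr; exact le_self_add

lemma lintegral_mixedNorm_lt_top {T c : ℝ} {q : ℝ≥0∞} (hc : 0 < c) {f : ℝ → E3 → ℝ}
    (h : mixedNorm T (ENNReal.ofReal c) q f < ⊤) :
    ∫⁻ t in Ioo 0 T, eLpNorm (f t) q volume ^ c < ⊤ := by
  have h1 := lintegral_rpow_enorm_lt_top_of_eLpNorm_lt_top (by simpa using hc) (by simp) h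
  simpa [ENNReal.toReal_ofReal hc.le] using h1

lemma lintegral_mixedNorm_two_lt_top {T : ℝ} {q : ℝ≥0∞} {f : ℝ → E3 → ℝ}
    (h : mixedNorm T 2 q f < ⊤) : ∫⁻ t in Ioo 0 T, eLpNorm (f t) q volume ^ 2 < ⊤ := by
  have h1 := lintegral_mixedNorm_lt_top (c := 2) (q := q) (f := f) (T := T) (by norm_num)
    (by rwa [show ENNReal.ofReal 2 = 2 by simp])
  simpa using h1

lemma ae_lt_top_of_mixedNorm {T : ℝ} {p q : ℝ≥0∞} (hp : p ≠ 0) (hq : q ≠ ⊤) {f : ℝ → E3 → ℝ}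
    (h : MemLpLq T p q f) : ∀ᵐ t ∂(volume.restrict (Ioo 0 T)), eLpNorm (f t) q volume < ⊤ := by
  obtain ⟨hm, h⟩ := h
  rcases eq_or_ne p ⊤ with rfl | hp'
  · rw [mixedNorm, eLpNorm_exponent_top] at h
    filter_upwards [ae_le_eLpNormEssSup (f := fun t => eLpNorm (f t) q volume)
      (μ := volume.restrict (Ioo 0 T))] with t ht
    exact lt_of_le_of_lt (by simpa using ht) h
  · have h1 := lintegral_rpow_enorm_lt_top_of_eLpNorm_lt_top hp hp' h
    have hpos := ENNReal.toReal_pos hp hp'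
    simp only [enorm_eq_self] at h1
    filter_upwards [ae_lt_top' ((aemeasurable_eLpNorm_slice hm hq).pow_const _) h1.ne] with t ht
    exact (ENNReal.rpow_lt_top_iff_of_pos hpos).1 ht

lemma dualExponent_ofReal {a : ℝ} (ha : 2 < a) :
    dualExponent (ENNReal.ofReal a) = ENNReal.ofReal (2 * a / (a - 2)) := by
  have h2 : (2 : ℝ≥0∞) = ENNReal.ofReal 2 := by simp
  rw [dualExponent, if_neg (by simp), h2, ← ENNReal.ofReal_mul (by norm_num),
    ← ENNReal.ofReal_sub _ (by norm_num), ENNReal.ofReal_div_of_pos (by linarith)]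

/-- The identity behind it is `1/a + (a - 2)/(2a) = 1/2`. -/
lemma holderTriple_dualExponent {a : ℝ} (ha : 2 < a) :
    ENNReal.HolderTriple (ENNReal.ofReal a) (dualExponent (ENNReal.ofReal a)) 2 := by
  have ha2 : 0 < a - 2 := by linarith
  have h2 : (2 : ℝ≥0∞) = ENNReal.ofReal 2 := by simp
  have hb : 0 < 2 * a / (a - 2) := by positivity
  rw [dualExponent_ofReal ha]
  constructor
  rw [h2, ← ENNReal.ofReal_inv_of_pos (by linarith), ← ENNReal.ofReal_inv_of_pos hb,
    ← ENNReal.ofReal_inv_of_pos (by norm_num),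
    ← ENNReal.ofReal_add (by positivity) (by positivity)]
  congr 1
  field_simp
  ring

lemma ShinbrotExponents.exists_real {p q : ℝ≥0∞} (h : ShinbrotExponents p q) (hq : q ≠ ⊤) :
    ∃ a : ℝ, 4 ≤ a ∧ q = ENNReal.ofReal a ∧ p = ENNReal.ofReal (2 * a / (a - 2)) := by
  obtain ⟨h1, h2⟩ := h
  lift q to ℝ≥0 using hq
  have h4 : (4 : ℝ) ≤ q := by exact_mod_cast h2
  refine ⟨q, h4, by simp, ?_⟩
  -- An infinite `p` would force `q = 2`, against `q ≥ 4`.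
  have hp : p ≠ ⊤ := by
    rintro rfl
    rw [ENNReal.div_top, zero_add] at h1
    have := congrArg ENNReal.toReal h1
    simp [ENNReal.toReal_div] at this
    rw [div_eq_iff (by linarith)] at this
    linarith
  have hp0 : p ≠ 0 := by
    rintro rfl
    simp [ENNReal.div_zero] at h1
  lift p to ℝ≥0 using hp
  have hp0' : (p : ℝ) ≠ 0 := by exact_mod_cast hp0
  have hq0 : (q : ℝ≥0∞) ≠ 0 := by rintro h; rw [h] at h2; simp at h2
  have h3 : 2 / (p : ℝ) + 2 / q = 1 := by
    have := congrArg ENNReal.toReal h1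
    rw [ENNReal.toReal_add (ENNReal.div_ne_top (by simp) hp0) (ENNReal.div_ne_top (by simp) hq0)]
      at this
    simpa [ENNReal.toReal_div] using this
  have e : (p : ℝ) = 2 * q / (q - 2) := by
    field_simp at h3
    rw [eq_div_iff (by linarith)]
    linarith
  rw [← e]; simp

lemma ShinbrotExponents.eq_two {p : ℝ≥0∞} (h : ShinbrotExponents p ⊤) : p = 2 := by
  have h1 := h.1
  rw [ENNReal.div_top, add_zero] at h1
  have hp0 : p ≠ 0 := by rintro rfl; simp [ENNReal.div_zero] at h1
  have hp : p ≠ ⊤ := by rintro rfl; simp at h1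
  rw [ENNReal.div_eq_one_iff hp0 hp] at h1
  exact h1.symm

lemma BeiraoDaVeigaYangExponents.exists_real {p q : ℝ≥0∞} (h : BeiraoDaVeigaYangExponents p q) :
    ∃ a : ℝ, a ≤ 4 ∧ q = ENNReal.ofReal a ∧
      (a = 3 ∧ p = ⊤ ∨ 3 < a ∧ p = ENNReal.ofReal (a / (a - 3))) := by
  obtain ⟨h1, h2⟩ := h
  have hq : q ≠ ⊤ := ne_top_of_le_ne_top (by norm_num) h2
  lift q to ℝ≥0 using hq
  have h4 : (q : ℝ) ≤ 4 := by exact_mod_cast h2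
  refine ⟨q, h4, by simp, ?_⟩
  have hq0 : (q : ℝ≥0∞) ≠ 0 := by rintro h; simp [h, ENNReal.div_zero] at h1
  have hp0 : p ≠ 0 := by rintro rfl; simp at h1
  have hq0' : 0 < (q : ℝ) := by
    have : q ≠ 0 := by exact_mod_cast hq0
    positivity
  rcases eq_or_ne p ⊤ with rfl | hp
  · left
    refine ⟨?_, rfl⟩
    rw [ENNReal.div_top, zero_add, ENNReal.div_eq_one_iff hq0 (by simp)] at h1
    exact_mod_cast h1.symm
  · right
    lift p to ℝ≥0 using hp
    have hp0' : 0 < (p : ℝ) := by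
      have : p ≠ 0 := by exact_mod_cast hp0
      positivity
    have h3 : 1 / (p : ℝ) + 3 / q = 1 := by
      have := congrArg ENNReal.toReal h1
      rw [ENNReal.toReal_add (ENNReal.div_ne_top (by simp) hp0)
        (ENNReal.div_ne_top (by simp) hq0)] at this
      simpa [ENNReal.toReal_div] using this
    field_simp at h3
    -- The relation reads `p (q - 3) = q` with `p` and `q` positive.
    have h5 : 3 < (q : ℝ) := by nlinarith
    refine ⟨h5, ?_⟩
    have e : (p : ℝ) = q / (q - 3) := by
      rw [eq_div_iff (by linarith)]
      linarith
    rw [← e]; simp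

/-! ### Space-time integrability of the components and conclusion -/

variable {T : ℝ} {u₀ : E3 → E3} {u : ℝ → E3 → E3} {G : ℝ → E3 → Fin 3 → Fin 3 → ℝ}

lemma IsLerayHopf.eLpNorm_component_le (hu : IsLerayHopf T u₀ u G) {t : ℝ} (ht : t ∈ Icc 0 T)
    (i : Fin 3) : eLpNorm (fun x => u t x i) 2 volume ≤ eLpNorm u₀ 2 volume :=
  (NavierStokes.eLpNorm_component_le _ _ _).trans (hu.eLpNorm_le ht)

/-- Leray–Hopf solutions are in `L²(0,T; L⁶)`. -/
lemma IsLerayHopf.lintegral_six_lt_top (hu : IsLerayHopf T u₀ u G) (j : Fin 3) :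
    ∫⁻ t in Ioo 0 T, eLpNorm (fun x => u t x j) 6 volume ^ 2 < ⊤ := by
  obtain ⟨C, hC⟩ := exists_eLpNorm_six_le
  set g : Fin 3 → ℝ → ℝ≥0∞ := fun i t => eLpNorm (fun x => G t x i j) 2 volume ^ 2 with hg
  set E := eLpNorm u₀ 2 volume ^ 2
  have hE : E ≠ ⊤ := ENNReal.pow_ne_top hu.initial_memLp.2.ne
  have hgm : ∀ i, AEMeasurable (g i) (volume.restrict (Ioo 0 T)) := fun i =>
    (aemeasurable_eLpNorm_slice (hu.grad_memLp i j).1 (by norm_num)).pow_const 2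
  -- The factor `64 = 4³` comes from splitting the square of a sum of four terms by three uses of
  -- `add_sq_le`.
  have hbound : ∀ᵐ t ∂(volume.restrict (Ioo 0 T)), eLpNorm (fun x => u t x j) 6 volume ^ 2
      ≤ (C : ℝ≥0∞) ^ 2 * 64 * (∑ i, g i t + E) := by
    have h := hu.ae_energy_slice
    rw [← restrict_Ioo_eq_restrict_Ioc] at h
    filter_upwards [h] with t ⟨h1, h2, h3⟩
    have hle := hC (fun x => u t x j) (fun i x => G t x i j) (hu.memLp_component h1 j)
      (fun i => h3 i j) (fun i => h2.isWeakDeriv i j)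
    simp only [Fin.sum_univ_three, hg] at hle ⊢
    set a := eLpNorm (fun x => G t x 0 j) 2 volume
    set b := eLpNorm (fun x => G t x 1 j) 2 volume
    set c := eLpNorm (fun x => G t x 2 j) 2 volume
    calc _ ≤ (C * (a + b + c + eLpNorm u₀ 2 volume)) ^ 2 := by
          gcongr
          refine hle.trans ?_
          gcongr
          exact hu.eLpNorm_component_le h1 j
      _ = (C : ℝ≥0∞) ^ 2 * (a + b + c + eLpNorm u₀ 2 volume) ^ 2 := mul_pow _ _ _
      _ ≤ (C : ℝ≥0∞) ^ 2 * (4 * (4 * (4 * (a ^ 2 + b ^ 2) + c ^ 2) + E)) := by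
          gcongr
          refine (add_sq_le _ _).trans ?_
          gcongr
          refine (add_sq_le _ _).trans ?_
          gcongr
          exact add_sq_le _ _
      _ ≤ (C : ℝ≥0∞) ^ 2 * (4 * (4 * (4 * (a ^ 2 + b ^ 2) + 4 * c ^ 2) + 16 * E)) := by
          gcongr
          · exact le_mul_of_one_le_left' (by norm_num)
          · exact le_mul_of_one_le_left' (by norm_num)
      _ = _ := by ring
  refine (lintegral_mono_ae hbound).trans_lt ?_
  rw [lintegral_const_mul' _ _ (ENNReal.mul_ne_top (by simp) (by norm_num)),
    lintegral_add_right' _ aemeasurable_const, lintegral_finsetSum' _ fun i _ => hgm i]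
  refine ENNReal.mul_lt_top (ENNReal.mul_lt_top (by simp) (by norm_num))
    (ENNReal.add_lt_top.2 ⟨ENNReal.sum_lt_top.2 fun i _ => hu.lintegral_grad_lt_top i j, ?_⟩)
  simpa [ENNReal.mul_lt_top_iff] using Or.inl hE.lt_top

/-- Interpolating `L⁴` between `L^q` and `L²` gives `‖f‖₄⁴` a factor `‖f‖_q` to the power `2q/(q -
2)`, which is exactly `p`; the `L²` factor is bounded by the energy. -/
lemma IsLerayHopf.lintegral_four_lt_top_of_shinbrot (hu : IsLerayHopf T u₀ u G) {i : Fin 3}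
    {p q : ℝ≥0∞} (hpq : ShinbrotExponents p q) (h : MemLpLq T p q (fun t x => u t x i)) :
    ∫⁻ t in Ioo 0 T, eLpNorm (fun x => u t x i) 4 volume ^ 4 < ⊤ := by
  have hE : eLpNorm u₀ 2 volume ≠ ⊤ := hu.initial_memLp.2.ne
  rcases eq_or_ne q ⊤ with rfl | hq
  · obtain rfl := hpq.eq_two
    have h2 := lintegral_mixedNorm_two_lt_top h.2
    refine lt_of_le_of_lt (setLIntegral_mono_ae' measurableSet_Ioo
      (g := fun t => eLpNorm (fun x => u t x i) ⊤ volume ^ 2 * eLpNorm u₀ 2 volume ^ 2)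
      (Eventually.of_forall fun t ht => ?_)) ?_
    · have ht' := Ioo_subset_Icc_self ht
      refine (eLpNorm_four_pow_le_top (hu.memLp_component ht' i).1).trans ?_
      gcongr
      exact hu.eLpNorm_component_le ht' i
    · rw [lintegral_mul_const' _ _ (ENNReal.pow_ne_top hE)]
      exact ENNReal.mul_lt_top h2 (ENNReal.pow_lt_top hE.lt_top)
  · obtain ⟨a, ha, rfl, rfl⟩ := hpq.exists_real hq
    have ha2 : 0 < a - 2 := by linarith
    have h2 := lintegral_mixedNorm_lt_top (by positivity) h.2
    have hβ : 0 ≤ (a - 4) / (a - 2) := div_nonneg (by linarith) ha2.le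
    refine lt_of_le_of_lt (setLIntegral_mono_ae' measurableSet_Ioo
      (g := fun t => eLpNorm (fun x => u t x i) (ENNReal.ofReal a) volume ^ (2 * a / (a - 2))
        * eLpNorm u₀ 2 volume ^ (2 * ((a - 4) / (a - 2))))
      (Eventually.of_forall fun t ht => ?_)) ?_
    · have ht' := Ioo_subset_Icc_self ht
      have h3 := eLpNorm_four_pow_le (hu.memLp_component ht' i).1 (a := a) (b := 2)
        (α := 2 / (a - 2)) (β := (a - 4) / (a - 2)) (by linarith) (by norm_num) (by positivity) hβ
        (by field_simp; ring) (by field_simp; ring)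
      refine h3.trans ?_
      rw [show a * (2 / (a - 2)) = 2 * a / (a - 2) by ring]
      gcongr
      simpa using hu.eLpNorm_component_le ht' i
    · have hE' : eLpNorm u₀ 2 volume ^ (2 * ((a - 4) / (a - 2))) ≠ ⊤ :=
        ENNReal.rpow_ne_top_of_nonneg (by positivity) hE
      rw [lintegral_mul_const' _ _ hE']
      exact ENNReal.mul_lt_top h2 hE'.lt_top

/-- For `q ≤ 4` the other interpolation endpoint is `L⁶`, controlled in `L²(0,T)`. When `q = 3` the
`L³` factor is bounded in time and `‖f‖₆` appears squared. -/
lemma IsLerayHopf.lintegral_four_lt_top_of_beiraoDaVeigaYang (hu : IsLerayHopf T u₀ u G)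
    {i : Fin 3} {p q : ℝ≥0∞} (hpq : BeiraoDaVeigaYangExponents p q)
    (h : MemLpLq T p q (fun t x => u t x i)) :
    ∫⁻ t in Ioo 0 T, eLpNorm (fun x => u t x i) 4 volume ^ 4 < ⊤ := by
  have h6 := hu.lintegral_six_lt_top i
  obtain ⟨a, ha, rfl, ⟨rfl, rfl⟩ | ⟨ha3, rfl⟩⟩ := hpq.exists_real
  · have h1 := h.2
    rw [mixedNorm, eLpNorm_exponent_top] at h1
    set M := eLpNormEssSup (fun t => eLpNorm (fun x => u t x i) (ENNReal.ofReal 3) volume)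
      (volume.restrict (Ioo 0 T))
    refine lt_of_le_of_lt (lintegral_mono_ae
      (g := fun t => M ^ 2 * eLpNorm (fun x => u t x i) 6 volume ^ 2) ?_) ?_
    · filter_upwards [ae_restrict_mem measurableSet_Ioo, ae_le_eLpNormEssSup
        (f := fun t => eLpNorm (fun x => u t x i) (ENNReal.ofReal 3) volume)
        (μ := volume.restrict (Ioo 0 T))] with t ht hM
      have h3 := eLpNorm_four_pow_le (hu.memLp_component (Ioo_subset_Icc_self ht) i).1 (a := 3)
        (b := 6) (α := 2 / 3) (β := 1 / 3) (by norm_num) (by norm_num) (by norm_num) (by norm_num)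
        (by norm_num) (by norm_num)
      norm_num only at h3
      simp only [ENNReal.rpow_ofNat] at h3
      refine h3.trans ?_
      rw [show ENNReal.ofReal 6 = 6 by simp]
      gcongr
      simpa only [enorm_eq_self] using hM
    · rw [lintegral_const_mul' _ _ (ENNReal.pow_ne_top h1.ne)]
      exact ENNReal.mul_lt_top (ENNReal.pow_lt_top h1) h6
  · have ha3' : 0 < a - 3 := by linarith
    have ha6 : 0 < 6 - a := by linarith
    have ha4 : 0 ≤ 4 - a := by linarith
    have h2 := lintegral_mixedNorm_lt_top (by positivity) h.2
    refine lt_of_le_of_lt (setLIntegral_mono_ae' measurableSet_Ioo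
      (g := fun t => eLpNorm (fun x => u t x i) (ENNReal.ofReal a) volume ^ (a / (a - 3))
        + eLpNorm (fun x => u t x i) 6 volume ^ 2)
      (Eventually.of_forall fun t ht => ?_)) ?_
    · have h3 := eLpNorm_four_pow_le (hu.memLp_component (Ioo_subset_Icc_self ht) i).1 (a := a)
        (b := 6) (α := 2 / (6 - a)) (β := (4 - a) / (6 - a)) (by linarith) (by norm_num)
        (by positivity) (by positivity) (by field_simp; ring) (by field_simp; ring)
      refine h3.trans ?_
      -- The powers are rewritten as weights on the two integrable functions `‖f‖_a^(a/(a-3))` and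
      -- `‖f‖₆²`. The weights `2(a-3)/(6-a)` and `3(4-a)/(6-a)` add up to one.
      rw [show a * (2 / (6 - a)) = a / (a - 3) * (2 * (a - 3) / (6 - a)) by field_simp,
        show 6 * ((4 - a) / (6 - a)) = 2 * (3 * (4 - a) / (6 - a)) by ring,
        ENNReal.rpow_mul, ENNReal.rpow_mul _ 2, ENNReal.rpow_ofNat,
        show ENNReal.ofReal 6 = 6 by simp]
      exact rpow_mul_rpow_le_add (by positivity) (by positivity) (by field_simp; ring) _ _
    · rw [lintegral_add_left'
        ((aemeasurable_eLpNorm_slice (hu.aestronglyMeasurable i) (by simp)).pow_const _)]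
      exact ENNReal.add_lt_top.2 ⟨h2, h6⟩

/-- Energy equality when `u_h ∈ Lᵖ Lᑫ` and `u₃` lies in the dual class. -/
lemma IsLerayHopf.energy_equality_of_dual (hT : 0 < T) (hu : IsLerayHopf T u₀ u G) {a : ℝ}
    (ha : 2 < a) {p : ℝ≥0∞} (hp : p = ⊤ ∨ ∃ c : ℝ, 2 < c ∧ p = ENNReal.ofReal c)
    (h : ∀ i : Fin 3, i ≠ 2 → MemLpLq T p (ENNReal.ofReal a) (fun t x => u t x i))
    (h2 : MemLpLq T (dualExponent p) (dualExponent (ENNReal.ofReal a)) (fun t x => u t x 2))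
    (h4 : ∀ i : Fin 3, i ≠ 2 →
      ∫⁻ t in Ioo 0 T, eLpNorm (fun x => u t x i) 4 volume ^ 4 < ⊤) :
    ∀ t ∈ Icc 0 T, energy (u t) + dissipation G t = energy u₀ := by
  have hqr := holderTriple_dualExponent ha
  have hr : dualExponent (ENNReal.ofReal a) ≠ ⊤ := by rw [dualExponent_ofReal ha]; simp
  have hp0 : p ≠ 0 := by
    rcases hp with rfl | ⟨c, hc, rfl⟩
    · simp
    · simp; linarith
  have hp'0 : dualExponent p ≠ 0 := by
    rcases hp with rfl | ⟨c, hc, rfl⟩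
    · simp [dualExponent]
    · rw [dualExponent_ofReal hc]
      have : 0 < 2 * c / (c - 2) := div_pos (by linarith) (by linarith)
      simpa using this
  intro t ht
  refine hu.energy_equality hT (by simp) hr h4 (fun i hi => ?_)
    (fun i hi => ae_lt_top_of_mixedNorm hp0 (by simp) (h i hi))
    (ae_lt_top_of_mixedNorm hp'0 hr h2) ht
  have hi := (h i hi).2
  have h2' := h2.2
  rcases hp with rfl | ⟨c, hc, rfl⟩
  · rw [dualExponent, if_pos rfl] at h2'
    have h3 := lintegral_mixedNorm_two_lt_top h2'
    rw [mixedNorm, eLpNorm_exponent_top] at hi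
    -- For `p = ∞` the horizontal norm is essentially bounded in time and the dual exponent is `2`.
    refine lt_of_le_of_lt (lintegral_mono_ae (g := fun t =>
      eLpNormEssSup (fun t => eLpNorm (fun x => u t x i) (ENNReal.ofReal a) volume)
        (volume.restrict (Ioo 0 T)) ^ 2
        * eLpNorm (fun x => u t x 2) (dualExponent (ENNReal.ofReal a)) volume ^ 2) ?_) ?_
    · filter_upwards [ae_le_eLpNormEssSup
        (f := fun t => eLpNorm (fun x => u t x i) (ENNReal.ofReal a) volume)
        (μ := volume.restrict (Ioo 0 T))] with t hM
      rw [mul_pow]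
      gcongr
      simpa only [enorm_eq_self] using hM
    · rw [lintegral_const_mul' _ _ (ENNReal.pow_ne_top hi.ne)]
      exact ENNReal.mul_lt_top (ENNReal.pow_lt_top hi) h3
  · have hc2 : 0 < c - 2 := by linarith
    have h3 := lintegral_mixedNorm_lt_top (by linarith) hi
    rw [dualExponent_ofReal hc] at h2'
    have h5 := lintegral_mixedNorm_lt_top (by positivity) h2'
    refine lt_of_le_of_lt (lintegral_mono (g := fun t =>
      eLpNorm (fun x => u t x i) (ENNReal.ofReal a) volume ^ c
        + eLpNorm (fun x => u t x 2) (dualExponent (ENNReal.ofReal a)) volume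
          ^ (2 * c / (c - 2))) fun t => ?_) ?_
    · have h6 := rpow_mul_rpow_le_add (α := 2 / c) (β := (c - 2) / c) (by positivity)
        (by positivity) (by field_simp; ring)
        (eLpNorm (fun x => u t x i) (ENNReal.ofReal a) volume ^ c)
        (eLpNorm (fun x => u t x 2) (dualExponent (ENNReal.ofReal a)) volume
          ^ (2 * c / (c - 2)))
      rw [← ENNReal.rpow_mul, ← ENNReal.rpow_mul, show c * (2 / c) = 2 by field_simp,
        show 2 * c / (c - 2) * ((c - 2) / c) = 2 by field_simp, ENNReal.rpow_ofNat,
        ENNReal.rpow_ofNat, ← mul_pow] at h6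
      exact h6
    · rw [lintegral_add_left'
        ((aemeasurable_eLpNorm_slice (hu.aestronglyMeasurable i) (by simp)).pow_const _)]
      exact ENNReal.add_lt_top.2 ⟨h3, h5⟩

/-- Energy equality for solutions in `L⁴(0,T; L⁴)`. -/
lemma IsLerayHopf.energy_equality_of_four (hT : 0 < T) (hu : IsLerayHopf T u₀ u G)
    (h4 : ∀ i, ∫⁻ t in Ioo 0 T, eLpNorm (fun x => u t x i) 4 volume ^ 4 < ⊤) :
    ∀ t ∈ Icc 0 T, energy (u t) + dissipation G t = energy u₀ := by
  have hm := fun i => aemeasurable_eLpNorm_slice (hu.aestronglyMeasurable i)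
    (q := 4) (by norm_num)
  have hfin : ∀ i, ∀ᵐ t ∂(volume.restrict (Ioo 0 T)), eLpNorm (fun x => u t x i) 4 volume < ⊤ := by
    intro i
    filter_upwards [ae_lt_top' ((hm i).pow_const 4) (h4 i).ne] with t ht
    exact (ENNReal.pow_lt_top_iff.1 ht).resolve_right (by norm_num)
  intro t ht
  -- The exponent `4` is its own dual, so the mixed product is controlled by the fourth powers.
  refine hu.energy_equality hT (q := 4) (r := 4) (by norm_num) (by norm_num) (fun i _ => h4 i)
    (fun i _ => ?_) (fun i _ => hfin i) (hfin 2) ht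
  refine lt_of_le_of_lt (lintegral_mono (g := fun t => eLpNorm (fun x => u t x i) 4 volume ^ 4
    + eLpNorm (fun x => u t x 2) 4 volume ^ 4) fun t => ?_) ?_
  · rw [mul_pow]
    refine (mul_le_sq_add_sq _ _).trans_eq ?_
    ring
  · rw [lintegral_add_left' ((hm i).pow_const 4)]
    exact ENNReal.add_lt_top.2 ⟨h4 i, h4 2⟩

end

end NavierStokes

/-- The components are numbered `0, 1, 2`; thus `u_h` consists of the components `0, 1`, and `u_3`
is the component `2`. -/
theorem corollary1p5 (T : ℝ) (hT : 0 < T)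
    (u₀ : NavierStokes.E3 → NavierStokes.E3)
    (u : ℝ → NavierStokes.E3 → NavierStokes.E3)
    (G : ℝ → NavierStokes.E3 → Fin 3 → Fin 3 → ℝ)
    (hu : NavierStokes.IsLerayHopf T u₀ u G)
    (h :
      (∃ p q : ℝ≥0∞, NavierStokes.ShinbrotExponents p q ∧ q ≠ ⊤ ∧
        NavierStokes.MemLpLq T p q (fun t x => u t x 0) ∧
        NavierStokes.MemLpLq T p q (fun t x => u t x 1) ∧
        NavierStokes.MemLpLq T (NavierStokes.dualExponent p) (NavierStokes.dualExponent q)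
          (fun t x => u t x 2)) ∨
      (∃ p q : ℝ≥0∞, NavierStokes.BeiraoDaVeigaYangExponents p q ∧
        NavierStokes.MemLpLq T p q (fun t x => u t x 0) ∧
        NavierStokes.MemLpLq T p q (fun t x => u t x 1) ∧
        NavierStokes.MemLpLq T (NavierStokes.dualExponent p) (NavierStokes.dualExponent q)
          (fun t x => u t x 2)) ∨
      (∃ S : Set (Fin 3),
        (∀ i ∈ S, ∃ p q : ℝ≥0∞, NavierStokes.ShinbrotExponents p q ∧
          NavierStokes.MemLpLq T p q (fun t x => u t x i)) ∧
        (∀ j ∉ S, ∃ p q : ℝ≥0∞, NavierStokes.BeiraoDaVeigaYangExponents p q ∧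
          NavierStokes.MemLpLq T p q (fun t x => u t x j)))) :
    ∀ t ∈ Set.Icc 0 T,
      NavierStokes.energy (u t) + NavierStokes.dissipation G t = NavierStokes.energy u₀ := by
  rcases h with ⟨p, q, hpq, hq, h0, h1, h2⟩ | ⟨p, q, hpq, h0, h1, h2⟩ | ⟨S, hS, hS'⟩
  · have h : ∀ i : Fin 3, i ≠ 2 → NavierStokes.MemLpLq T p q (fun t x => u t x i) := by
      intro i hi
      fin_cases i
      exacts [h0, h1, absurd rfl hi]
    have h4 := fun i hi => hu.lintegral_four_lt_top_of_shinbrot hpq (h i hi)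
    obtain ⟨a, ha, rfl, rfl⟩ := hpq.exists_real hq
    refine hu.energy_equality_of_dual hT (by linarith) (Or.inr ⟨_, ?_, rfl⟩) h h2 h4
    -- The time exponent `2a/(a-2)` exceeds `2` because `q` is finite.
    rw [lt_div_iff₀ (by linarith)]
    linarith
  · have h : ∀ i : Fin 3, i ≠ 2 → NavierStokes.MemLpLq T p q (fun t x => u t x i) := by
      intro i hi
      fin_cases i
      exacts [h0, h1, absurd rfl hi]
    have h4 := fun i hi => hu.lintegral_four_lt_top_of_beiraoDaVeigaYang hpq (h i hi)
    obtain ⟨a, ha, rfl, ⟨rfl, rfl⟩ | ⟨ha3, rfl⟩⟩ := hpq.exists_real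
    · exact hu.energy_equality_of_dual hT (by norm_num) (Or.inl rfl) h h2 h4
    · refine hu.energy_equality_of_dual hT (by linarith) (Or.inr ⟨_, ?_, rfl⟩) h h2 h4
      -- Here `a/(a-3) > 2` amounts to `a < 6`, which follows from `a ≤ 4`.
      rw [lt_div_iff₀ (by linarith)]
      linarith
  · refine hu.energy_equality_of_four hT fun i => ?_
    by_cases hi : i ∈ S
    · obtain ⟨p, q, hpq, h⟩ := hS i hi
      exact hu.lintegral_four_lt_top_of_shinbrot hpq h
    · obtain ⟨p, q, hpq, h⟩ := hS' i hi
      exact hu.lintegral_four_lt_top_of_beiraoDaVeigaYang hpq h
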